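/- **The algebra.** Let $\mathbb{C}(q)$ be the field of rational functions in a variable $q$. For $n\ge 0$ let $\mathcal{R}_n$ be the generic mirabolic Hecke algebra: the $\mathbb{C}(q)$-algebra with generators $T_0,T_1,\dots,T_{n-1}$ and (whenever the indices involved are among $0,\dots,n-1$) relations $$T_0^2=(q-2)T_0+(q-1),\qquad T_i^2=(q-1)T_i+q\ (i\ge1),\qquad T_iT_{i+1}T_i=T_{i+1}T_iT_{i+1}\ (i\ge1),$$ $$T_0T_1T_0T_1=(q-1)(T_1T_0T_1+T_1T_0)-T_0T_1T_0,\qquad T_1T_0T_1T_0=(q-1)(T_1T_0T_1+T_0T_1)-T_0T_1T_0,$$ $$T_iT_j=T_jT_i\ (|i-j|\ge2).$$ Put $e=q^{-1}(T_0+1)$. Let $\mathcal{R}_n\text{-Mod}$ be the category of finitely generated left $\mathcal{R}_n$-modules. For $n\ge1$, $\mathcal{R}_n$-modules are restricted to $\mathcal{R}_{n-1}$ along the homomorphism $T_i\mapsto T_i$, whose image commutes with $L_n=q^{1-n}T_{n-1}\cdots T_1\,e\,T_1\cdots T_{n-1}\in\mathcal{R}_n$. **The functors.** For $n\ge 1$,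 $M\in\mathcal{R}_n\text{-Mod}$ and $\alpha\in\mathbb{C}(q)$, let $M(\alpha)\in\mathcal{R}_{n-1}\text{-Mod}$ be the generalized $\alpha$-eigenspace of $L_n$ on $M$. Let $i\text{-Res}^n_{n-1}:\mathcal{R}_n\text{-Mod}\to\mathcal{R}_{n-1}\text{-Mod}$ be the functor $M\mapsto M(q^i)$ for $i\in\mathbb{Z}$, and $M\mapsto M(0)$ for $i=\infty$. **The modules.** For a partition $\lambda$ and $k\ge0$ with $|\lambda|+k=n$, let $M^{(\lambda,1^k)}$ be the $\mathcal{R}_n$-module with $\mathbb{C}(q)$-basis $v_U$ indexed by the standard bitableaux $U=(U^1,U^2)$ of shape $(\lambda,1^k)$ with entries $1,\dots,n$ (here $1^k$ is the diagram with a single column of $k$ boxes). The action is as follows. One has $e\,v_U=v_U$ if $1\in U^1$ and $e\,v_U=0$ if $1\in U^2$. For $1\le i\le n-1$, $T_iv_U$ equals: $q\,v_U$ if $i,i+1$ are in the same row of the same tableau; $-v_U$ if they are in the same column of the same tableau; $\frac{q-1}{1-q^d}v_U+\bigl(1+\frac{q-1}{1-q^d}\bigr)v_{s_iU}$ with $d=c_U(i)-c_U(i+1)$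 if they are in the same tableau but not in the same row or column; $v_{s_iU}$ if $i\in U^1$, $i+1\in U^2$; and $(q-1)v_U+q\,v_{s_iU}$ if $i\in U^2$, $i+1\in U^1$. Here $s_iU$ is $U$ with $i$ and $i+1$ exchanged, the content of a box of a diagram is its column number minus its row number, and $c_U(j)$ is the content of the box containing $j$, increased by $1$ if $j\in U^2$. **Statement.** Let $n\ge1$ and $i\in\mathbb{Z}\cup\{\infty\}$. The functor $i\text{-Res}^n_{n-1}$ has a left adjoint $i\text{-Ind}^n_{n-1}$ and a right adjoint $i\text{-}\widehat{\mathrm{Ind}}{}^n_{n-1}$, both $\mathcal{R}_{n-1}\text{-Mod}\to\mathcal{R}_n\text{-Mod}$, and any such adjoints have the following properties. 1. Let $\lambda$ be a partition and $k\ge0$ with $|\lambda|+k=n-1$. Then $M^{(\lambda,1^k)}$ is an irreducible $\mathcal{R}_{n-1}$-module, and: (i) If $i\in\mathbb{Z}$, there is at most one partition $\lambda[i^+]$ obtained from $\lambda$ by adding a box of content $i$. If it exists, then $$i\text{-Ind}^n_{n-1}M^{(\lambda,1^k)}\cong i\text{-}\widehat{\mathrm{Ind}}{}^n_{n-1}M^{(\lambda,1^k)}\cong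 M^{(\lambda[i^+],1^k)};$$ if it does not exist, both $i\text{-Ind}^n_{n-1}M^{(\lambda,1^k)}$ and $i\text{-}\widehat{\mathrm{Ind}}{}^n_{n-1}M^{(\lambda,1^k)}$ are zero. (ii) If $i=\infty$, then $$\infty\text{-Ind}^n_{n-1}M^{(\lambda,1^k)}\cong \infty\text{-}\widehat{\mathrm{Ind}}{}^n_{n-1}M^{(\lambda,1^k)}\cong M^{(\lambda,1^{k+1})}.$$ 2. There is an isomorphism of functors $i\text{-Ind}^n_{n-1}\simeq i\text{-}\widehat{\mathrm{Ind}}{}^n_{n-1}$, and both functors are exact. -/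

import Mathlib

open CategoryTheory

namespace Mirabolic

noncomputable section

/-- The field `ℂ(q)` of rational functions in one variable. -/
abbrev K : Type := RatFunc ℂ

/-- The variable `q` of `ℂ(q)`. -/
def q : K := RatFunc.X

/-! ### The generic mirabolic Hecke algebra -/

open FreeAlgebra (ι)

/-- The defining relations between the generators `T_0, …, T_{n-1}`. -/
inductive Rel (n : ℕ) : FreeAlgebra K (Fin n) → FreeAlgebra K (Fin n) → Prop
  | zero (i : Fin n) (hi : i.val = 0) :
      Rel n (ι K i * ι K i) ((q - 2) • ι K i + (q - 1) • 1)
  | quad (i : Fin n) (hi : 1 ≤ i.val) :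
      Rel n (ι K i * ι K i) ((q - 1) • ι K i + q • 1)
  | braid (i j : Fin n) (hi : 1 ≤ i.val) (hj : j.val = i.val + 1) :
      Rel n (ι K i * ι K j * ι K i) (ι K j * ι K i * ι K j)
  | four (i j : Fin n) (hi : i.val = 0) (hj : j.val = 1) :
      Rel n (ι K i * ι K j * ι K i * ι K j)
        ((q - 1) • (ι K j * ι K i * ι K j + ι K j * ι K i) - ι K i * ι K j * ι K i)
  | four' (i j : Fin n) (hi : i.val = 0) (hj : j.val = 1) :
      Rel n (ι K j * ι K i * ι K j * ι K i)
        ((q - 1) • (ι K j * ι K i * ι K j + ι K i * ι K j) - ι K i * ι K j * ι K i)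
  | comm (i j : Fin n) (hij : i.val + 2 ≤ j.val ∨ j.val + 2 ≤ i.val) :
      Rel n (ι K i * ι K j) (ι K j * ι K i)

/-- The generic mirabolic Hecke algebra `R_n` over `ℂ(q)`. -/
abbrev R (n : ℕ) : Type := RingQuot (Rel n)

/-- The generator `T_i` of `R_n`, for `0 ≤ i ≤ n - 1`. -/
def T {n : ℕ} (i : Fin n) : R n := RingQuot.mkAlgHom K (Rel n) (ι K i)

/-- The universal property of `R_n`. -/
def lift {n : ℕ} {A : Type*} [Ring A] [Algebra K A] (t : Fin n → A)
    (h : ∀ a b, Rel n a b → FreeAlgebra.lift K t a = FreeAlgebra.lift K t b) : R n →ₐ[K] A :=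
  RingQuot.liftAlgHom K ⟨FreeAlgebra.lift K t, fun a b hab => h a b hab⟩

@[simp]
theorem lift_T {n : ℕ} {A : Type*} [Ring A] [Algebra K A] (t : Fin n → A)
    (h : ∀ a b, Rel n a b → FreeAlgebra.lift K t a = FreeAlgebra.lift K t b) (i : Fin n) :
    lift t h (T i) = t i := by
  simp [lift, T]

section relations

variable {n : ℕ}

theorem T_zero (i : Fin n) (hi : i.val = 0) :
    (T i * T i : R n) = (q - 2) • T i + (q - 1) • 1 := by
  simpa [T] using RingQuot.mkAlgHom_rel K (Rel.zero i hi)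

theorem T_quad (i : Fin n) (hi : 1 ≤ i.val) :
    (T i * T i : R n) = (q - 1) • T i + q • 1 := by
  simpa [T] using RingQuot.mkAlgHom_rel K (Rel.quad i hi)

theorem T_braid (i j : Fin n) (hi : 1 ≤ i.val) (hj : j.val = i.val + 1) :
    (T i * T j * T i : R n) = T j * T i * T j := by
  simpa [T] using RingQuot.mkAlgHom_rel K (Rel.braid i j hi hj)

theorem T_four (i j : Fin n) (hi : i.val = 0) (hj : j.val = 1) :
    (T i * T j * T i * T j : R n) = (q - 1) • (T j * T i * T j + T j * T i) - T i * T j * T i := by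
  simpa only [T, map_mul, map_add, map_sub, map_smul] using
    RingQuot.mkAlgHom_rel K (Rel.four i j hi hj)

theorem T_four' (i j : Fin n) (hi : i.val = 0) (hj : j.val = 1) :
    (T j * T i * T j * T i : R n) = (q - 1) • (T j * T i * T j + T i * T j) - T i * T j * T i := by
  simpa only [T, map_mul, map_add, map_sub, map_smul] using
    RingQuot.mkAlgHom_rel K (Rel.four' i j hi hj)

theorem T_comm (i j : Fin n) (hij : i.val + 2 ≤ j.val ∨ j.val + 2 ≤ i.val) :
    (T i * T j : R n) = T j * T i := by
  simpa [T] using RingQuot.mkAlgHom_rel K (Rel.comm i j hij)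

/-- A set of elements that contains `1` and is stable under linear combinations and under right
multiplication by the generators is everything. -/
theorem eq_top_of_mul_T (W : Submodule K (R n)) (h1 : (1 : R n) ∈ W)
    (hT : ∀ w ∈ W, ∀ i, w * T i ∈ W) : W = ⊤ := by
  rw [eq_top_iff]
  rintro x -
  obtain ⟨y, rfl⟩ := RingQuot.mkAlgHom_surjective K (Rel n) x
  have key : ∀ w ∈ W, w * RingQuot.mkAlgHom K (Rel n) y ∈ W := by
    induction y using FreeAlgebra.induction with
    | grade0 r => intro w hw; simpa [Algebra.algebraMap_eq_smul_one] using W.smul_mem r hw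
    | grade1 i => intro w hw; exact hT w hw i
    | mul a b ha hb => intro w hw; rw [map_mul, ← mul_assoc]; exact hb _ (ha w hw)
    | add a b ha hb => intro w hw; rw [map_add, mul_add]; exact W.add_mem (ha w hw) (hb w hw)
  simpa using key 1 h1

end relations

/-- The homomorphism `R_n → R_{n+1}` that sends `T_i` to `T_i`. -/
def incl (n : ℕ) : R n →ₐ[K] R (n + 1) :=
  lift (fun i => T i.castSucc) (by
    intro a b hab
    cases hab with
    | zero i hi => simpa using T_zero i.castSucc hi
    | quad i hi => simpa using T_quad i.castSucc hi
    | braid i j hi hj => simpa using T_braid i.castSucc j.castSucc hi hj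
    | four i j hi hj => simpa using T_four i.castSucc j.castSucc hi hj
    | four' i j hi hj => simpa using T_four' i.castSucc j.castSucc hi hj
    | comm i j hij => simpa using T_comm i.castSucc j.castSucc hij)

@[simp]
theorem incl_T {n : ℕ} (i : Fin n) : incl n (T i) = T i.castSucc := by
  simp [incl]

/-! ### Jucys–Murphy elements -/

/-- The idempotent `e = q⁻¹ (T_0 + 1)` of `R_{n+1}`. -/
def e (n : ℕ) : R (n + 1) := q⁻¹ • (T 0 + 1)

/-- The Jucys–Murphy element `L_{j+1} = q^{-j} T_j ⋯ T_1 e T_1 ⋯ T_j` of `R_{n+1}`, defined by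
`L_1 = e` and `L_{j+1} = q⁻¹ T_j L_j T_j`. -/
def jm (n : ℕ) : (j : ℕ) → j < n + 1 → R (n + 1)
  | 0, _ => e n
  | j + 1, h => q⁻¹ • (T ⟨j + 1, h⟩ * jm n j (Nat.lt_of_succ_lt h) * T ⟨j + 1, h⟩)

theorem q_ne_zero : q ≠ 0 := RatFunc.X_ne_zero

theorem e_comm (n : ℕ) (m : Fin (n + 1)) (hm : 2 ≤ m.val) : Commute (T m) (e n) := by
  have : Commute (T m) (T 0 : R (n + 1)) := T_comm m 0 (Or.inr (by simpa using hm))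
  exact ((this.add_right (Commute.one_right _)).smul_right _)

theorem jm_comm_high (n : ℕ) (j : ℕ) (h : j < n + 1) (m : Fin (n + 1)) (hm : j + 2 ≤ m.val) :
    Commute (T m) (jm n j h) := by
  induction j with
  | zero => exact e_comm n m (by omega)
  | succ j ih =>
    have h1 : Commute (T m) (T ⟨j + 1, h⟩ : R (n + 1)) := T_comm _ _ (Or.inr (by simpa using hm))
    exact (((h1.mul_right (ih _ (by omega))).mul_right h1).smul_right _)

theorem jm_comm_low (n : ℕ) (j : ℕ) (h : j < n + 1) (m : Fin (n + 1)) (hm : m.val < j) :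
    Commute (T m) (jm n j h) := by
  induction j with
  | zero => omega
  | succ j ih =>
    rw [jm]
    apply Commute.smul_right
    by_cases hmj : m.val < j
    · have h1 : Commute (T m) (T ⟨j + 1, h⟩ : R (n + 1)) :=
        T_comm _ _ (Or.inl (by simp only; omega))
      exact ((h1.mul_right (ih _ hmj)).mul_right h1)
    · have hmj : m.val = j := by omega
      cases j with
      | zero =>
        have hm0 : m = 0 := Fin.ext hmj
        subst hm0
        have h1 := T_four (n := n + 1) 0 ⟨1, h⟩ rfl rfl
        have h2 := T_four' (n := n + 1) 0 ⟨1, h⟩ rfl rfl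
        have h3 := T_quad (n := n + 1) ⟨1, h⟩ le_rfl
        rw [jm, e, Commute, SemiconjBy]
        simp only [zero_add, mul_smul_comm, smul_mul_assoc, mul_add, add_mul, mul_one]
        congr 1
        rw [← mul_assoc, ← mul_assoc, h1, h2, h3]
        simp only [mul_add, add_mul, mul_smul_comm, smul_mul_assoc, mul_one, one_mul, smul_add]
        abel
      | succ j =>
        have hm' : m = ⟨j + 1, by omega⟩ := Fin.ext hmj
        rw [hm']
        have hb := T_braid (n := n + 1) ⟨j + 1, by omega⟩ ⟨j + 2, h⟩ (by simp) rfl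
        have hc := (jm_comm_high n j (by omega) ⟨j + 2, h⟩ le_rfl).eq
        rw [jm, Commute, SemiconjBy]
        simp only [mul_smul_comm, smul_mul_assoc]
        congr 1
        set s := (T ⟨j + 1, by omega⟩ : R (n + 1))
        set t := (T ⟨j + 2, h⟩ : R (n + 1))
        set x := jm n j (by omega)
        calc s * (t * (s * x * s) * t) = (s * t * s) * x * (s * t) := by simp only [mul_assoc]
          _ = t * s * (t * x) * (s * t) := by rw [hb]; simp only [mul_assoc]
          _ = t * s * x * (t * s * t) := by rw [hc]; simp only [mul_assoc]
          _ = t * (s * x * s) * t * s := by rw [← hb]; simp only [mul_assoc]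

/-- The Jucys–Murphy element `L_{n+1}` of `R_{n+1}` commutes with the image of `R_n`. -/
theorem incl_comm (n : ℕ) (x : R n) : Commute (incl n x) (jm n n (Nat.lt_succ_self n)) := by
  let W : Submodule K (R n) :=
    { carrier := {x | Commute (incl n x) (jm n n (Nat.lt_succ_self n))}
      add_mem' := fun {a b} ha hb => by
        simp only [Set.mem_ofPred_eq, map_add] at *; exact ha.add_left hb
      zero_mem' := by simp
      smul_mem' := fun c a ha => by
        simp only [Set.mem_ofPred_eq, map_smul] at *; exact ha.smul_left c }
  have hW : W = ⊤ := eq_top_of_mul_T W (by simp [W]) (by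
    intro w hw i
    simp only [W, Submodule.mem_mk, AddSubmonoid.mem_mk, AddSubsemigroup.mem_mk,
      Set.mem_ofPred_eq, map_mul, incl_T] at *
    exact hw.mul_left (jm_comm_low n n _ _ (by simp)))
  have : x ∈ W := hW ▸ Submodule.mem_top
  exact this


/-! ### Finite dimensionality -/

section finite

variable (n : ℕ)

/-- The generator `T_j` of `R_{n+1}` with a natural number as its index. -/
def tt (j : ℕ) : R (n + 1) := if h : j < n + 1 then T ⟨j, h⟩ else 0

variable {n}

theorem tt_of_lt {j : ℕ} (h : j < n + 1) : tt n j = T ⟨j, h⟩ := dif_pos h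

theorem tt_zero : tt n 0 * tt n 0 = (q - 2) • tt n 0 + (q - 1) • 1 := by
  rw [tt_of_lt (by omega)]; exact T_zero _ rfl

theorem tt_quad {j : ℕ} (h1 : 1 ≤ j) (h : j ≤ n) :
    tt n j * tt n j = (q - 1) • tt n j + q • 1 := by
  rw [tt_of_lt (by omega)]; exact T_quad _ h1

theorem tt_braid {j : ℕ} (h1 : 1 ≤ j) (h : j + 1 ≤ n) :
    tt n j * tt n (j + 1) * tt n j = tt n (j + 1) * tt n j * tt n (j + 1) := by
  rw [tt_of_lt (by omega), tt_of_lt (by omega)]; exact T_braid _ _ h1 rfl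

theorem tt_four' (h : 1 ≤ n) :
    tt n 1 * tt n 0 * tt n 1 * tt n 0 =
      (q - 1) • (tt n 1 * tt n 0 * tt n 1 + tt n 0 * tt n 1) - tt n 0 * tt n 1 * tt n 0 := by
  rw [tt_of_lt (by omega), tt_of_lt (by omega)]; exact T_four' _ _ rfl rfl

theorem tt_comm {i j : ℕ} (h : i + 2 ≤ j ∨ j + 2 ≤ i) : tt n i * tt n j = tt n j * tt n i := by
  unfold tt
  split_ifs <;> first | exact T_comm _ _ h | simp

variable (n) in
/-- `T_n T_{n-1} ⋯ T_{n-k+1}`. -/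
def dd : ℕ → R (n + 1)
  | 0 => 1
  | k + 1 => dd k * tt n (n - k)

variable (n) in
/-- `T_n ⋯ T_1 T_0 T_1 ⋯ T_j`. -/
def cc : ℕ → R (n + 1)
  | 0 => dd n n * tt n 0
  | j + 1 => cc j * tt n (j + 1)

theorem dd_low {k i : ℕ} (h : i + k + 1 ≤ n) : dd n k * tt n i = tt n i * dd n k := by
  induction k with
  | zero => simp [dd]
  | succ k ih =>
    rw [dd, mul_assoc, ← tt_comm (Or.inl (by omega)), ← mul_assoc, ih (by omega), mul_assoc]

theorem dd_high {k i : ℕ} (hk : k ≤ n) (h : n + 2 ≤ i + k) (hi : i ≤ n) :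
    dd n k * tt n i = tt n (i - 1) * dd n k := by
  induction k with
  | zero => omega
  | succ k ih =>
    by_cases hik : i + k = n + 1
    · obtain ⟨k, rfl⟩ : ∃ l, k = l + 1 := ⟨k - 1, by omega⟩
      obtain ⟨i, rfl⟩ : ∃ l, i = l + 1 := ⟨i - 1, by omega⟩
      have e1 : n - (k + 1) = i := by omega
      have e2 : n - k = i + 1 := by omega
      rw [dd, dd, e1, e2, Nat.add_sub_cancel, mul_assoc, mul_assoc, ← mul_assoc (tt n (i + 1)),
        ← tt_braid (by omega) (by omega), ← mul_assoc, ← mul_assoc, dd_low (by omega)]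
      simp only [mul_assoc]
    · rw [dd, mul_assoc, tt_comm (Or.inl (by omega)), ← mul_assoc, ih (by omega) (by omega),
        mul_assoc]

theorem cc_high {j i : ℕ} (h : j + 2 ≤ i) (hi : i ≤ n) :
    cc n j * tt n i = tt n (i - 1) * cc n j := by
  induction j with
  | zero =>
    rw [cc, mul_assoc, tt_comm (Or.inl (by omega)), ← mul_assoc,
      dd_high le_rfl (by omega) hi, mul_assoc]
  | succ j ih =>
    rw [cc, mul_assoc, tt_comm (Or.inl (by omega)), ← mul_assoc, ih (by omega), mul_assoc]

theorem cc_low {j i : ℕ} (h1 : 1 ≤ i) (h : i < j) (hj : j ≤ n) :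
    cc n j * tt n i = tt n i * cc n j := by
  induction j with
  | zero => omega
  | succ j ih =>
    by_cases hij : i < j
    · rw [cc, mul_assoc, tt_comm (Or.inr (by omega)), ← mul_assoc, ih hij (by omega), mul_assoc]
    · obtain ⟨j, rfl⟩ : ∃ l, j = l + 1 := ⟨j - 1, by omega⟩
      have hij' : i = j + 1 := by omega
      subst hij'
      rw [cc, cc, mul_assoc, mul_assoc, ← mul_assoc (tt n (j + 1)),
        tt_braid (by omega) (by omega), ← mul_assoc, ← mul_assoc, cc_high le_rfl (by omega)]
      have e1 : j + 2 - 1 = j + 1 := by omega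
      rw [e1]
      simp only [mul_assoc]

variable (n) in
/-- The image of `R_n` in `R_{n+1}`, as a subspace. -/
def im : Submodule K (R (n + 1)) := LinearMap.range (incl n).toLinearMap

variable (n) in
/-- The span of the coset representatives. -/
def reps : Submodule K (R (n + 1)) :=
  Submodule.span K (dd n '' Set.Iic n ∪ cc n '' Set.Iic n)

theorem tt_mem_im {i : ℕ} (h : i < n) : tt n i ∈ im n :=
  ⟨T ⟨i, h⟩, by rw [tt_of_lt (by omega)]; simp⟩

theorem one_mem_im : (1 : R (n + 1)) ∈ im n := ⟨1, by simp⟩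

theorem im_mul {x y : R (n + 1)} (hx : x ∈ im n) (hy : y ∈ im n * reps n) :
    x * y ∈ im n * reps n := by
  have him : im n * im n ≤ im n := by
    rw [Submodule.mul_le]
    rintro _ ⟨a, rfl⟩ _ ⟨b, rfl⟩
    exact ⟨a * b, by simp⟩
  have := Submodule.mul_mem_mul hx hy
  rw [← mul_assoc] at this
  exact mul_le_mul' him le_rfl this

theorem reps_le {x : R (n + 1)} (hx : x ∈ reps n) : x ∈ im n * reps n := by
  simpa using Submodule.mul_mem_mul (one_mem_im (n := n)) hx

theorem dd_mem {k : ℕ} (hk : k ≤ n) : dd n k ∈ im n * reps n :=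
  reps_le (Submodule.subset_span (Or.inl ⟨k, hk, rfl⟩))

theorem cc_mem {k : ℕ} (hk : k ≤ n) : cc n k ∈ im n * reps n :=
  reps_le (Submodule.subset_span (Or.inr ⟨k, hk, rfl⟩))

theorem dd_mul {k i : ℕ} (hk : k ≤ n) (hi : i ≤ n) : dd n k * tt n i ∈ im n * reps n := by
  rcases lt_trichotomy (i + k) n with h | h | h
  · rw [dd_low (by omega)]
    exact im_mul (tt_mem_im (by omega)) (dd_mem hk)
  · rcases Nat.lt_or_ge k n with hkn | hkn
    · have : dd n (k + 1) = dd n k * tt n i := by rw [dd]; congr 2; omega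
      rw [← this]; exact dd_mem hkn
    · obtain rfl : k = n := by omega
      obtain rfl : i = 0 := by omega
      exact cc_mem (k := 0) (by omega)
  · by_cases h' : i + k = n + 1
    · obtain ⟨k, rfl⟩ : ∃ l, k = l + 1 := ⟨k - 1, by omega⟩
      have e1 : n - k = i := by omega
      have h2 : dd n (k + 1) * tt n i = (q - 1) • dd n (k + 1) + q • dd n k := by
        rw [dd, e1, mul_assoc, tt_quad (by omega) hi, mul_add]; simp
      rw [h2]
      exact Submodule.add_mem _ (Submodule.smul_mem _ _ (dd_mem hk))
        (Submodule.smul_mem _ _ (dd_mem (by omega)))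
    · rw [dd_high hk (by omega) hi]
      exact im_mul (tt_mem_im (by omega)) (dd_mem hk)

theorem cc_mul_pos {j i : ℕ} (hj : j ≤ n) (h1 : 1 ≤ i) (hi : i ≤ n) :
    cc n j * tt n i ∈ im n * reps n := by
  rcases lt_trichotomy i j with h | h | h
  · rw [cc_low h1 h hj]
    exact im_mul (tt_mem_im (by omega)) (cc_mem hj)
  · subst h
    obtain ⟨k, rfl⟩ : ∃ l, i = l + 1 := ⟨i - 1, by omega⟩
    have h2 : cc n (k + 1) * tt n (k + 1) = (q - 1) • cc n (k + 1) + q • cc n k := by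
      rw [cc, mul_assoc, tt_quad (by omega) hi, mul_add]; simp
    rw [h2]
    exact Submodule.add_mem _ (Submodule.smul_mem _ _ (cc_mem hj))
      (Submodule.smul_mem _ _ (cc_mem (by omega)))
  · by_cases h' : i = j + 1
    · subst h'; exact cc_mem (k := j + 1) hi
    · rw [cc_high (by omega) hi]
      exact im_mul (tt_mem_im (by omega)) (cc_mem hj)

theorem mul_pos_mem {w : R (n + 1)} (hw : w ∈ im n * reps n) {i : ℕ} (hi : i ≤ n)
    (hc : ∀ j ≤ n, cc n j * tt n i ∈ im n * reps n) : w * tt n i ∈ im n * reps n := by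
  induction hw using Submodule.mul_induction_on' with
  | mem_mul_mem x hx y hy =>
    rw [mul_assoc]
    refine im_mul hx ?_
    induction hy using Submodule.span_induction with
    | mem z hz =>
      rcases hz with ⟨k, hk, rfl⟩ | ⟨k, hk, rfl⟩
      · exact dd_mul hk hi
      · exact hc k hk
    | zero => simp
    | add a b _ _ ha hb => rw [add_mul]; exact Submodule.add_mem _ ha hb
    | smul c a _ ha => rw [smul_mul_assoc]; exact Submodule.smul_mem _ _ ha
  | add a _ b _ ha hb => rw [add_mul]; exact Submodule.add_mem _ ha hb

theorem cc_mul_zero {j : ℕ} (hj : j ≤ n) : cc n j * tt n 0 ∈ im n * reps n := by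
  induction j with
  | zero =>
    rw [cc, mul_assoc, tt_zero, mul_add, mul_smul_comm, mul_smul_comm, mul_one]
    exact Submodule.add_mem _ (Submodule.smul_mem _ _ (cc_mem (k := 0) (by omega)))
      (Submodule.smul_mem _ _ (dd_mem le_rfl))
  | succ j ih =>
    cases j with
    | zero =>
      obtain ⟨m, rfl⟩ : ∃ l, n = l + 1 := ⟨n - 1, by omega⟩
      have e1 : dd (m + 1) (m + 1) = dd (m + 1) m * tt (m + 1) 1 := by
        rw [dd]; congr 2; omega
      have e0 := dd_low (n := m + 1) (k := m) (i := 0) (by omega)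
      have h2 : cc (m + 1) (0 + 1) * tt (m + 1) 0 =
          (q - 1) • (cc (m + 1) 1 + tt (m + 1) 0 * dd (m + 1) (m + 1))
            - tt (m + 1) 0 * cc (m + 1) 0 := by
        have h4 := congrArg (fun z => dd (m + 1) m * z) (tt_four' (n := m + 1) (by omega))
        simp only [mul_sub, mul_smul_comm, mul_add, ← mul_assoc, e0] at h4
        simp only [cc, e1, zero_add, smul_add, ← mul_assoc, h4]
      rw [h2]
      exact Submodule.sub_mem _ (Submodule.smul_mem _ _ (Submodule.add_mem _ (cc_mem hj)
        (im_mul (tt_mem_im (by omega)) (dd_mem le_rfl))))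
        (im_mul (tt_mem_im (by omega)) (cc_mem (by omega)))
    | succ j =>
      have h2 : cc n (j + 1 + 1) * tt n 0 = cc n (j + 1) * tt n 0 * tt n (j + 2) := by
        rw [cc, mul_assoc, mul_assoc, tt_comm (i := 0) (Or.inl (by omega))]
      rw [h2]
      exact mul_pos_mem (ih (by omega)) hj (fun k hk => cc_mul_pos hk (by omega) hj)

theorem im_mul_reps : im n * reps n = ⊤ := by
  apply eq_top_of_mul_T
  · exact dd_mem (k := 0) (by omega)
  · intro w hw i
    have hi : tt n i.val = T i := tt_of_lt i.isLt
    rw [← hi]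
    refine mul_pos_mem hw (by omega) (fun j hj => ?_)
    rcases Nat.eq_zero_or_pos i.val with h | h
    · rw [h]; exact cc_mul_zero hj
    · exact cc_mul_pos hj h (by omega)

end finite

/-- The algebra `R_n` is finite dimensional over `ℂ(q)`. -/
instance finite_R (n : ℕ) : Module.Finite K (R n) := by
  induction n with
  | zero =>
    refine ⟨⟨{1}, ?_⟩⟩
    apply eq_top_of_mul_T
    · exact Submodule.subset_span (by simp)
    · intro w _ i; exact i.elim0
  | succ n ih =>
    refine ⟨?_⟩
    rw [← im_mul_reps]
    refine Submodule.FG.mul ?_ ?_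
    · exact Module.Finite.iff_fg.1 (Module.Finite.range (incl n).toLinearMap)
    · exact Submodule.fg_span (((Set.finite_Iic n).image _).union ((Set.finite_Iic n).image _))

instance noetherian_R (n : ℕ) : IsNoetherianRing (R n) := isNoetherian_of_tower K inferInstance


/-! ### Refined restriction functors -/

/-- The possible eigenvalues of a Jucys–Murphy element: `q ^ i` for `i ∈ ℤ` and `0` for
`i = ∞ = ⊤`. -/
def eigenvalue (i : WithTop ℤ) : K := i.recTopCoe 0 (fun j => q ^ j)

/-- The restriction of an `R_{n+1}`-module to `R_n`. -/
abbrev res (n : ℕ) : ModuleCat.{0} (R (n + 1)) ⥤ ModuleCat.{0} (R n) :=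
  ModuleCat.restrictScalars (incl n).toRingHom

/-- The generalized eigenspace `M(a)` of `L_{n+1}` on an `R_{n+1}`-module `M`, as an
`R_n`-submodule. -/
def genEigenspace (n : ℕ) (a : K) (M : ModuleCat.{0} (R (n + 1))) :
    Submodule (R n) ((res n).obj M) where
  carrier := {m | ∃ k : ℕ,
    (((jm n n (Nat.lt_succ_self n) - algebraMap K (R (n + 1)) a) ^ k • (m : M) : M)) = 0}
  add_mem' := by
    rintro x y ⟨k, hk⟩ ⟨l, hl⟩
    refine ⟨k + l, ?_⟩
    erw [smul_add]
    rw [pow_add, mul_smul, mul_smul, hl, smul_zero, ← mul_smul, ← pow_add, add_comm k l, pow_add,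
      mul_smul, hk, smul_zero, add_zero]
  zero_mem' := ⟨0, smul_zero _⟩
  smul_mem' := by
    rintro c x ⟨k, hk⟩
    refine ⟨k, ?_⟩
    have hc : Commute (incl n c)
        ((jm n n (Nat.lt_succ_self n) - algebraMap K (R (n + 1)) a) ^ k) :=
      ((incl_comm n c).sub_right (Algebra.commutes a _).symm).pow_right k
    erw [ModuleCat.restrictScalars.smul_def]
    erw [← mul_smul, ← hc.eq, mul_smul, hk, smul_zero]

theorem finite_genEigenspace (n : ℕ) (a : K) (M : ModuleCat.{0} (R (n + 1)))
    (hM : Module.Finite (R (n + 1)) M) : Module.Finite (R n) (genEigenspace n a M) := by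
  let : Module K M := Module.compHom M (algebraMap K (R (n + 1)))
  have : IsScalarTower K (R (n + 1)) M := ⟨fun x y z => by
    rw [Algebra.smul_def, mul_smul]; rfl⟩
  have : Module.Finite K M := Module.Finite.trans (R (n + 1)) M
  let : Module K ((res n).obj M) := inferInstanceAs (Module K M)
  have : Module.Finite K ((res n).obj M) := inferInstanceAs (Module.Finite K M)
  have : IsScalarTower K (R n) ((res n).obj M) := ⟨fun x y z => by
    rw [Algebra.smul_def, mul_smul]
    change incl n (algebraMap K (R n) x) • (y • z) = _
    rw [AlgHom.commutes]; rfl⟩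
  have : IsNoetherian (R n) ((res n).obj M) := isNoetherian_of_tower K inferInstance
  infer_instance

/-- The refined restriction functor `i-Res` from finitely generated `R_{n+1}`-modules to finitely
generated `R_n`-modules, for `i ∈ ℤ ∪ {∞}`: it sends `M` to the generalized eigenspace
`M(q ^ i)`, and to `M(0)` if `i = ∞`. -/
def iRes (n : ℕ) (i : WithTop ℤ) : FGModuleCat.{0} (R (n + 1)) ⥤ FGModuleCat.{0} (R n) where
  obj M :=
    haveI := finite_genEigenspace n (eigenvalue i) M.obj M.property
    FGModuleCat.of (R n) (genEigenspace n (eigenvalue i) M.obj)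
  map {M N} f :=
    haveI := finite_genEigenspace n (eigenvalue i) M.obj M.property
    haveI := finite_genEigenspace n (eigenvalue i) N.obj N.property
    FGModuleCat.ofHom (((res n).map f.hom).hom.restrict (by
      rintro x ⟨k, hk⟩
      refine ⟨k, ?_⟩
      have := (f.hom.hom.map_smul
        ((jm n n (Nat.lt_succ_self n) - algebraMap K (R (n + 1)) (eigenvalue i)) ^ k) x).symm
      exact this.trans ((congrArg _ hk).trans (map_zero _))))
  map_id M := rfl
  map_comp f g := rfl


/-! ### The modules attached to bipartitions -/

/-- A box `(t, r, c)` lies in row `r` and column `c` of the first (`t = 0`) or second (`t = 1`)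
diagram of a bipartition; rows and columns are numbered from `0`. -/
abbrev Box : Type := Fin 2 × ℕ × ℕ

/-- The content of a box. -/
def content (b : Box) : ℤ := (b.1.val : ℤ) + ((b.2.2 : ℤ) - (b.2.1 : ℤ))

/-- `U` is a standard bitableau of shape `(lam, mu)` with entries `1, …, n`, where `U j` is the
box that contains the number `j + 1`. -/
structure IsStandard {n : ℕ} (lam mu : YoungDiagram) (U : Fin n → Box) : Prop where
  inj : Function.Injective U
  shape : ∀ b : Box, (∃ j, U j = b) ↔ b.2 ∈ (if b.1 = 0 then lam else mu)
  row : ∀ i j, (U i).1 = (U j).1 → (U i).2.1 = (U j).2.1 → (U i).2.2 < (U j).2.2 → i < j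
  col : ∀ i j, (U i).1 = (U j).1 → (U i).2.2 = (U j).2.2 → (U i).2.1 < (U j).2.1 → i < j

/-- The set of standard bitableaux of shape `(lam, mu)` with `n` boxes. It is empty if `n` is not
the number of boxes of `(lam, mu)`. -/
abbrev StdTab (n : ℕ) (lam mu : YoungDiagram) : Type := {U : Fin n → Box // IsStandard lam mu U}

/-- The vector space with basis the standard bitableaux of shape `(lam, mu)`. -/
abbrev V (n : ℕ) (lam mu : YoungDiagram) : Type := StdTab n lam mu →₀ K

section seminormal

variable {n : ℕ} {lam mu : YoungDiagram}

open Classical in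
variable (lam mu) in
/-- The basis vector of a standard bitableau `U`, extended by `0` to all fillings. -/
def vec (U : Fin n → Box) : V n lam mu :=
  if h : IsStandard lam mu U then Finsupp.single ⟨U, h⟩ 1 else 0

/-- The predecessor of an index. -/
def prev (i : Fin n) : Fin n := ⟨i.val - 1, lt_of_le_of_lt (Nat.sub_le _ _) i.isLt⟩

variable (lam mu) in
/-- The vector `T_i v_U`, for `1 ≤ i ≤ n - 1`. The numbers `i` and `i + 1` are in the boxes
`U (i - 1)` and `U i`, because the entries of `U` are indexed from `0`. -/
def actT (i : Fin n) (U : Fin n → Box) : V n lam mu :=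
  let b := U (prev i)
  let b' := U i
  let sU := U ∘ Equiv.swap (prev i) i
  if b.1 = b'.1 then
    if b.2.1 = b'.2.1 then q • vec lam mu U
    else if b.2.2 = b'.2.2 then - vec lam mu U
    else ((q - 1) / (1 - q ^ (content b - content b'))) • vec lam mu U
      + (1 + (q - 1) / (1 - q ^ (content b - content b'))) • vec lam mu sU
  else if b.1 = 0 then vec lam mu sU
  else (q - 1) • vec lam mu U + q • vec lam mu sU

variable (lam mu) in
/-- The vector `e v_U`, with `e = q⁻¹ (T_0 + 1)`: it is `v_U` if the number `1` is in the first
tableau, and `0` otherwise. -/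
def actE (i : Fin n) (U : Fin n → Box) : V n lam mu :=
  if (U i).1 = 0 then vec lam mu U else 0

variable (lam mu) in
/-- The action of the generator `T_i` on the span of the standard bitableaux, for `i ≥ 1`. -/
def opT (i : Fin n) : Module.End K (V n lam mu) :=
  Finsupp.linearCombination K (fun U : StdTab n lam mu => actT lam mu i U.1)

variable (lam mu) in
/-- The action of `e = q⁻¹ (T_0 + 1)` on the span of the standard bitableaux. -/
def opE (i : Fin n) : Module.End K (V n lam mu) :=
  Finsupp.linearCombination K (fun U : StdTab n lam mu => actE lam mu i U.1)

variable (lam mu) in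
/-- The action of the generator `T_i` on the span of the standard bitableaux, for `i ≥ 0`,
where `T_0 = q e - 1`. -/
def op (i : Fin n) : Module.End K (V n lam mu) :=
  if i.val = 0 then q • opE lam mu i - 1 else opT lam mu i

theorem vec_of (U : Fin n → Box) (h : IsStandard lam mu U) :
    vec lam mu U = Finsupp.single ⟨U, h⟩ 1 := dif_pos h

theorem vec_of_not (U : Fin n → Box) (h : ¬ IsStandard lam mu U) : vec lam mu U = 0 := dif_neg h

theorem hom_ext' {A : Type*} [AddCommGroup A] [Module K A] {f g : V n lam mu →ₗ[K] A}
    (h : ∀ U, IsStandard lam mu U → f (vec lam mu U) = g (vec lam mu U)) : f = g := by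
  apply Finsupp.lhom_ext'
  rintro ⟨U, hU⟩
  apply LinearMap.ext_ring
  have := h U hU
  rw [vec_of U hU] at this
  exact this

theorem q_zpow_ne_one {k : ℤ} (hk : k ≠ 0) : q ^ k ≠ 1 := by
  have key : ∀ m : ℕ, m ≠ 0 → q ^ m ≠ 1 := by
    intro m hm h
    have h2 : algebraMap (Polynomial ℂ) K (Polynomial.X ^ m) = algebraMap (Polynomial ℂ) K 1 := by
      rw [map_pow, RatFunc.algebraMap_X, map_one]; exact h
    have h3 := RatFunc.algebraMap_injective ℂ h2
    have h4 := congrArg Polynomial.natDegree h3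
    simp at h4
    exact hm h4
  rcases Int.lt_or_gt_of_ne hk with h | h
  · obtain ⟨m, rfl⟩ : ∃ m : ℕ, k = -(m : ℤ) := ⟨k.natAbs, by omega⟩
    rw [zpow_neg, zpow_natCast, Ne, inv_eq_one]
    exact key m (by omega)
  · obtain ⟨m, rfl⟩ : ∃ m : ℕ, k = (m : ℤ) := ⟨k.natAbs, by omega⟩
    rw [zpow_natCast]
    exact key m (by omega)

/-- `b` is weakly to the left of and above `b'` in the same diagram. -/
def Below (b b' : Box) : Prop := b.1 = b'.1 ∧ b.2 ≤ b'.2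

/-- The diagonal coefficient of the seminormal form. -/
def cf (b b' : Box) : K :=
  if b.1 = b'.1 then (q - 1) / (1 - q ^ (content b - content b')) else if b.1 = 0 then 0 else q - 1

/-- Two boxes that are not on the same diagonal of the same diagram. -/
def Apart (b b' : Box) : Prop := b.1 = b'.1 → content b ≠ content b'

theorem Apart.symm {b b' : Box} (h : Apart b b') : Apart b' b := fun h1 h2 => h h1.symm h2.symm

theorem cf_den {b b' : Box} (h : Apart b b') (h1 : b.1 = b'.1) :
    1 - q ^ (content b - content b') ≠ 0 := by
  rw [sub_ne_zero]
  exact (q_zpow_ne_one (sub_ne_zero.2 (h h1))).symm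

theorem cf_symm {b b' : Box} (h : Apart b b') : cf b' b = q - 1 - cf b b' := by
  unfold cf
  by_cases h1 : b.1 = b'.1
  · rw [if_pos h1, if_pos h1.symm]
    have d1 := cf_den h h1
    have d2 := cf_den h.symm h1.symm
    have e1 : q ^ (content b' - content b) = (q ^ (content b - content b'))⁻¹ := by
      rw [← zpow_neg]; congr 1; ring
    rw [e1] at d2 ⊢
    have d3 : q ^ (content b - content b') ≠ 0 := zpow_ne_zero _ q_ne_zero
    generalize q ^ (content b - content b') = x at *
    have d4 : x - 1 ≠ 0 := fun h => d1 (by linear_combination -h)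
    have d5 : 1 - x⁻¹ = (x - 1) / x := by field_simp
    rw [d5]
    field_simp
    ring
  · rw [if_neg h1, if_neg (Ne.symm h1)]
    have := b.1.isLt
    have := b'.1.isLt
    by_cases h2 : b.1 = 0
    · have h3 : b'.1 ≠ 0 := fun h => h1 (h2.trans h.symm)
      simp [h2, h3]
    · have h3 : b'.1 = 0 := by
        by_contra h; exact h1 (by omega)
      simp [h2, h3]

theorem cf_triple {x y z : Box} (h1 : Apart x y) (h2 : Apart y z) (h3 : Apart x z) :
    cf x y * cf y z = cf x z * (cf x y + cf y z - (q - 1)) := by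
  have hx := x.1.isLt
  have hy := y.1.isLt
  have hz := z.1.isLt
  unfold cf
  by_cases e1 : x.1 = y.1
  · by_cases e2 : y.1 = z.1
    · have e3 := e1.trans e2
      rw [if_pos e1, if_pos e2, if_pos e3]
      have d1 := cf_den h1 e1
      have d2 := cf_den h2 e2
      have d3 := cf_den h3 e3
      have e4 : q ^ (content x - content z) =
          q ^ (content x - content y) * q ^ (content y - content z) := by
        rw [← zpow_add₀ q_ne_zero]; congr 1; ring
      rw [e4] at d3 ⊢
      generalize q ^ (content x - content y) = a at *
      generalize q ^ (content y - content z) = b at *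
      field_simp
      ring
    · have e3 : x.1 ≠ z.1 := fun h => e2 (e1.symm.trans h)
      rw [if_pos e1, if_neg e2, if_neg e3, e1]
      by_cases h0 : y.1 = 0
      · simp [h0]
      · rw [if_neg h0]; ring
  · by_cases e2 : y.1 = z.1
    · have e3 : x.1 ≠ z.1 := fun h => e1 (h.trans e2.symm)
      rw [if_neg e1, if_pos e2, if_neg e3]
      by_cases h0 : x.1 = 0
      · simp [h0]
      · rw [if_neg h0]; ring
    · have e3 : x.1 = z.1 := by omega
      rw [if_neg e1, if_neg e2]
      by_cases h0 : x.1 = 0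
      · have h4 : y.1 ≠ 0 := fun h => e1 (h0.trans h.symm)
        simp [h0, h4]
      · have h4 : y.1 = 0 := by omega
        simp [h0, h4]

theorem IsStandard.mono {U : Fin n → Box} (hU : IsStandard lam mu U) {i j : Fin n}
    (h : Below (U i) (U j)) : i ≤ j := by
  obtain ⟨h1, h2, h3⟩ := h
  have hm : ((U i).2.1, (U j).2.2) ∈ (if (U j).1 = 0 then lam else mu) :=
    YoungDiagram.isLowerSet _ (a := (U j).2) (Prod.mk_le_mk.2 ⟨h2, le_rfl⟩)
      ((hU.shape (U j)).1 ⟨j, rfl⟩)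
  obtain ⟨m, hm⟩ := (hU.shape ((U j).1, (U i).2.1, (U j).2.2)).2 hm
  have a1 : i ≤ m := by
    rcases h3.lt_or_eq with h | h
    · exact (hU.row i m (by rw [hm, h1]) (by rw [hm]) (by rw [hm]; exact h)).le
    · refine (hU.inj ?_).le
      rw [hm]; exact Prod.ext h1 (Prod.ext rfl h)
  have a2 : m ≤ j := by
    rcases h2.lt_or_eq with h | h
    · exact (hU.col m j (by rw [hm]) (by rw [hm]) (by rw [hm]; exact h)).le
    · refine (hU.inj ?_).le
      rw [hm]; exact Prod.ext rfl (Prod.ext h rfl)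
  exact a1.trans a2

/-- No box lies strictly between two boxes with consecutive entries. -/
theorem IsStandard.between {U : Fin n → Box} (hU : IsStandard lam mu U) {i j : Fin n}
    (hij : i.val + 1 = j.val) {b : Box} (h1 : Below (U i) b) (h2 : Below b (U j)) :
    b = U i ∨ b = U j := by
  have hm : b.2 ∈ (if b.1 = 0 then lam else mu) := by
    rw [h2.1]
    exact YoungDiagram.isLowerSet _ (a := (U j).2) h2.2 ((hU.shape (U j)).1 ⟨j, rfl⟩)
  obtain ⟨m, rfl⟩ := (hU.shape b).2 hm
  have a1 := hU.mono h1
  have a2 := hU.mono h2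
  rcases Nat.lt_or_ge i.val m.val with h | h
  · exact Or.inr (congrArg U (Fin.ext (by have : m.val ≤ j.val := a2; omega)))
  · exact Or.inl (congrArg U (Fin.ext (by have : i.val ≤ m.val := a1; omega)))

/-- The relative position of two boxes with consecutive entries in the same tableau. -/
theorem IsStandard.consec {U : Fin n → Box} (hU : IsStandard lam mu U) {i j : Fin n}
    (hij : i.val + 1 = j.val) (h : (U i).1 = (U j).1) :
    ((U i).2.1 = (U j).2.1 ∧ (U j).2.2 = (U i).2.2 + 1) ∨
    ((U i).2.2 = (U j).2.2 ∧ (U j).2.1 = (U i).2.1 + 1) ∨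
    ((U i).2.1 < (U j).2.1 ∧ (U j).2.2 < (U i).2.2) ∨
    ((U j).2.1 < (U i).2.1 ∧ (U i).2.2 < (U j).2.2) := by
  have hne : U i ≠ U j := fun h' => by have := congrArg Fin.val (hU.inj h'); omega
  have hn : ¬ Below (U j) (U i) := fun h' => by
    have : j.val ≤ i.val := hU.mono h'
    omega
  have hb := fun r c => hU.between hij (b := ((U i).1, r, c))
  generalize U i = x at *
  generalize U j = y at *
  obtain ⟨t, r, c⟩ := x
  obtain ⟨t', r', c'⟩ := y
  simp only [Below, Prod.mk_le_mk, Prod.mk.injEq, not_and, not_le, Ne] at *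
  subst h
  simp only [true_and, true_imp_iff] at *
  rcases lt_trichotomy r r' with h1 | h1 | h1
  · rcases lt_trichotomy c c' with h2 | h2 | h2
    · have := hb r c' ⟨by omega, by omega⟩ ⟨by omega, by omega⟩
      omega
    · have := hb (r + 1) c ⟨by omega, by omega⟩ ⟨by omega, by omega⟩
      omega
    · omega
  · rcases lt_trichotomy c c' with h2 | h2 | h2
    · have := hb r (c + 1) ⟨by omega, by omega⟩ ⟨by omega, by omega⟩
      omega
    · exact absurd h2 (hne h1)
    · have := hn (by omega); omega
  · rcases lt_trichotomy c c' with h2 | h2 | h2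
    · omega
    · have := hn (by omega); omega
    · have := hn (by omega); omega

theorem IsStandard.apart {U : Fin n → Box} (hU : IsStandard lam mu U) {i j : Fin n}
    (hij : i.val + 1 = j.val) : Apart (U i) (U j) := by
  intro h
  have := hU.consec hij h
  unfold content
  rw [h]
  omega

/-- Exchanging two consecutive entries in incomparable boxes gives a standard bitableau. -/
theorem IsStandard.swap {U : Fin n → Box} (hU : IsStandard lam mu U) {i j : Fin n}
    (hij : i.val + 1 = j.val) (h : ¬ Below (U i) (U j)) :
    IsStandard lam mu (U ∘ Equiv.swap i j) := by
  have key : ∀ a b : Fin n, Below (U (Equiv.swap i j a)) (U (Equiv.swap i j b)) → a ≠ b → a < b := by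
    intro a b hab hne
    have h1 := hU.mono hab
    have h2 : Equiv.swap i j a ≠ Equiv.swap i j b := fun h => hne ((Equiv.swap i j).injective h)
    have h3 : Equiv.swap i j a < Equiv.swap i j b := lt_of_le_of_ne h1 h2
    have h4 : ¬ (Equiv.swap i j a = i ∧ Equiv.swap i j b = j) := by
      rintro ⟨e1, e2⟩; rw [e1, e2] at hab; exact h hab
    simp only [Equiv.swap_apply_def, Fin.lt_def] at *
    have hi := fun x y : Fin n => @Fin.ext_iff n x y
    split_ifs at * <;> simp_all <;> omega
  refine ⟨hU.inj.comp (Equiv.injective _), fun b => ?_, fun a b h1 h2 h3 => ?_,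
    fun a b h1 h2 h3 => ?_⟩
  · rw [← hU.shape b]
    exact ⟨fun ⟨j, hj⟩ => ⟨_, hj⟩, fun ⟨l, hl⟩ => ⟨Equiv.swap i j l, by simp [hl]⟩⟩
  · refine key a b ⟨h1, h2.le, h3.le⟩ ?_
    rintro rfl; exact lt_irrefl _ h3
  · refine key a b ⟨h1, h3.le, h2.le⟩ ?_
    rintro rfl; exact lt_irrefl _ h3

/-- The diagonal coefficient for comparable boxes. -/
theorem IsStandard.cf_below {U : Fin n → Box} (hU : IsStandard lam mu U) {i j : Fin n}
    (hij : i.val + 1 = j.val) (h : Below (U i) (U j)) :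
    ((U i).2.1 = (U j).2.1 ∧ cf (U i) (U j) = q) ∨
      ((U i).2.2 = (U j).2.2 ∧ (U i).2.1 ≠ (U j).2.1 ∧ cf (U i) (U j) = -1) := by
  have hap := cf_den (hU.apart hij) h.1
  have hq := q_ne_zero
  rcases hU.consec hij h.1 with ⟨h1, h2⟩ | ⟨h1, h2⟩ | ⟨h1, h2⟩ | ⟨h1, h2⟩
  · left
    refine ⟨h1, ?_⟩
    have e1 : content (U i) - content (U j) = -1 := by
      unfold content; rw [h.1]; omega
    rw [e1, zpow_neg_one] at hap
    rw [cf, if_pos h.1, e1, zpow_neg_one]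
    have e2 : 1 - q⁻¹ = (q - 1) / q := by field_simp
    rw [e2] at hap ⊢
    have e3 : q - 1 ≠ 0 := fun h => hap (by rw [h, zero_div])
    field_simp
  · right
    refine ⟨h1, by omega, ?_⟩
    have e1 : content (U i) - content (U j) = 1 := by
      unfold content; rw [h.1]; omega
    rw [e1, zpow_one] at hap
    rw [cf, if_pos h.1, e1, zpow_one, div_eq_iff hap]
    ring
  · have := h.2.2; omega
  · have := h.2.1; omega

theorem IsStandard.cf_quad {U : Fin n → Box} (hU : IsStandard lam mu U) {i j : Fin n}
    (hij : i.val + 1 = j.val) (h : Below (U i) (U j)) :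
    cf (U i) (U j) ^ 2 = (q - 1) * cf (U i) (U j) + q := by
  rcases hU.cf_below hij h with ⟨_, h⟩ | ⟨_, _, h⟩ <;> rw [h] <;> ring

/-- If a swap of consecutive entries makes `U` standard, although `U` is not, then the two boxes
are comparable and in the wrong order. -/
theorem below_of_swap {U : Fin n → Box} {i j : Fin n} (hij : i.val + 1 = j.val)
    (h1 : ¬ IsStandard lam mu U) (h2 : IsStandard lam mu (U ∘ Equiv.swap i j)) :
    Below (U j) (U i) := by
  by_contra h
  apply h1
  have := h2.swap hij (by simpa using h)
  have e : (U ∘ Equiv.swap i j) ∘ Equiv.swap i j = U := by ext1 x; simp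
  rwa [e] at this

theorem not_below_symm {U : Fin n → Box} (hU : IsStandard lam mu U) {i j : Fin n}
    (hij : i < j) : ¬ Below (U j) (U i) := fun h => absurd (hU.mono h) (not_le.2 hij)

theorem not_std_swap {U : Fin n → Box} {i j : Fin n} (hij : i.val + 1 = j.val)
    (h : Below (U i) (U j)) : ¬ IsStandard lam mu (U ∘ Equiv.swap i j) := fun h' => by
  have : j ≤ i := h'.mono (i := j) (j := i) (by simpa using h)
  have : j.val ≤ i.val := this
  omega

/-- The action of `T_i` in a uniform shape. -/
theorem opT_vec {U : Fin n → Box} {p i : Fin n} (hp : p.val + 1 = i.val)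
    (h : ¬ IsStandard lam mu U → ¬ IsStandard lam mu (U ∘ Equiv.swap p i)) :
    opT lam mu i (vec lam mu U) =
      cf (U p) (U i) • vec lam mu U + (1 + cf (U p) (U i)) • vec lam mu (U ∘ Equiv.swap p i) := by
  by_cases hU : IsStandard lam mu U
  · have hpi : prev i = p := Fin.ext (by simp [prev]; omega)
    rw [opT, vec_of U hU, Finsupp.linearCombination_single, one_smul, ← vec_of U hU]
    simp only [actT, hpi]
    by_cases h1 : (U p).1 = (U i).1
    · rw [if_pos h1]
      by_cases h2 : Below (U p) (U i)
      · rw [vec_of_not _ (not_std_swap hp h2), smul_zero, add_zero]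
        rcases hU.cf_below hp h2 with ⟨h3, h4⟩ | ⟨h3, h3', h4⟩
        · simp [h3, h4]
        · simp [h3, h3', h4]
      · have h3 := hU.consec hp h1
        have h4 : ¬ (U p).2.1 = (U i).2.1 := by
          intro h; apply h2; refine ⟨h1, ?_, ?_⟩ <;> omega
        have h5 : ¬ (U p).2.2 = (U i).2.2 := by
          intro h; apply h2; refine ⟨h1, ?_, ?_⟩ <;> omega
        rw [if_neg h4, if_neg h5, cf, if_pos h1]
    · rw [if_neg h1, cf, if_neg h1]
      by_cases h2 : (U p).1 = 0
      · simp [h2]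
      · simp [h2]
  · rw [vec_of_not U hU, vec_of_not _ (h hU)]; simp

theorem opT_vec_std {U : Fin n → Box} {p i : Fin n} (hp : p.val + 1 = i.val)
    (hU : IsStandard lam mu U) :
    opT lam mu i (vec lam mu U) =
      cf (U p) (U i) • vec lam mu U + (1 + cf (U p) (U i)) • vec lam mu (U ∘ Equiv.swap p i) :=
  opT_vec hp (fun h => absurd hU h)

theorem opE_vec (U : Fin n → Box) (i : Fin n) :
    opE lam mu i (vec lam mu U) = (if (U i).1 = 0 then 1 else 0 : K) • vec lam mu U := by
  by_cases hU : IsStandard lam mu U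
  · rw [opE, vec_of U hU, Finsupp.linearCombination_single, one_smul, ← vec_of U hU]
    simp only [actE]
    split_ifs <;> simp
  · rw [vec_of_not U hU]; simp

section aux

variable {F M : Type*} [Field F] [AddCommGroup M] [Module F M]

theorem aux_quad (A t : F) (v w : M) :
    A • (A • v + (1 + A) • w) + (1 + A) • ((t - 1 - A) • w + (1 + (t - 1 - A)) • v) =
      (t - 1) • (A • v + (1 + A) • w) + t • v := by
  module

theorem aux_comm (A B : F) (u v w x : M) :
    B • (A • u + (1 + A) • v) + (1 + B) • (A • w + (1 + A) • x) =
      A • (B • u + (1 + B) • w) + (1 + A) • (B • v + (1 + B) • x) := by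
  module

theorem aux_four (S T : M →ₗ[F] M) (t : F) (v w : M) (hv : T v = w)
    (hw : T w = (t - 1) • w + t • v) (sv : S v = (t - 1) • v) (sw : S w = -w) :
    (S (T (S (T v))) = (t - 1) • (T (S (T v)) + T (S v)) - S (T (S v)) ∧
      T (S (T (S v))) = (t - 1) • (T (S (T v)) + S (T v)) - S (T (S v))) ∧
    (S (T (S (T w))) = (t - 1) • (T (S (T w)) + T (S w)) - S (T (S w)) ∧
      T (S (T (S w))) = (t - 1) • (T (S (T w)) + S (T w)) - S (T (S w))) := by
  refine ⟨⟨?_, ?_⟩, ?_, ?_⟩ <;>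
  · simp only [hv, hw, sv, sw, map_neg, map_add, map_smul]
    module

theorem aux_four' (S T : M →ₗ[F] M) (t a s : F) (v : M) (hv : T v = a • v) (sv : S v = s • v)
    (h : s * a * s * a = (t - 1) * (a * s * a + a * s) - s * a * s) :
    S (T (S (T v))) = (t - 1) • (T (S (T v)) + T (S v)) - S (T (S v)) ∧
      T (S (T (S v))) = (t - 1) • (T (S (T v)) + S (T v)) - S (T (S v)) := by
  simp only [hv, sv, map_smul]
  constructor <;> linear_combination (norm := module) h • v

theorem aux_braid (S T : M →ₗ[F] M) (A B C t : F) (v v1 v2 v12 v21 v3 : M)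
    (h : A * B = C * (A + B - (t - 1)))
    (f : S v = A • v + (1 + A) • v1) (g : T v = B • v + (1 + B) • v2)
    (f1 : S v1 = (t - 1 - A) • v1 + (1 + (t - 1 - A)) • v) (g1 : T v1 = C • v1 + (1 + C) • v12)
    (f2 : S v2 = C • v2 + (1 + C) • v21) (g2 : T v2 = (t - 1 - B) • v2 + (1 + (t - 1 - B)) • v)
    (f12 : S v12 = B • v12 + (1 + B) • v3) (g21 : T v21 = A • v21 + (1 + A) • v3) :
    S (T (S v)) = T (S (T v)) := by
  rw [f, g]
  simp only [map_add, map_smul, f, g, f1, f2, g1, g2, f12, g21]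
  linear_combination (norm := module) ((1 + A) * h) • v1 + (-(1 + B) * h) • v2 + ((A - B) * h) • v

theorem aux_braid' (S T : M →ₗ[F] M) (A B C t : F) (v v2 v21 : M)
    (h : A * B = C * (A + B - (t - 1))) (hA : A ^ 2 = (t - 1) * A + t)
    (f : S v = A • v) (g : T v = B • v + (1 + B) • v2)
    (f2 : S v2 = C • v2 + (1 + C) • v21) (g2 : T v2 = (t - 1 - B) • v2 + (1 + (t - 1 - B)) • v)
    (g21 : T v21 = A • v21) :
    S (T (S v)) = T (S (T v)) := by
  rw [f, g]
  simp only [map_add, map_smul, f, g, f2, g2, g21]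
  linear_combination (norm := module) (-(1 + B) * h) • v2 + ((A - B) * h + C * hA) • v

end aux

theorem opT_quad (i : Fin n) (hi : 1 ≤ i.val) :
    opT lam mu i * opT lam mu i = (q - 1) • opT lam mu i + q • 1 := by
  apply hom_ext'
  intro U hU
  have hp : (prev i).val + 1 = i.val := by simp [prev]; omega
  generalize prev i = p at hp
  have f1 := opT_vec_std hp hU
  simp only [Module.End.mul_apply, LinearMap.add_apply, LinearMap.smul_apply,
    Module.End.one_apply]
  by_cases h : Below (U p) (U i)
  · rw [vec_of_not _ (not_std_swap hp h), smul_zero, add_zero] at f1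
    rw [f1, map_smul, f1, smul_smul, smul_smul, ← add_smul, ← hU.cf_quad hp h, sq]
  · have f2 := opT_vec_std hp (hU.swap hp h)
    have e : (U ∘ Equiv.swap p i) ∘ Equiv.swap p i = U := by ext1 x; simp
    have e1 : (U ∘ Equiv.swap p i) p = U i := by simp
    have e2 : (U ∘ Equiv.swap p i) i = U p := by simp
    rw [e, e1, e2, cf_symm (hU.apart hp)] at f2
    rw [f1, map_add, map_smul, map_smul, f1, f2]
    exact aux_quad _ _ _ _

theorem opT_comm (i j : Fin n) (hi : 1 ≤ i.val) (hij : i.val + 2 ≤ j.val) :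
    opT lam mu i * opT lam mu j = opT lam mu j * opT lam mu i := by
  apply hom_ext'
  intro U hU
  have hp : (prev i).val + 1 = i.val := by simp [prev]; omega
  generalize prev i = p at hp
  have hs : (prev j).val + 1 = j.val := by simp [prev]; omega
  generalize prev j = s at hs
  have n1 : p ≠ s := fun h => by rw [h] at hp; omega
  have n2 : p ≠ j := fun h => by rw [h] at hp; omega
  have n3 : i ≠ s := fun h => by rw [h] at hp hij; omega
  have n4 : i ≠ j := fun h => by rw [h] at hij; omega
  have c : (U ∘ Equiv.swap s j) ∘ Equiv.swap p i = (U ∘ Equiv.swap p i) ∘ Equiv.swap s j := by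
    ext1 x
    have : Equiv.swap s j * Equiv.swap p i = Equiv.swap p i * Equiv.swap s j :=
      Equiv.Perm.Disjoint.commute (by
        rw [Equiv.Perm.disjoint_iff_disjoint_support, Equiv.Perm.support_swap,
          Equiv.Perm.support_swap]
        · simp [n1, n2, n3, n4]
        · rintro rfl; omega
        · rintro rfl; omega)
    exact congrArg U (congrArg (fun f => f x) this)
  have a1 : (U ∘ Equiv.swap p i) s = U s := by
    simp [Equiv.swap_apply_of_ne_of_ne n1.symm n3.symm]
  have a2 : (U ∘ Equiv.swap p i) j = U j := by
    simp [Equiv.swap_apply_of_ne_of_ne n2.symm n4.symm]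
  have a3 : (U ∘ Equiv.swap s j) p = U p := by
    simp [Equiv.swap_apply_of_ne_of_ne n1 n2]
  have a4 : (U ∘ Equiv.swap s j) i = U i := by
    simp [Equiv.swap_apply_of_ne_of_ne n3 n4]
  have p1 : ∀ W : Fin n → Box, (W ∘ Equiv.swap p i) p = W i := fun W => by simp
  have p2 : ∀ W : Fin n → Box, (W ∘ Equiv.swap p i) i = W p := fun W => by simp
  have p3 : ∀ W : Fin n → Box, (W ∘ Equiv.swap s j) s = W j := fun W => by simp
  have p4 : ∀ W : Fin n → Box, (W ∘ Equiv.swap s j) j = W s := fun W => by simp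
  have f1 := opT_vec_std hp hU
  have f2 := opT_vec_std hs hU
  have f3 := opT_vec (lam := lam) (mu := mu) (U := U ∘ Equiv.swap p i) hs (fun h h' => by
    have hb : Below (U p) (U i) := by by_contra hb; exact h (hU.swap hp hb)
    have := h'.mono (i := i) (j := p) (by rw [← c]; simpa [-Function.comp_apply, p1, p2, a3, a4] using hb)
    have : i.val ≤ p.val := this
    omega)
  have f4 := opT_vec (lam := lam) (mu := mu) (U := U ∘ Equiv.swap s j) hp (fun h h' => by
    have hb : Below (U s) (U j) := by by_contra hb; exact h (hU.swap hs hb)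
    have := h'.mono (i := j) (j := s) (by rw [c]; simpa [-Function.comp_apply, p3, p4, a1, a2] using hb)
    have : j.val ≤ s.val := this
    omega)
  rw [a1, a2] at f3
  rw [a3, a4, c] at f4
  simp only [Module.End.mul_apply]
  rw [f1, f2, map_add, map_add, map_smul, map_smul, map_smul, map_smul, f1, f2, f3, f4]
  exact aux_comm _ _ _ _ _ _

theorem opE_comm (i j : Fin n) (hi : i.val = 0) (hij : 2 ≤ j.val) :
    opE lam mu i * opT lam mu j = opT lam mu j * opE lam mu i := by
  apply hom_ext'
  intro U hU
  have hs : (prev j).val + 1 = j.val := by simp [prev]; omega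
  generalize prev j = s at hs
  have n3 : i ≠ s := fun h => by rw [h] at hi; omega
  have n4 : i ≠ j := fun h => by rw [h] at hi; omega
  have a4 : (U ∘ Equiv.swap s j) i = U i := by
    simp [Equiv.swap_apply_of_ne_of_ne n3 n4]
  have f2 := opT_vec_std hs hU
  simp only [Module.End.mul_apply]
  have g1 := opE_vec (lam := lam) (mu := mu) U i
  have g2 := opE_vec (lam := lam) (mu := mu) (U ∘ Equiv.swap s j) i
  rw [a4] at g2
  generalize (if (U i).1 = 0 then (1 : K) else 0) = a at g1 g2
  rw [g1, map_smul, f2, map_add, map_smul, map_smul, g1, g2]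
  rw [smul_add, smul_comm a, smul_comm a]

theorem opT_braid (i j : Fin n) (hi : 1 ≤ i.val) (hj : j.val = i.val + 1) :
    opT lam mu i * opT lam mu j * opT lam mu i = opT lam mu j * opT lam mu i * opT lam mu j := by
  apply hom_ext'
  intro U hU
  have hp : (prev i).val + 1 = i.val := by simp [prev]; omega
  generalize prev i = p at hp
  have hj := hj.symm
  have hpi : p ≠ i := fun h => by rw [h] at hp; omega
  have hij : i ≠ j := fun h => by rw [h] at hj; omega
  have hpj : p ≠ j := fun h => by rw [h] at hp; omega
  have p1 : ∀ W : Fin n → Box, (W ∘ Equiv.swap p i) p = W i := fun W => by simp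
  have p2 : ∀ W : Fin n → Box, (W ∘ Equiv.swap p i) i = W p := fun W => by simp
  have p3 : ∀ W : Fin n → Box, (W ∘ Equiv.swap p i) j = W j := fun W => by
    simp [Equiv.swap_apply_of_ne_of_ne hpj.symm hij.symm]
  have p4 : ∀ W : Fin n → Box, (W ∘ Equiv.swap i j) p = W p := fun W => by
    simp [Equiv.swap_apply_of_ne_of_ne hpi hpj]
  have p5 : ∀ W : Fin n → Box, (W ∘ Equiv.swap i j) i = W j := fun W => by simp
  have p6 : ∀ W : Fin n → Box, (W ∘ Equiv.swap i j) j = W i := fun W => by simp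
  have s1 : ∀ W : Fin n → Box, (W ∘ Equiv.swap p i) ∘ Equiv.swap p i = W := fun W => by
    ext1 x; simp
  have s2 : ∀ W : Fin n → Box, (W ∘ Equiv.swap i j) ∘ Equiv.swap i j = W := fun W => by
    ext1 x; simp
  have s3 : ((U ∘ Equiv.swap i j) ∘ Equiv.swap p i) ∘ Equiv.swap i j =
      ((U ∘ Equiv.swap p i) ∘ Equiv.swap i j) ∘ Equiv.swap p i := by
    have : Equiv.swap i j * Equiv.swap p i * Equiv.swap i j =
        Equiv.swap p i * Equiv.swap i j * Equiv.swap p i := by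
      have a := Equiv.swap_mul_swap_mul_swap hpi hpj
      have b := Equiv.swap_mul_swap_mul_swap hij.symm hpj.symm
      rw [a, Equiv.swap_comm i j, Equiv.swap_comm p i, b, Equiv.swap_comm]
    ext1 x
    exact congrArg U (congrArg (fun f => f x) this)
  have lpi : p < i := Fin.lt_def.2 (by omega)
  have lij : i < j := Fin.lt_def.2 (by omega)
  have lpj : p < j := Fin.lt_def.2 (by omega)
  -- the six fillings and the action on them
  have f0 := opT_vec_std hp hU
  have g0 := opT_vec_std hj hU
  have hA := hU.apart hp
  have hB := hU.apart hj
  obtain ⟨U1, hU1⟩ : ∃ W, W = U ∘ Equiv.swap p i := ⟨_, rfl⟩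
  obtain ⟨U2, hU2⟩ : ∃ W, W = U ∘ Equiv.swap i j := ⟨_, rfl⟩
  obtain ⟨U12, hU12⟩ : ∃ W, W = U1 ∘ Equiv.swap i j := ⟨_, rfl⟩
  obtain ⟨U21, hU21⟩ : ∃ W, W = U2 ∘ Equiv.swap p i := ⟨_, rfl⟩
  obtain ⟨U3, hU3⟩ : ∃ W, W = U12 ∘ Equiv.swap p i := ⟨_, rfl⟩
  rw [← hU1] at f0
  rw [← hU2] at g0
  rw [← hU2, ← hU1, ← hU21, ← hU12, ← hU3] at s3
  have x1p : U1 p = U i := hU1 ▸ p1 U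
  have x1i : U1 i = U p := hU1 ▸ p2 U
  have x1j : U1 j = U j := hU1 ▸ p3 U
  have x2p : U2 p = U p := hU2 ▸ p4 U
  have x2i : U2 i = U j := hU2 ▸ p5 U
  have x2j : U2 j = U i := hU2 ▸ p6 U
  have x12p : U12 p = U i := hU12 ▸ (p4 U1).trans x1p
  have x12i : U12 i = U j := hU12 ▸ (p5 U1).trans x1j
  have x21i : U21 i = U p := hU21 ▸ (p2 U2).trans x2p
  have x21j : U21 j = U i := hU21 ▸ (p3 U2).trans x2j
  have x12j : U12 j = U p := hU12 ▸ (p6 U1).trans x1i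
  have x3p : U3 p = U j := hU3 ▸ (p1 U12).trans x12i
  have x3i : U3 i = U i := hU3 ▸ (p2 U12).trans x12p
  have x3j : U3 j = U p := hU3 ▸ (p3 U12).trans x12j
  have n1 : ¬ Below (U i) (U p) := not_below_symm hU lpi
  have n2 : ¬ Below (U j) (U i) := not_below_symm hU lij
  have f12 := opT_vec (lam := lam) (mu := mu) (U := U12) hp (fun h h' => by
    have := below_of_swap hp h h'
    rw [x12i, x12p] at this
    exact n2 this)
  have g21 := opT_vec (lam := lam) (mu := mu) (U := U21) hj (fun h h' => by
    have := below_of_swap hj h h'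
    rw [x21i, x21j] at this
    exact n1 this)
  rw [x12p, x12i, ← hU3] at f12
  rw [x21i, x21j, s3] at g21
  simp only [Module.End.mul_apply]
  by_cases hXY : Below (U p) (U i)
  · have z1 : ¬ IsStandard lam mu U1 := hU1 ▸ not_std_swap hp hXY
    rw [vec_of_not _ z1, smul_zero, add_zero] at f0
    have z3 : ¬ IsStandard lam mu U3 := fun h => by
      have : j ≤ i := h.mono (by rw [x3i, x3j]; exact hXY)
      exact absurd lij (not_lt.2 this)
    by_cases hYZ : Below (U i) (U j)
    · have z2 : ¬ IsStandard lam mu U2 := hU2 ▸ not_std_swap hj hYZ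
      rw [vec_of_not _ z2, smul_zero, add_zero] at g0
      have hAB : cf (U p) (U i) = cf (U i) (U j) := by
        have corner : ∀ b : Box, Below (U p) b → Below b (U j) →
            b = U p ∨ b = U i ∨ b = U j := by
          intro b h1 h2
          have hm : b.2 ∈ (if b.1 = 0 then lam else mu) := by
            rw [h2.1]
            exact YoungDiagram.isLowerSet _ (a := (U j).2) h2.2 ((hU.shape (U j)).1 ⟨j, rfl⟩)
          obtain ⟨m, rfl⟩ := (hU.shape b).2 hm
          have a1 : p.val ≤ m.val := hU.mono h1
          have a2 : m.val ≤ j.val := hU.mono h2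
          have : m = p ∨ m = i ∨ m = j := by simp only [Fin.ext_iff]; omega
          rcases this with h | h | h <;> simp [h]
        rcases hU.cf_below hp hXY with ⟨h1, h2⟩ | ⟨h1, h1', h2⟩ <;>
          rcases hU.cf_below hj hYZ with ⟨h3, h4⟩ | ⟨h3, h3', h4⟩
        · rw [h2, h4]
        · exfalso
          have hne : (U p).2.2 ≠ (U i).2.2 := fun h =>
            hpi (hU.inj (Prod.ext hXY.1 (Prod.ext h1 h)))
          have := corner ((U j).1, (U j).2.1, (U p).2.2)
            ⟨hXY.1.trans hYZ.1, hXY.2.1.trans hYZ.2.1, le_rfl⟩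
            ⟨rfl, le_rfl, hXY.2.2.trans hYZ.2.2⟩
          rcases this with h | h | h
          · have := congrArg (fun b : Box => b.2.1) h
            simp only at this; omega
          · have := congrArg (fun b : Box => b.2.1) h
            simp only at this; omega
          · have := congrArg (fun b : Box => b.2.2) h
            simp only at this; omega
        · exfalso
          have hne : (U i).2.2 ≠ (U j).2.2 := fun h =>
            hij (hU.inj (Prod.ext hYZ.1 (Prod.ext h3 h)))
          have := corner ((U j).1, (U p).2.1, (U j).2.2)
            ⟨hXY.1.trans hYZ.1, le_rfl, hXY.2.2.trans hYZ.2.2⟩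
            ⟨rfl, hXY.2.1.trans hYZ.2.1, le_rfl⟩
          rcases this with h | h | h
          · have := congrArg (fun b : Box => b.2.2) h
            simp only at this; omega
          · have := congrArg (fun b : Box => b.2.2) h
            simp only at this; omega
          · have := congrArg (fun b : Box => b.2.1) h
            simp only at this; omega
        · rw [h2, h4]
      rw [f0, map_smul, g0, map_smul, map_smul, map_smul, f0, map_smul, g0, hAB]
    · have y2 : IsStandard lam mu U2 := hU2 ▸ hU.swap hj hYZ
      have f2 := opT_vec_std hp y2
      have g2 := opT_vec_std hj y2
      have hC := y2.apart hp
      rw [x2p, x2i] at f2 hC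
      rw [← hU21] at f2
      rw [x2i, x2j, hU2, s2, ← hU2, cf_symm hB] at g2
      rw [vec_of_not _ z3, smul_zero, add_zero] at g21
      exact aux_braid' _ _ _ _ _ q _ _ _ (cf_triple hA hB hC) (hU.cf_quad hp hXY) f0 g0 f2 g2 g21
  · have y1 : IsStandard lam mu U1 := hU1 ▸ hU.swap hp hXY
    have f1 := opT_vec_std hp y1
    have g1 := opT_vec_std hj y1
    have hC := y1.apart hj
    rw [x1i, x1j] at g1 hC
    rw [← hU12] at g1
    rw [x1p, x1i, hU1, s1, ← hU1, cf_symm hA] at f1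
    have h3 := cf_triple hA hB hC
    by_cases hYZ : Below (U i) (U j)
    · have z2 : ¬ IsStandard lam mu U2 := hU2 ▸ not_std_swap hj hYZ
      have z3 : ¬ IsStandard lam mu U3 := fun h => by
        have : i ≤ p := h.mono (by rw [x3i, x3p]; exact hYZ)
        exact absurd lpi (not_lt.2 this)
      rw [vec_of_not _ z2, smul_zero, add_zero] at g0
      rw [vec_of_not _ z3, smul_zero, add_zero] at f12
      refine (aux_braid' _ _ _ _ _ q _ _ _ ?_ (hU.cf_quad hj hYZ) g0 f0 g1 f1 f12).symm
      rw [mul_comm, h3]; ring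
    · have y2 : IsStandard lam mu U2 := hU2 ▸ hU.swap hj hYZ
      have f2 := opT_vec_std hp y2
      have g2 := opT_vec_std hj y2
      rw [x2p, x2i, ← hU21] at f2
      rw [x2i, x2j, hU2, s2, ← hU2, cf_symm hB] at g2
      exact aux_braid _ _ _ _ _ q _ _ _ _ _ _ h3 f0 g0 f1 g1 f2 g2 f12 g21

end seminormal


/-- The diagram `1^k` that consists of a single column of `k` boxes. -/
def column (k : ℕ) : YoungDiagram where
  cells := Finset.range k ×ˢ {0}
  isLowerSet := by
    rintro ⟨r, c⟩ ⟨r', c'⟩ h hm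
    simp only [Prod.mk_le_mk, Finset.coe_product, Finset.coe_range, Finset.coe_singleton,
      Set.mem_prod, Set.mem_Iio, Set.mem_singleton_iff] at *
    omega

theorem mem_column {k : ℕ} {b : ℕ × ℕ} : b ∈ column k ↔ b.1 < k ∧ b.2 = 0 := by
  obtain ⟨r, c⟩ := b
  rw [← YoungDiagram.mem_cells]
  simp only [column, Finset.mem_product, Finset.mem_range, Finset.mem_singleton]

section module_structure

variable {n : ℕ} {lam : YoungDiagram} {k : ℕ}

theorem first_entries {U : Fin n → Box} (hU : IsStandard lam (column k) U) {i j : Fin n}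
    (hi : i.val = 0) (h : (U i).1 = (U j).1) : Below (U i) (U j) := by
  have hm : ((U j).1, 0, 0).2 ∈ (if ((U j).1, 0, 0).1 = 0 then lam else column k) :=
    YoungDiagram.isLowerSet _ (a := (U j).2) (Prod.mk_le_mk.2 ⟨Nat.zero_le _, Nat.zero_le _⟩)
      ((hU.shape (U j)).1 ⟨j, rfl⟩)
  obtain ⟨m, hm⟩ := (hU.shape ((U j).1, 0, 0)).2 hm
  have h1 : Below (U m) (U i) := by
    rw [hm]; exact ⟨h.symm, Prod.mk_le_mk.2 ⟨Nat.zero_le _, Nat.zero_le _⟩⟩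
  have h2 : m = i := Fin.ext (by have : m.val ≤ i.val := hU.mono h1; omega)
  rw [← h2, hm]
  exact ⟨rfl, Prod.mk_le_mk.2 ⟨Nat.zero_le _, Nat.zero_le _⟩⟩

theorem op_zero_vec (i : Fin n) (hi : i.val = 0) (U : Fin n → Box) :
    op lam (column k) i (vec lam (column k) U) =
      (if (U i).1 = 0 then q - 1 else -1) • vec lam (column k) U := by
  rw [op, if_pos hi, LinearMap.sub_apply, LinearMap.smul_apply, opE_vec, Module.End.one_apply]
  by_cases h : (U i).1 = 0
  · rw [if_pos h, if_pos h, one_smul, sub_smul, one_smul]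
  · rw [if_neg h, if_neg h, zero_smul, smul_zero, zero_sub, neg_one_smul]

theorem op_pos (i : Fin n) (hi : 1 ≤ i.val) : op lam (column k) i = opT lam (column k) i :=
  if_neg (by omega)

theorem op_four_vec (i j : Fin n) (hi : i.val = 0) (hj : j.val = 1) (U : Fin n → Box)
    (hU : IsStandard lam (column k) U) (S T : Module.End K (V n lam (column k)))
    (hS : S = op lam (column k) i) (hT : T = op lam (column k) j) :
    S (T (S (T (vec lam (column k) U)))) =
      (q - 1) • (T (S (T (vec lam (column k) U))) + T (S (vec lam (column k) U)))
        - S (T (S (vec lam (column k) U))) ∧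
    T (S (T (S (vec lam (column k) U)))) =
      (q - 1) • (T (S (T (vec lam (column k) U))) + S (T (vec lam (column k) U)))
        - S (T (S (vec lam (column k) U))) := by
  have hij : i.val + 1 = j.val := by omega
  have f := opT_vec_std hij hU
  have g := fun W => op_zero_vec (lam := lam) (k := k) i hi W
  rw [← op_pos j (by omega), ← hT] at f
  rw [← hS] at g
  have g0 := g U
  by_cases h : (U i).1 = (U j).1
  · have hb := first_entries hU hi h
    rw [vec_of_not _ (not_std_swap hij hb), smul_zero, add_zero] at f
    by_cases h0 : (U i).1 = 0
    · rw [if_pos h0] at g0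
      refine aux_four' S T q _ _ _ f g0 ?_
      ring
    · rw [if_neg h0] at g0
      refine aux_four' S T q _ _ _ f g0 ?_
      rcases hU.cf_below hij hb with ⟨h1, h2⟩ | ⟨h1, h1', h2⟩
      · exfalso
        have m1 := (hU.shape (U i)).1 ⟨i, rfl⟩
        have m2 := (hU.shape (U j)).1 ⟨j, rfl⟩
        rw [if_neg h0, mem_column] at m1
        rw [if_neg (h ▸ h0), mem_column] at m2
        have := hU.inj (Prod.ext h (Prod.ext h1 (m1.2.trans m2.2.symm)))
        rw [this] at hij
        omega
      · rw [h2]; ring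
  · have hb : ¬ Below (U i) (U j) := fun hb => h hb.1
    have f' := opT_vec_std hij (hU.swap hij hb)
    have e : (U ∘ Equiv.swap i j) ∘ Equiv.swap i j = U := by ext1 x; simp
    have e1 : (U ∘ Equiv.swap i j) i = U j := by simp
    have e2 : (U ∘ Equiv.swap i j) j = U i := by simp
    rw [← op_pos j (by omega), ← hT, e, e1, e2, cf_symm (hU.apart hij)] at f'
    have g1 := g (U ∘ Equiv.swap i j)
    rw [e1] at g1
    have := (U i).1.isLt
    have := (U j).1.isLt
    by_cases h0 : (U i).1 = 0
    · have h0' : (U j).1 ≠ 0 := fun h' => h (h0.trans h'.symm)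
      have hc : cf (U i) (U j) = 0 := by rw [cf, if_neg h, if_pos h0]
      rw [if_pos h0] at g0
      rw [if_neg h0', neg_one_smul] at g1
      rw [hc, zero_smul, zero_add, add_zero, one_smul] at f
      rw [hc, sub_zero, add_sub_cancel] at f'
      exact (aux_four S T q _ _ f f' g0 g1).1
    · have h0' : (U j).1 = 0 := by omega
      have hc : cf (U i) (U j) = q - 1 := by rw [cf, if_neg h, if_neg h0]
      rw [if_neg h0, neg_one_smul] at g0
      rw [if_pos h0'] at g1
      rw [hc, add_sub_cancel] at f
      rw [hc, sub_self, zero_smul, zero_add, add_zero, one_smul] at f'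
      exact (aux_four S T q _ _ f' f g1 g0).2

theorem op_rel (a b : FreeAlgebra K (Fin n)) (hab : Rel n a b) :
    FreeAlgebra.lift K (op lam (column k)) a = FreeAlgebra.lift K (op lam (column k)) b := by
  cases hab with
  | zero i hi =>
    simp only [map_mul, map_add, map_smul, map_one, FreeAlgebra.lift_ι_apply]
    apply hom_ext'
    intro U hU
    simp only [Module.End.mul_apply, LinearMap.add_apply, LinearMap.smul_apply,
      Module.End.one_apply]
    have h := op_zero_vec (lam := lam) (k := k) i hi U
    rw [h, map_smul, h, smul_smul, smul_smul, ← add_smul]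
    congr 1
    split_ifs <;> ring
  | quad i hi =>
    simp only [map_mul, map_add, map_smul, map_one, FreeAlgebra.lift_ι_apply]
    rw [op_pos i hi]
    exact opT_quad i hi
  | braid i j hi hj =>
    simp only [map_mul, FreeAlgebra.lift_ι_apply]
    rw [op_pos i hi, op_pos j (by omega)]
    exact opT_braid i j hi hj
  | four i j hi hj =>
    simp only [map_mul, map_add, map_sub, map_smul, FreeAlgebra.lift_ι_apply]
    apply hom_ext'
    intro U hU
    exact (op_four_vec i j hi hj U hU _ _ rfl rfl).1
  | four' i j hi hj =>
    simp only [map_mul, map_add, map_sub, map_smul, FreeAlgebra.lift_ι_apply]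
    apply hom_ext'
    intro U hU
    exact (op_four_vec i j hi hj U hU _ _ rfl rfl).2
  | comm i j hij =>
    have key : ∀ i j : Fin n, i.val + 2 ≤ j.val →
        op lam (column k) i * op lam (column k) j = op lam (column k) j * op lam (column k) i := by
      intro i j h
      rw [op_pos j (by omega)]
      rcases Nat.eq_zero_or_pos i.val with h0 | h0
      · rw [op, if_pos h0]
        apply LinearMap.ext
        intro x
        have hc := LinearMap.congr_fun (opE_comm (lam := lam) (mu := column k) i j h0 (by omega)) x
        simp only [Module.End.mul_apply, LinearMap.sub_apply, LinearMap.smul_apply,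
          Module.End.one_apply, map_sub, map_smul] at hc ⊢
        rw [hc]
      · rw [op_pos i h0]; exact opT_comm i j h0 h
    simp only [map_mul, FreeAlgebra.lift_ι_apply]
    rcases hij with h | h
    · exact key i j h
    · exact (key j i h).symm

variable (n lam k) in
/-- The representation of `R_n` on the span of the standard bitableaux of shape `(lam, 1^k)`. -/
def rep : R n →ₐ[K] Module.End K (V n lam (column k)) := lift (op lam (column k)) op_rel

end module_structure

/-- The `R_n`-module `M^{(lam, 1^k)}`, where `(lam, 1^k)` is a bipartition of `n`. -/
def Irr (n : ℕ) (lam : YoungDiagram) (k : ℕ) : Type := V n lam (column k)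

instance (n : ℕ) (lam : YoungDiagram) (k : ℕ) : AddCommGroup (Irr n lam k) :=
  inferInstanceAs (AddCommGroup (V n lam (column k)))

instance (n : ℕ) (lam : YoungDiagram) (k : ℕ) : Module K (Irr n lam k) :=
  inferInstanceAs (Module K (V n lam (column k)))

instance (n : ℕ) (lam : YoungDiagram) (k : ℕ) : Module (R n) (Irr n lam k) :=
  Module.compHom (V n lam (column k)) (rep n lam k).toRingHom

theorem smul_def {n : ℕ} {lam : YoungDiagram} {k : ℕ} (x : R n) (m : Irr n lam k) :
    x • m = rep n lam k x m := rfl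

instance (n : ℕ) (lam : YoungDiagram) (k : ℕ) : IsScalarTower K (R n) (Irr n lam k) :=
  ⟨fun a x m => by rw [smul_def, smul_def, map_smul]; rfl⟩

instance finite_stdTab (n : ℕ) (lam mu : YoungDiagram) : Finite (StdTab n lam mu) := by
  let S : Finset Box := Finset.univ ×ˢ (lam.cells ∪ mu.cells)
  have key : ∀ (U : StdTab n lam mu) (j : Fin n), U.1 j ∈ S := by
    intro U j
    have h := (U.2.shape (U.1 j)).1 ⟨j, rfl⟩
    refine Finset.mem_product.2 ⟨Finset.mem_univ _, Finset.mem_union.2 ?_⟩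
    split_ifs at h
    · exact Or.inl h
    · exact Or.inr h
  refine Finite.of_injective (fun (U : StdTab n lam mu) (j : Fin n) => (⟨U.1 j, key U j⟩ : S)) ?_
  intro U W h
  apply Subtype.ext
  funext j
  exact congrArg Subtype.val (congrFun h j)

instance (n : ℕ) (lam : YoungDiagram) (k : ℕ) : Module.Finite K (Irr n lam k) :=
  inferInstanceAs (Module.Finite K (V n lam (column k)))

instance (n : ℕ) (lam : YoungDiagram) (k : ℕ) : Module.Finite (R n) (Irr n lam k) :=
  Module.Finite.of_restrictScalars_finite K (R n) (Irr n lam k)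

/-- `M^{(lam, 1^k)}` as an object of the category of finitely generated `R_n`-modules. -/
abbrev irr (n : ℕ) (lam : YoungDiagram) (k : ℕ) : FGModuleCat.{0} (R n) :=
  FGModuleCat.of (R n) (Irr n lam k)

/-- `mu` is obtained from `lam` by adding a box of content `i`, that is, `mu = lam[i⁺]`. -/
def IsAddBox (lam : YoungDiagram) (i : ℤ) (mu : YoungDiagram) : Prop :=
  ∃ b : ℕ × ℕ, b ∉ lam ∧ mu.cells = insert b lam.cells ∧ (b.2 : ℤ) - (b.1 : ℤ) = i

end

end Mirabolic

/-! The Jucys–Murphy elements L_1 = e, L_{j+1} = q⁻¹ T_j L_j T_j commute, and the proof analyses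
their joint eigenspaces `Wt` in an arbitrary module, in the manner of Okounkov and Vershik. A
filling gives an entry the eigenvalue q^content if it lies in the first tableau and 0 if it lies in
the second (`ev`).

Two statements are proved by a joint induction (`branching_extends`). `Branching`: on the weight
space of a standard filling with n boxes, L_{n+1} is annihilated by the product of the factors X −
ev b over the addable boxes b, and these roots are distinct. `Extends`: every weight vector of a
standard filling belongs to a family, indexed by all standard fillings of the same shape, on which
the generators act by the seminormal formulas; in other words, it is the image of v_U under a
homomorphism from M^{(λ,1^k)}. For `Branching`, `IsRep.roots` limits the possible new eigenvalues,
and the braid relation excludes the superfluous ones (`Branching.eq_zero_of_removable`). For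
`Extends`, families for the different last boxes are glued, and the braid relation gives the missing
action of the last generator.

It follows that weight vectors span every module (`IsRep.eq_top_of_Wt_le`). The weight spaces of
M^{(λ,1^k)} are lines, so it is simple; R_n is semisimple, and every simple module is of this kind.
Moreover Hom(M^{(λ,1^k)}, N) is the weight space of N for any one standard filling U of that shape.

A morphism from M^{(λ,1^k)} to i-Res N is therefore a vector of N whose weight is that of U followed
by the eigenvalue of i. At most one addable box b has this eigenvalue. If b exists, the module of
the enlarged bipartition corepresents such morphisms (`existsUnique_extension`); if not, there are
only zero morphisms. This gives the left adjoint on simple modules, and by semisimplicity on all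
finitely generated ones.

The right adjoint comes from trace duality. The trace over ℂ(q) pairs Hom(X, Y) and Hom(Y, X)
perfectly, by semisimplicity and characteristic zero, and this turns G ⊣ i-Res into i-Res ⊣ G
(`TraceForm.adjunction`). The left and right adjoints then agree by uniqueness of adjoints, and a
functor with adjoints on both sides is exact. -/

namespace Mirabolic
noncomputable section

/-! ### Representations of `R_n` by sequences of elements of an algebra -/

section algebra

variable {A : Type*} [Ring A] [Algebra K A]

/-- The elements `t 0, …, t (n - 1)` satisfy the defining relations of `R_n`. -/
structure IsRep (n : ℕ) (t : ℕ → A) : Prop where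
  zero : 0 < n → t 0 * t 0 = (q - 2) • t 0 + (q - 1) • (1 : A)
  quad : ∀ i, 1 ≤ i → i < n → t i * t i = (q - 1) • t i + q • (1 : A)
  braid : ∀ i, 1 ≤ i → i + 1 < n → t i * t (i + 1) * t i = t (i + 1) * t i * t (i + 1)
  four : 1 < n → t 0 * t 1 * t 0 * t 1 =
    (q - 1) • (t 1 * t 0 * t 1 + t 1 * t 0) - t 0 * t 1 * t 0
  four' : 1 < n → t 1 * t 0 * t 1 * t 0 =
    (q - 1) • (t 1 * t 0 * t 1 + t 0 * t 1) - t 0 * t 1 * t 0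
  comm : ∀ i j, i + 2 ≤ j → j < n → t i * t j = t j * t i

theorem IsRep.mono {n m : ℕ} {t : ℕ → A} (h : IsRep n t) (hm : m ≤ n) : IsRep m t where
  zero := fun h0 => h.zero (by omega)
  quad := fun i h1 h2 => h.quad i h1 (by omega)
  braid := fun i h1 h2 => h.braid i h1 (by omega)
  four := fun h0 => h.four (by omega)
  four' := fun h0 => h.four' (by omega)
  comm := fun i j h1 h2 => h.comm i j h1 (by omega)

/-- The algebra homomorphism from `R_n` given by elements that satisfy the relations. -/
def IsRep.hom {n : ℕ} {t : ℕ → A} (h : IsRep n t) : R n →ₐ[K] A :=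
  lift (fun i => t i) (by
    intro a b hab
    cases hab with
    | zero i hi => simpa [hi] using h.zero (by have := i.isLt; omega)
    | quad i hi => simpa using h.quad i hi i.isLt
    | braid i j hi hj => simpa [hj] using h.braid i hi (by have := j.isLt; omega)
    | four i j hi hj => simpa [hi, hj] using h.four (by have := j.isLt; omega)
    | four' i j hi hj => simpa [hi, hj] using h.four' (by have := j.isLt; omega)
    | comm i j hij =>
      rcases hij with h' | h'
      · simpa using h.comm i j h' j.isLt
      · simpa using (h.comm j i h' i.isLt).symm)

@[simp]
theorem IsRep.hom_T {n : ℕ} {t : ℕ → A} (h : IsRep n t) (i : Fin n) : h.hom (T i) = t i := by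
  simp [IsRep.hom]

/-- The Jucys–Murphy element `L_{j+1}` built from a sequence of elements. -/
def Lm (t : ℕ → A) : ℕ → A
  | 0 => q⁻¹ • (t 0 + 1)
  | j + 1 => q⁻¹ • (t (j + 1) * Lm t j * t (j + 1))

theorem IsRep.hom_jm {n : ℕ} {t : ℕ → A} (h : IsRep (n + 1) t) (j : ℕ) (hj : j < n + 1) :
    h.hom (jm n j hj) = Lm t j := by
  induction j with
  | zero => simp [jm, e, Lm]
  | succ j ih => simp [jm, Lm, ih]

/-- `Lm t j` is L_{j+1}, so the excluded indices m are j and j + 1, the generators that move the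
entry j + 1. -/
theorem IsRep.commute_Lm {n : ℕ} {t : ℕ → A} (h : IsRep n t) {m j : ℕ} (hm : m < n) (hj : j < n)
    (hmj : m < j ∨ j + 2 ≤ m) : Commute (t m) (Lm t j) := by
  obtain ⟨n, rfl⟩ : ∃ l, n = l + 1 := ⟨n - 1, by omega⟩
  rw [← h.hom_jm j hj, show t m = h.hom (T ⟨m, hm⟩) by simp]
  rcases hmj with h' | h'
  · exact (jm_comm_low n j hj ⟨m, hm⟩ h').map h.hom
  · exact (jm_comm_high n j hj ⟨m, hm⟩ h').map h.hom

theorem commute_Lm_of_commute {t : ℕ → A} {x : A}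
    {j : ℕ} (hx : ∀ m, m ≤ j → Commute (t m) x) : Commute (Lm t j) x := by
  induction j with
  | zero => exact ((hx 0 le_rfl).add_left (Commute.one_left x)).smul_left _
  | succ j ih =>
    have h1 := ih (fun m hm => hx m (by omega))
    exact (((hx _ le_rfl).mul_left h1).mul_left (hx _ le_rfl)).smul_left _

theorem IsRep.Lm_commute {n : ℕ} {t : ℕ → A} (h : IsRep n t) {i j : ℕ} (hi : i < n) (hj : j < n) :
    Commute (Lm t i) (Lm t j) := by
  have key : ∀ i j, i < j → j < n → Commute (Lm t i) (Lm t j) := fun i j hij hj =>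
    commute_Lm_of_commute
      (fun m hm => h.commute_Lm (by omega) hj (Or.inl (by omega)))
  rcases lt_trichotomy i j with h' | rfl | h'
  · exact key i j h' hj
  · exact Commute.refl _
  · exact (key j i h' hi).symm

/-- This is the Bernstein relation of an affine Hecke algebra, obtained by expanding T² in T(TLT).
Together with its mirror image it is all that the divided differences below need. -/
theorem IsRep.T_mul_Lm {n : ℕ} {t : ℕ → A} (h : IsRep n t) {j : ℕ} (hj : j + 1 < n) :
    t (j + 1) * Lm t (j + 1) = (q - 1) • Lm t (j + 1) + Lm t j * t (j + 1) := by
  have hq := h.quad (j + 1) (by omega) hj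
  have hn := q_ne_zero
  rw [Lm, mul_smul_comm, ← mul_assoc, ← mul_assoc, hq]
  simp only [add_mul, smul_mul_assoc, one_mul, smul_add, smul_smul]
  rw [inv_mul_cancel₀ hn, one_smul, mul_comm]

theorem IsRep.Lm_mul_T {n : ℕ} {t : ℕ → A} (h : IsRep n t) {j : ℕ} (hj : j + 1 < n) :
    Lm t (j + 1) * t (j + 1) = (q - 1) • Lm t (j + 1) + t (j + 1) * Lm t j := by
  have hq := h.quad (j + 1) (by omega) hj
  have hn := q_ne_zero
  rw [Lm, smul_mul_assoc, mul_assoc, hq]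
  simp only [mul_add, mul_smul_comm, mul_one, smul_add, smul_smul]
  rw [inv_mul_cancel₀ hn, one_smul, mul_comm]

theorem IsRep.Lm_zero_sq {n : ℕ} {t : ℕ → A} (h : IsRep n t) (hn : 0 < n) :
    Lm t 0 * Lm t 0 = Lm t 0 := by
  have h0 := h.zero hn
  have hq := q_ne_zero
  have h1 : (t 0 + 1) * (t 0 + 1) = q • (t 0 + 1) := by
    rw [add_mul, mul_add, h0]
    simp only [one_mul, mul_one, sub_smul, smul_add, one_smul, two_smul]
    abel
  rw [Lm, smul_mul_assoc, mul_smul_comm, h1, inv_smul_smul₀ hq]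

/-- Think of P = p(Y), Q = p(X) and D = (p(Y) − p(X))/(Y − X). The step multiplies p by (variable −
c), and (Y − c)D + Q is the new quotient. It is built without division because Y − X need not be
invertible. The constant c is 0 in the induction over polynomials and an eigenvalue in
`IsRep.roots`. -/
theorem divided_difference_step {X Y T : A} (hXY : Commute X Y)
    (hTY : T * Y = (q - 1) • Y + X * T) (hYT : Y * T = (q - 1) • Y + T * X) (c : K) {P Q D : A}
    (hQX : Commute Q X) (hQY : Commute Q Y)
    (hDX : Commute D X) (hDY : Commute D Y) (hDT : Commute D T) (h1 : (Y - X) * D = P - Q)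
    (h2 : T * P = Q * T + (q - 1) • (Y * D)) (h3 : P * T = T * Q + (q - 1) • (Y * D)) :
    Commute ((Y - c • 1) * D + Q) X ∧ Commute ((Y - c • 1) * D + Q) Y ∧
      Commute ((Y - c • 1) * D + Q) T ∧
      (Y - X) * ((Y - c • 1) * D + Q) = (Y - c • 1) * P - (X - c • 1) * Q ∧
      T * ((Y - c • 1) * P) = (X - c • 1) * Q * T + (q - 1) • (Y * ((Y - c • 1) * D + Q)) ∧
      (Y - c • 1) * P * T = T * ((X - c • 1) * Q) + (q - 1) • (Y * ((Y - c • 1) * D + Q)) := by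
  have cY : Commute (c • (1 : A)) Y := (Commute.one_left Y).smul_left c
  have cX : Commute (c • (1 : A)) X := (Commute.one_left X).smul_left c
  have cT : Commute (c • (1 : A)) T := (Commute.one_left T).smul_left c
  have cD : Commute (c • (1 : A)) D := (Commute.one_left D).smul_left c
  generalize c • (1 : A) = d at *
  have e3 : P = (Y - X) * D + Q := by rw [h1]; abel
  have hDT' : Commute ((Y - d) * D + Q) T := by
    change ((Y - d) * D + Q) * T = T * ((Y - d) * D + Q)
    have e1 : T * (Y * D) = (q - 1) • (Y * D) + X * (D * T) := by
      rw [← mul_assoc, hTY, add_mul, smul_mul_assoc, mul_assoc, hDT.eq]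
    have e2 : T * Q = P * T - (q - 1) • (Y * D) := by rw [h3]; abel
    have e4 : T * (d * D) = d * (D * T) := by
      rw [← mul_assoc, ← cT.eq, mul_assoc, hDT.eq]
    simp only [mul_add, add_mul, sub_mul, mul_sub]
    rw [e1, e2, e3, e4]
    simp only [add_mul, sub_mul, mul_assoc, hDT.eq]
    abel
  have h4 : (Y - X) * ((Y - d) * D + Q) = (Y - d) * P - (X - d) * Q := by
    have e5 : (Y - X) * (Y - d) = (Y - d) * (Y - X) := by
      simp only [mul_sub, sub_mul, hXY.eq, cX.eq, cY.eq]; abel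
    rw [mul_add, ← mul_assoc, e5, mul_assoc, h1]
    simp only [mul_sub, sub_mul]
    abel
  have h5 : Y * (Y - X) = (Y - X) * Y := by rw [mul_sub, sub_mul, hXY.eq]
  have e6 : T * ((Y - d) * P) = (X - d) * Q * T + (q - 1) • (Y * ((Y - d) * D + Q)) := by
    have e7 : T * (Y - d) = (q - 1) • Y + (X - d) * T := by
      rw [mul_sub, hTY, sub_mul, cT.eq]; abel
    have e8 : Y * P = Y * (Y - X) * D + Y * Q := by rw [e3, mul_add, mul_assoc]
    rw [← mul_assoc, e7, add_mul, smul_mul_assoc, e8, mul_assoc (X - d), h2]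
    simp only [mul_add, mul_sub, sub_mul, ← mul_assoc, mul_smul_comm, smul_add,
      smul_sub, hXY.eq, cY.eq]
    abel
  refine ⟨((hXY.symm.sub_left cX).mul_left hDX).add_left hQX,
      (((Commute.refl Y).sub_left cY).mul_left hDY).add_left hQY, hDT', h4, e6, ?_⟩
  have e7 : (Y - d) * T = (q - 1) • Y + T * (X - d) := by
    rw [sub_mul, hYT, mul_sub, cT.eq]; abel
  rw [mul_assoc, h3, mul_add, ← mul_assoc, e7, add_mul]
  simp only [mul_add, mul_sub, sub_mul, ← mul_assoc, mul_smul_comm, smul_mul_assoc, smul_add,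
      smul_sub, cY.eq]
  abel

/-- Divided differences of polynomials in two commuting elements related by an element `T` of
Hecke type commute with `T`. -/
theorem exists_divided_difference {X Y T : A} (hXY : Commute X Y)
    (hTY : T * Y = (q - 1) • Y + X * T) (hYT : Y * T = (q - 1) • Y + T * X) (p : Polynomial K) :
    ∃ D : A, Commute D X ∧ Commute D Y ∧ Commute D T ∧
      (Y - X) * D = Polynomial.aeval Y p - Polynomial.aeval X p ∧
      T * Polynomial.aeval Y p = Polynomial.aeval X p * T + (q - 1) • (Y * D) ∧
      Polynomial.aeval Y p * T = T * Polynomial.aeval X p + (q - 1) • (Y * D) := by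
  -- The induction must also carry that p(X) commutes with X and Y, which `divided_difference_step`
  -- requires.
  suffices h : ∃ D : A, Commute D X ∧ Commute D Y ∧ Commute D T ∧
      (Y - X) * D = Polynomial.aeval Y p - Polynomial.aeval X p ∧
      T * Polynomial.aeval Y p = Polynomial.aeval X p * T + (q - 1) • (Y * D) ∧
      Polynomial.aeval Y p * T = T * Polynomial.aeval X p + (q - 1) • (Y * D) ∧
      Commute (Polynomial.aeval X p) X ∧ Commute (Polynomial.aeval X p) Y by
    obtain ⟨D, h1, h2, h3, h4, h5, h6, -⟩ := h
    exact ⟨D, h1, h2, h3, h4, h5, h6⟩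
  induction p using Polynomial.induction_on with
  | C a =>
    refine ⟨0, Commute.zero_left _, Commute.zero_left _, Commute.zero_left _, ?_, ?_, ?_, ?_, ?_⟩
    · simp
    · simp [Algebra.commutes]
    · simp [Algebra.commutes]
    · rw [Polynomial.aeval_C]; exact Algebra.commutes a X
    · rw [Polynomial.aeval_C]; exact Algebra.commutes a Y
  | add p p' h h' =>
    obtain ⟨D, h1, h2, h3, h4, h5, h6, h7, h8⟩ := h
    obtain ⟨D', h1', h2', h3', h4', h5', h6', h7', h8'⟩ := h'
    refine ⟨D + D', h1.add_left h1', h2.add_left h2', h3.add_left h3', ?_, ?_, ?_, ?_, ?_⟩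
    · rw [mul_add, h4, h4', map_add, map_add]; abel
    · simp only [map_add, mul_add, add_mul, h5, h5', smul_add]; abel
    · simp only [map_add, mul_add, add_mul, h6, h6', smul_add]; abel
    · rw [map_add]; exact h7.add_left h7'
    · rw [map_add]; exact h8.add_left h8'
  | monomial n a h =>
    obtain ⟨D, h1, h2, h3, h4, h5, h6, h7, h8⟩ := h
    have e : Polynomial.C a * Polynomial.X ^ (n + 1) =
        Polynomial.X * (Polynomial.C a * Polynomial.X ^ n) := by ring
    have := divided_difference_step hXY hTY hYT 0 h7 h8 h1 h2 h3 h4 h5 h6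
    rw [zero_smul, sub_zero, sub_zero] at this
    rw [e, map_mul (Polynomial.aeval Y) Polynomial.X, map_mul (Polynomial.aeval X) Polynomial.X,
      Polynomial.aeval_X, Polynomial.aeval_X]
    obtain ⟨k1, k2, k3, k4, k5, k6⟩ := this
    exact ⟨_, k1, k2, k3, k4, k5, k6, (Commute.refl X).mul_left h7, hXY.mul_left h8⟩

end algebra

/-! ### Consecutive Jucys–Murphy elements: common kernels and possible eigenvalues. -/

section aux

variable {F M : Type*} [Field F] [AddCommGroup M] [Module F M]

/-- Here v stands for T_1 u, and h is the relation for T_0T_1T_0T_1 evaluated on a vector u killed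
by L_1 and L_2. -/
theorem aux_neg (t : F) (u v : M)
    (h : (t - 1) • v + t • u = (t - 1) • (-((t - 1) • v + t • u) + -v) - v) :
    (t * t) • (v + u) = 0 := by
  linear_combination (norm := module) h

/-- Applying T to h and reducing the squares of T by the quadratic relation leaves only T (X z). -/
theorem aux_roots (T X Y : M →ₗ[F] M) (t : F) (z : M) (h : T (Y z) = (t - 1) • Y z + T (X z))
    (h2 : T (T (Y z)) = (t - 1) • T (Y z) + t • Y z)
    (h3 : T (T (X z)) = (t - 1) • T (X z) + t • X z) :
    (t - 1) • T (X z) = t • (Y z - X z) := by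
  have h4 := congrArg T h
  rw [h2, map_add, map_smul, h3] at h4
  linear_combination (norm := module) -h4

/-- The conclusion is t (Y − t x)(Y − t⁻¹ x) z = 0 multiplied out. The terms T z and T (Y z) cancel
between the three relations. -/
theorem aux_roots' (T X Y : M →ₗ[F] M) (t x : F) (z : M) (hx : X z = x • z)
    (hXY : X (Y z) = x • Y z)
    (h : T (Y (X z)) = (t - 1) • Y (X z) + T (X (X z)))
    (h2 : (t - 1) • T (X z) = t • (Y z - X z))
    (h3 : (t - 1) • T (X (Y z)) = t • (Y (Y z) - X (Y z))) :
    t • Y (Y z) - ((t * t + 1) * x) • Y z + (t * x * x) • z = 0 := by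
  simp only [hx, hXY, map_smul] at h h2 h3
  linear_combination (norm := module) (t - 1) • h - h3 + x • h2

theorem aux_roots'' (t x : F) (ht : t ≠ 0) (a b c : M)
    (h : t • a - ((t * t + 1) * x) • b + (t * x * x) • c = 0) :
    a - x • t • b - x • t⁻¹ • (b - x • t • c) = 0 := by
  have h2 := congrArg (t⁻¹ • ·) h
  simp only [smul_add, smul_sub, smul_smul, inv_mul_cancel₀ ht, one_smul, smul_zero] at h2
  rw [← h2]
  have e1 : t⁻¹ * ((t * t + 1) * x) = t⁻¹ * x + t * x := by field_simp; ring
  have e2 : t⁻¹ * (t * x * x) = t * x * (t⁻¹ * x) := by field_simp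
  rw [e1, e2]
  module

end aux

section module

variable {N : Type*} [AddCommGroup N] [Module K N]

theorem q_add_one_ne_zero : 1 + q ≠ 0 := by
  intro h
  have h2 : algebraMap (Polynomial ℂ) K (1 + Polynomial.X) = algebraMap (Polynomial ℂ) K 0 := by
    rw [map_add, RatFunc.algebraMap_X, map_one, map_zero]; exact h
  have h3 := RatFunc.algebraMap_injective ℂ h2
  have h4 := congrArg (Polynomial.eval 1) h3
  norm_num at h4

theorem IsRep.injective {n : ℕ} {t : ℕ → Module.End K N} (h : IsRep n t) {i : ℕ} (h1 : 1 ≤ i)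
    (hi : i < n) : Function.Injective (t i) := by
  rw [← LinearMap.ker_eq_bot, LinearMap.ker_eq_bot']
  intro m hm
  have := LinearMap.congr_fun (h.quad i h1 hi) m
  simp only [Module.End.mul_apply, hm, map_zero, LinearMap.add_apply, LinearMap.smul_apply,
    smul_zero, zero_add, Module.End.one_apply] at this
  exact (smul_eq_zero.1 this.symm).resolve_left q_ne_zero

theorem IsRep.T_Lm_apply {n : ℕ} {t : ℕ → Module.End K N} (h : IsRep n t) {j : ℕ}
    (hj : j + 1 < n) (m : N) :
    t (j + 1) (Lm t (j + 1) m) = (q - 1) • Lm t (j + 1) m + Lm t j (t (j + 1) m) :=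
  LinearMap.congr_fun (h.T_mul_Lm hj) m

theorem IsRep.Lm_T_apply {n : ℕ} {t : ℕ → Module.End K N} (h : IsRep n t) {j : ℕ}
    (hj : j + 1 < n) (m : N) :
    Lm t (j + 1) (t (j + 1) m) = (q - 1) • Lm t (j + 1) m + t (j + 1) (Lm t j m) :=
  LinearMap.congr_fun (h.Lm_mul_T hj) m

theorem IsRep.Lm_comm_apply {n : ℕ} {t : ℕ → Module.End K N} (h : IsRep n t) {m j : ℕ}
    (hm : m < n) (hj : j < n) (hmj : m < j ∨ j + 2 ≤ m) (x : N) :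
    Lm t j (t m x) = t m (Lm t j x) :=
  (LinearMap.congr_fun (h.commute_Lm hm hj hmj).eq x).symm

/-- On the common kernel of `L_{j+1}` and `L_{j+2}` the generator `T_{j+1}` acts as `-1`. -/
theorem IsRep.neg_of_ker {n : ℕ} {t : ℕ → Module.End K N} (h : IsRep n t) {j : ℕ}
    (hj : j + 1 < n) {u : N} (h0 : Lm t j u = 0) (h1 : Lm t (j + 1) u = 0) :
    t (j + 1) u = -u := by
  induction j generalizing u with
  | zero =>
    have hX := h.T_Lm_apply hj u
    rw [h1, map_zero, smul_zero, zero_add] at hX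
    have hq := q_ne_zero
    have e0 : ∀ m, Lm t 0 m = 0 → t 0 m = -m := fun m hm => by
      simp only [Lm, LinearMap.smul_apply, smul_eq_zero, inv_eq_zero, hq, false_or,
        LinearMap.add_apply, Module.End.one_apply] at hm
      exact eq_neg_of_add_eq_zero_left hm
    have a1 := e0 u h0
    have a2 := e0 _ hX.symm
    have h4 := LinearMap.congr_fun (h.four (by omega)) u
    have h5 := LinearMap.congr_fun (h.quad 1 le_rfl (by omega)) u
    simp only [zero_add, Module.End.mul_apply, LinearMap.add_apply, LinearMap.sub_apply,
      LinearMap.smul_apply, Module.End.one_apply] at *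
    -- T_1² u is a combination of T_1 u and u, hence also in the kernel of L_1.
    have a3 := e0 (t 1 (t 1 u)) (by
      rw [h5, map_add, map_smul, map_smul, h0, ← hX]; simp)
    simp only [a1, a2, map_neg, a3, neg_neg] at h4
    rw [h5] at h4
    have h6 : (q * q) • (t 1 u + u) = 0 := by
      exact aux_neg q _ _ h4
    exact eq_neg_of_add_eq_zero_left ((smul_eq_zero.1 h6).resolve_left (mul_ne_zero hq hq))
  | succ j ih =>
    -- The vector T_{j+2} T_{j+1} u lies in the common kernel of L_{j+1} and L_{j+2}, where the
    -- induction hypothesis applies. The braid relation carries the sign back to u, since the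
    -- generators are injective.
    have b1 : Lm t j (t (j + 1) u) = 0 := by
      have := h.T_Lm_apply (j := j) (by omega) u
      rw [h0, map_zero, smul_zero, zero_add] at this
      exact this.symm
    have b2 : Lm t (j + 2) (t (j + 1) u) = 0 := by
      rw [h.Lm_comm_apply (by omega) (by omega) (Or.inl (by omega)), h1, map_zero]
    have c1 : Lm t j (t (j + 2) (t (j + 1) u)) = 0 := by
      rw [h.Lm_comm_apply (by omega) (by omega) (Or.inr (by omega)), b1, map_zero]
    have c2 : Lm t (j + 1) (t (j + 2) (t (j + 1) u)) = 0 := by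
      have := h.T_Lm_apply (j := j + 1) (by omega) (t (j + 1) u)
      rw [b2, map_zero, smul_zero, zero_add] at this
      exact this.symm
    have c3 := ih (by omega) c1 c2
    have c4 := LinearMap.congr_fun (h.braid (j + 1) (by omega) (by omega)) u
    simp only [Module.End.mul_apply] at c4
    have e : j + 1 + 1 = j + 2 := rfl
    rw [e, c3, ← map_neg, ← map_neg] at c4
    exact (h.injective (by omega) (by omega) (h.injective (by omega) (by omega) c4)).symm

/-- The roots of a Jucys–Murphy element on an eigenspace of the previous one. -/
theorem IsRep.roots {n : ℕ} {t : ℕ → Module.End K N} (h : IsRep n t) {j : ℕ}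
    (hj : j + 1 < n) (P : Submodule K N) (hPT : ∀ m ∈ P, t (j + 1) m ∈ P)
    (hPX : ∀ m ∈ P, Lm t j m ∈ P) (hPY : ∀ m ∈ P, Lm t (j + 1) m ∈ P) (x : K) (g : Polynomial K)
    (hg : ∀ m ∈ P, Polynomial.aeval (Lm t j) ((Polynomial.X - Polynomial.C x) * g) m = 0)
    {m : N} (hm : m ∈ P) (hx : Lm t j m = x • m) :
    (x = 0 → Polynomial.aeval (Lm t (j + 1)) (Polynomial.X * g) m = 0) ∧
    Polynomial.aeval (Lm t (j + 1))
      ((Polynomial.X - Polynomial.C (q * x)) * (Polynomial.X - Polynomial.C (q⁻¹ * x)) * g)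
        m = 0 := by
  have hXY : Commute (Lm t j) (Lm t (j + 1)) := h.Lm_commute (by omega) hj
  obtain ⟨D₁, k1, k2, k3, k4, k5, k6⟩ :=
    exists_divided_difference hXY (h.T_mul_Lm hj) (h.Lm_mul_T hj) g
  have qX : Commute (Polynomial.aeval (Lm t j) g) (Lm t j) := by
    simpa using (Commute.all g Polynomial.X).map (Polynomial.aeval (Lm t j))
  have qY : Commute (Polynomial.aeval (Lm t j) g) (Lm t (j + 1)) := by
    rw [show Polynomial.aeval (Lm t j) g = Polynomial.aeval (Lm t (j + 1)) g -
      (Lm t (j + 1) - Lm t j) * D₁ by rw [k4]; abel]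
    refine Commute.sub_left ?_ (((Commute.refl _).sub_left hXY).mul_left k2)
    simpa using (Commute.all g Polynomial.X).map (Polynomial.aeval (Lm t (j + 1)))
  obtain ⟨d1, d2, d3, d4, d5, -⟩ := divided_difference_step hXY (h.T_mul_Lm hj) (h.Lm_mul_T hj) x
    qX qY k1 k2 k3 k4 k5 k6
  set X := Lm t j
  set Y := Lm t (j + 1)
  set S := t (j + 1)
  -- D is the divided difference of p = (variable − x) g, and p(X) vanishes on P.
  set D := (Y - x • 1) * D₁ + Polynomial.aeval X g with hD
  -- On an x-eigenvector of X, the factor Y − x equals Y − X, and D₁ turns it into g(Y) − g(X).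
  have hDm : D m = Polynomial.aeval Y g m := by
    have e1 : D = D₁ * (Y - x • 1) + Polynomial.aeval X g := by
      rw [hD]; congr 1
      exact ((k2.sub_right ((Commute.one_right _).smul_right x)).eq).symm
    have e2 : (Y - x • 1) m = (Y - X) m := by simp [hx]
    have e3 : D₁ ((Y - X) m) = Polynomial.aeval Y g m - Polynomial.aeval X g m := by
      rw [← LinearMap.sub_apply, ← k4, ← (k2.sub_right k1).eq]; rfl
    rw [e1, LinearMap.add_apply, Module.End.mul_apply, e2, e3, sub_add_cancel]
  have hg' : ∀ m ∈ P, ((X - x • 1) * Polynomial.aeval X g) m = 0 := fun m hm => by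
    have := hg m hm
    rwa [map_mul, map_sub, Polynomial.aeval_X, Polynomial.aeval_C,
      Algebra.algebraMap_eq_smul_one] at this
  -- Both m and S m are in P, so p(X) kills them. Hence p(Y) m = (Y − X) D m, and the relation
  -- between S and p(Y) loses its p(X) term.
  have one : ∀ m ∈ P, S (Y (D m)) = (q - 1) • Y (D m) + S (X (D m)) := fun m hm => by
    have a1 := LinearMap.congr_fun d5 m
    have a2 := LinearMap.congr_fun d4 m
    have a3 := hg' (S m) (hPT m hm)
    simp only [Module.End.mul_apply, LinearMap.add_apply, LinearMap.sub_apply,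
      LinearMap.smul_apply, Module.End.one_apply] at a1 a2 a3 hg'
    rw [hg' m hm, sub_zero] at a2
    rw [← a2, a3, map_sub, zero_add] at a1
    exact sub_eq_iff_eq_add.1 a1
  have quad : ∀ m, S (S m) = (q - 1) • S m + q • m := fun m => by
    simpa using LinearMap.congr_fun (h.quad (j + 1) (by omega) hj) m
  have two : ∀ m ∈ P, (q - 1) • S (X (D m)) = q • (Y (D m) - X (D m)) := fun m hm =>
    aux_roots S X Y q _ (one m hm) (quad _) (quad _)
  have cX : ∀ m, X (D m) = D (X m) := fun m => (LinearMap.congr_fun d1.eq m).symm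
  have cY : ∀ m, Y (D m) = D (Y m) := fun m => (LinearMap.congr_fun d2.eq m).symm
  have cXY : ∀ m, X (Y m) = Y (X m) := fun m => LinearMap.congr_fun hXY.eq m
  have hq := q_ne_zero
  have z1 : X (D m) = x • D m := by rw [cX, hx, map_smul]
  constructor
  · intro h0
    have := two m hm
    rw [z1, h0, zero_smul, map_zero, smul_zero, sub_zero] at this
    rw [map_mul, Polynomial.aeval_X, Module.End.mul_apply, ← hDm]
    exact (smul_eq_zero.1 this.symm).resolve_left hq
  -- The first relation is taken at X m, the second at m and at Y m; eliminating S leaves a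
  -- quadratic relation for Y.
  · have a1 := one (X m) (hPX m hm)
    have a2 := two (Y m) (hPY m hm)
    rw [← cX] at a1
    rw [← cY] at a2
    have := aux_roots' S X Y q x (D m) z1 (by rw [cXY, z1, map_smul]) a1 (two m hm) a2
    rw [hDm] at this
    simp only [map_mul, map_sub, Polynomial.aeval_X, Polynomial.aeval_C,
      Algebra.algebraMap_eq_smul_one, Module.End.mul_apply, LinearMap.sub_apply,
      LinearMap.smul_apply, Module.End.one_apply, map_smul]
    exact aux_roots'' q x hq _ _ _ this

end module

/-! ### Standard fillings -/

/-- The eigenvalue of a Jucys–Murphy element that belongs to a box. -/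
def ev (b : Box) : K := if b.1 = 0 then q ^ content b else 0

theorem Below.refl (b : Box) : Below b b := ⟨rfl, le_rfl⟩

theorem Below.antisymm {a b : Box} (h : Below a b) (h' : Below b a) : a = b :=
  Prod.ext h.1 (le_antisymm h.2 h'.2)

theorem q_zpow_injective : Function.Injective (fun k : ℤ => q ^ k) := by
  intro a b h
  by_contra hab
  refine q_zpow_ne_one (sub_ne_zero.2 hab) ?_
  rw [zpow_sub₀ q_ne_zero, div_eq_one_iff_eq (zpow_ne_zero _ q_ne_zero)]
  exact h

theorem ev_zero {b : Box} (h : b.1 = 0) : ev b = q ^ content b := if_pos h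

theorem ev_of_ne {b : Box} (h : b.1 ≠ 0) : ev b = 0 := if_neg h

theorem ev_ne_zero {b : Box} (h : b.1 = 0) : ev b ≠ 0 := by
  rw [ev_zero h]; exact zpow_ne_zero _ q_ne_zero

/-- Powers of q do not vanish, so the eigenvalue 0 marks the second tableau. Within that tableau the
eigenvalue says nothing about the position. -/
theorem eq_of_ev_eq {b b' : Box} (h : ev b = ev b') :
    b.1 = b'.1 ∧ (b.1 = 0 → content b = content b') := by
  by_cases h0 : b.1 = 0
  · have h1 : b'.1 = 0 := by
      by_contra h1
      rw [ev_of_ne h1] at h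
      exact ev_ne_zero h0 h
    refine ⟨h0.trans h1.symm, fun _ => ?_⟩
    rw [ev_zero h0, ev_zero h1] at h
    exact q_zpow_injective h
  · have h1 : b'.1 ≠ 0 := fun h1 => by
      rw [ev_of_ne h0] at h
      exact ev_ne_zero h1 h.symm
    refine ⟨?_, fun h => absurd h h0⟩
    have := b.1.isLt
    have := b'.1.isLt
    omega

/-- A filling without repetitions whose initial segments are bipartitions; the second one is a
column. -/
structure Good {n : ℕ} (U : Fin n → Box) : Prop where
  inj : Function.Injective U
  low : ∀ i b, Below b (U i) → ∃ j ≤ i, U j = b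
  col : ∀ i, (U i).1 ≠ 0 → (U i).2.2 = 0

/-- The box `b` can be added to the shape `D`. -/
structure Addable (D : Set Box) (b : Box) : Prop where
  notMem : b ∉ D
  col : b.1 ≠ 0 → b.2.2 = 0
  low : ∀ b', Below b' b → b' = b ∨ b' ∈ D

theorem IsStandard.good {n k : ℕ} {lam : YoungDiagram} {U : Fin n → Box}
    (hU : IsStandard lam (column k) U) : Good U where
  inj := hU.inj
  low i b hb := by
    have hm : b.2 ∈ (if b.1 = 0 then lam else column k) := by
      rw [hb.1]
      exact YoungDiagram.isLowerSet _ (a := (U i).2) hb.2 ((hU.shape (U i)).1 ⟨i, rfl⟩)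
    obtain ⟨j, rfl⟩ := (hU.shape b).2 hm
    exact ⟨j, hU.mono hb, rfl⟩
  col i hi := by
    have := (hU.shape (U i)).1 ⟨i, rfl⟩
    rw [if_neg hi, mem_column] at this
    exact this.2

namespace Good

variable {n : ℕ} {U : Fin n → Box}

theorem mono (hU : Good U) {i j : Fin n} (h : Below (U i) (U j)) : i ≤ j := by
  obtain ⟨m, hm, h'⟩ := hU.low j _ h
  exact hU.inj h' ▸ hm

theorem isStandard (hU : Good U) {lam mu : YoungDiagram}
    (h : ∀ b : Box, b ∈ Set.range U ↔ b.2 ∈ (if b.1 = 0 then lam else mu)) :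
    IsStandard lam mu U := by
  have key : ∀ i j, Below (U i) (U j) → U i ≠ U j → i < j := fun i j hb hne =>
    lt_of_le_of_ne (hU.mono hb) (fun h => hne (congrArg U h))
  refine ⟨hU.inj, h, fun i j h1 h2 h3 => key i j ⟨h1, h2.le, h3.le⟩ ?_,
    fun i j h1 h2 h3 => key i j ⟨h1, h3.le, h2.le⟩ ?_⟩
  · intro h; rw [h] at h3; exact lt_irrefl _ h3
  · intro h; rw [h] at h3; exact lt_irrefl _ h3

/-- Makes the results on `IsStandard` available for fillings whose shape is only known as a range of
boxes. -/
theorem exists_isStandard (hU : Good U) : ∃ lam mu : YoungDiagram, IsStandard lam mu U := by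
  have key : ∀ t : Fin 2, ∃ lam : YoungDiagram, ∀ x, x ∈ lam ↔ (t, x) ∈ Set.range U := by
    intro t
    refine ⟨⟨(Finset.univ.filter (fun i => (U i).1 = t)).image (fun i => (U i).2), ?_⟩, ?_⟩
    · intro x y hyx hx
      simp only [Finset.coe_image, Set.mem_image, Finset.mem_coe, Finset.mem_filter,
        Finset.mem_univ, true_and] at hx ⊢
      obtain ⟨i, hi, rfl⟩ := hx
      obtain ⟨j, -, hj⟩ := hU.low i ((U i).1, y) ⟨rfl, hyx⟩
      exact ⟨j, by rw [hj]; exact hi, by rw [hj]⟩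
    · intro x
      rw [← YoungDiagram.mem_cells]
      simp only [Finset.mem_image, Finset.mem_filter, Finset.mem_univ, true_and, Set.mem_range]
      exact exists_congr fun i => ⟨fun h => Prod.ext h.1 h.2, fun h => by rw [h]; exact ⟨rfl, rfl⟩⟩
  obtain ⟨lam, hlam⟩ := key 0
  obtain ⟨mu, hmu⟩ := key 1
  refine ⟨lam, mu, hU.isStandard fun b => ?_⟩
  obtain ⟨t, x⟩ := b
  by_cases h : t = 0
  · subst h; rw [if_pos rfl, hlam]
  · have : t = 1 := by omega
    subst this; rw [if_neg h, hmu]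

theorem swap (hU : Good U) {i j : Fin n} (hij : i.val + 1 = j.val) (h : ¬ Below (U i) (U j)) :
    Good (U ∘ Equiv.swap i j) := by
  obtain ⟨lam, mu, hs⟩ := hU.exists_isStandard
  have hs' := hs.swap hij h
  refine ⟨hs'.inj, fun l b hb => ?_, fun l => hU.col _⟩
  obtain ⟨m, -, hm⟩ := hU.low _ b hb
  have e : (U ∘ Equiv.swap i j) (Equiv.swap i j m) = b := by simpa using hm
  exact ⟨Equiv.swap i j m, hs'.mono (by rw [e]; exact hb), e⟩

theorem not_swap {i j : Fin n} (hij : i.val + 1 = j.val) (h : Below (U i) (U j)) :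
    ¬ Good (U ∘ Equiv.swap i j) := fun h' => by
  have : j ≤ i := h'.mono (i := j) (j := i) (by simpa using h)
  have : j.val ≤ i.val := this
  omega

theorem apart (hU : Good U) {i j : Fin n} (hij : i.val + 1 = j.val) : Apart (U i) (U j) := by
  obtain ⟨lam, mu, hs⟩ := hU.exists_isStandard
  exact hs.apart hij

theorem isLow (hU : Good U) {b b' : Box} (hb : b ∈ Set.range U) (h : Below b' b) :
    b' ∈ Set.range U := by
  obtain ⟨i, rfl⟩ := hb
  obtain ⟨j, -, rfl⟩ := hU.low i b' h
  exact ⟨j, rfl⟩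

end Good

theorem range_swap {n : ℕ} (U : Fin n → Box) (i j : Fin n) :
    Set.range (U ∘ Equiv.swap i j) = Set.range U :=
  (Equiv.swap i j).surjective.range_comp U

/-! ### Appending a box -/

/-- The filling `U` with one more entry, in the box `b`. -/
def app {n : ℕ} (U : Fin n → Box) (b : Box) : Fin (n + 1) → Box :=
  Fin.snoc (α := fun _ => Box) U b

section app

variable {n : ℕ}

@[simp]
theorem app_last (U : Fin n → Box) (b : Box) : app U b (Fin.last n) = b := by
  simp [app]

@[simp]
theorem app_castSucc (U : Fin n → Box) (b : Box) (i : Fin n) : app U b i.castSucc = U i := by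
  simp [app]

theorem app_init (U : Fin (n + 1) → Box) : app (U ∘ Fin.castSucc) (U (Fin.last n)) = U :=
  Fin.snoc_init_self U

@[simp]
theorem app_comp_castSucc (U : Fin n → Box) (b : Box) : app U b ∘ Fin.castSucc = U := by
  funext i; simp

theorem range_app (U : Fin n → Box) (b : Box) : Set.range (app U b) = insert b (Set.range U) := by
  ext x
  simp only [Set.mem_range, Fin.exists_fin_succ', app_castSucc, app_last, Set.mem_insert_iff]
  tauto

theorem app_swap (U : Fin n → Box) (b : Box) (i j : Fin n) :
    app U b ∘ Equiv.swap i.castSucc j.castSucc = app (U ∘ Equiv.swap i j) b := by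
  funext x
  refine Fin.lastCases ?_ (fun x => ?_) x
  · rw [Function.comp_apply, Equiv.swap_apply_of_ne_of_ne (Fin.castSucc_lt_last i).ne'
      (Fin.castSucc_lt_last j).ne']
    simp
  · simp only [Function.comp_apply, app_castSucc, Equiv.swap_apply_def]
    split_ifs <;> simp_all

theorem app_app_swap (U : Fin n → Box) (b c : Box) :
    app (app U b) c ∘ Equiv.swap (Fin.last n).castSucc (Fin.last (n + 1)) = app (app U c) b := by
  funext x
  refine Fin.lastCases ?_ (fun x => ?_) x
  · simp
  · refine Fin.lastCases ?_ (fun x => ?_) x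
    · simp
    · rw [Function.comp_apply, Equiv.swap_apply_of_ne_of_ne]
      · simp
      · exact fun h => (Fin.castSucc_lt_last x).ne (Fin.castSucc_injective _ h)
      · exact (Fin.castSucc_lt_last _).ne

/-- Standard fillings are paths of successive addable boxes; the inductions on the number of boxes
run along this equivalence. -/
theorem good_app_iff {U : Fin n → Box} {b : Box} :
    Good (app U b) ↔ Good U ∧ Addable (Set.range U) b := by
  constructor
  · intro h
    refine ⟨⟨fun i j hij => ?_, fun i b' hb => ?_, fun i hi => ?_⟩, ?_, fun hb => ?_,
      fun b' hb => ?_⟩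
    · exact Fin.castSucc_injective _ (h.inj (by simpa using hij))
    · obtain ⟨j, hj, rfl⟩ := h.low i.castSucc b' (by simpa using hb)
      obtain ⟨j, rfl⟩ : ∃ l : Fin n, j = l.castSucc :=
        ⟨j.castPred (by rintro rfl; exact absurd hj (not_le.2 (Fin.castSucc_lt_last i))), by simp⟩
      exact ⟨j, by simpa using hj, by simp⟩
    · have := h.col i.castSucc
      simp only [app_castSucc] at this
      exact this hi
    · rintro ⟨i, hi⟩
      have : i.castSucc = Fin.last n := h.inj (by simpa using hi)
      exact (Fin.castSucc_lt_last i).ne this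
    · have := h.col (Fin.last n)
      simp only [app_last] at this
      exact this hb
    · obtain ⟨j, -, rfl⟩ := h.low (Fin.last n) b' (by simpa using hb)
      refine Fin.lastCases ?_ (fun x => ?_) j
      · simp
      · simp
  · rintro ⟨h, hb⟩
    refine ⟨fun i j => ?_, fun i b' => ?_, fun i => ?_⟩
    · refine Fin.lastCases ?_ (fun i => ?_) i <;> refine Fin.lastCases ?_ (fun j => ?_) j
      · simp
      · intro h'; exact absurd ⟨j, by simpa using h'.symm⟩ hb.notMem
      · intro h'; exact absurd ⟨i, by simpa using h'⟩ hb.notMem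
      · intro h'; exact congrArg _ (h.inj (by simpa using h'))
    · refine Fin.lastCases ?_ (fun i => ?_) i
      · intro h'
        rw [app_last] at h'
        rcases hb.low b' h' with rfl | ⟨j, rfl⟩
        · exact ⟨Fin.last n, le_rfl, by simp⟩
        · exact ⟨j.castSucc, Fin.le_last _, by simp⟩
      · intro h'
        rw [app_castSucc] at h'
        obtain ⟨j, hj, rfl⟩ := h.low i b' h'
        exact ⟨j.castSucc, by simpa using hj, by simp⟩
    · refine Fin.lastCases ?_ (fun i => ?_) i
      · rw [app_last]; exact hb.col
      · rw [app_castSucc]; exact h.col i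

theorem Good.init {U : Fin (n + 1) → Box} (h : Good U) :
    Good (U ∘ Fin.castSucc) ∧ Addable (Set.range (U ∘ Fin.castSucc)) (U (Fin.last n)) := by
  rw [← good_app_iff, app_init]; exact h

end app

/-! ### Addable boxes -/

section addable

variable {D : Set Box} {a b : Box}

theorem Addable.eq_of_below (ha : Addable D a) (hb : Addable D b) (h : Below a b) : a = b :=
  (hb.low a h).resolve_right ha.notMem

/-- Two boxes on one diagonal of the first diagram, or in the one column of the second, are
comparable for `Below`, and comparable addable boxes coincide. This is why the roots of `addPoly`
are simple. -/
theorem Addable.eq_of_ev (ha : Addable D a) (hb : Addable D b) (h : ev a = ev b) : a = b := by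
  obtain ⟨h1, h2⟩ := eq_of_ev_eq h
  by_cases h0 : a.1 = 0
  · have h3 := h2 h0
    unfold content at h3
    rw [h1] at h3
    rcases le_total a.2.1 b.2.1 with h4 | h4
    · exact ha.eq_of_below hb ⟨h1, h4, by omega⟩
    · exact (hb.eq_of_below ha ⟨h1.symm, h4, by omega⟩).symm
  · have h3 := ha.col h0
    have h3' := hb.col (h1 ▸ h0)
    rcases le_total a.2.1 b.2.1 with h4 | h4
    · exact ha.eq_of_below hb ⟨h1, h4, by omega⟩
    · exact (hb.eq_of_below ha ⟨h1.symm, h4, by omega⟩).symm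

/-- Boxes on adjacent diagonals are comparable as well. -/
theorem Addable.content_ne (ha : Addable D a) (hb : Addable D b) (h : a.1 = b.1) :
    content b ≠ content a + 1 := by
  intro h3
  have h' := h
  unfold content at h3
  rw [h] at h3
  rcases le_or_gt a.2.1 b.2.1 with h4 | h4
  · have := ha.eq_of_below hb ⟨h, h4, by omega⟩
    rw [this] at h3; omega
  · have := hb.eq_of_below ha ⟨h.symm, h4.le, by omega⟩
    rw [this] at h3; omega

theorem Addable.insert (hb : Addable D b) (hab : a ≠ b) :
    Addable (insert a D) b :=
  ⟨by rintro (h | h); exacts [hab h.symm, hb.notMem h], hb.col,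
    fun b' h => (hb.low b' h).imp_right Or.inr⟩

/-- A shape contains with a box all boxes to the left of and above it. -/
def IsLow (D : Set Box) : Prop := ∀ b ∈ D, ∀ b', Below b' b → b' ∈ D

/-- In the second tableau the next box is always available; it accounts for the root 0 in
`Branching.succ`. -/
theorem Addable.column {r : ℕ} (hD : IsLow D) (ha : Addable D (1, r, 0)) :
    Addable (Insert.insert (1, r, 0) D) (1, r + 1, 0) := by
  refine ⟨?_, fun _ => rfl, ?_⟩
  · rintro (h | h)
    · simp at h
    · exact ha.notMem (hD _ h _ ⟨rfl, Prod.mk_le_mk.2 ⟨Nat.le_succ r, le_rfl⟩⟩)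
  · rintro ⟨t, r', c⟩ ⟨h1, h2⟩
    simp only [Prod.mk_le_mk] at h1 h2
    subst h1
    obtain rfl : c = 0 := by omega
    rcases h2.1.lt_or_eq with h3 | h3
    · right
      exact ha.low (1, r', 0) ⟨rfl, Prod.mk_le_mk.2 ⟨by omega, le_rfl⟩⟩
    · left; rw [h3]

/-- The box `b` is a removable box of the shape `D`. -/
structure Removable (D : Set Box) (b : Box) : Prop where
  mem : b ∈ D
  max : ∀ b' ∈ D, Below b b' → b' = b

/-- The question is whether (r − 1, c + 1) belongs to D, or r = 0. If not, the box (r − 1, c) ends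
its row and its column. It lies on the diagonal of (r, c + 1), so the two alternatives concern the
same eigenvalue. -/
theorem Addable.right (hD : IsLow D) {r c : ℕ} (ha : Addable D (0, r, c)) :
    Addable (Insert.insert (0, r, c) D) (0, r, c + 1) ∨
      ∃ r', r = r' + 1 ∧ Removable D (0, r', c) := by
  by_cases h0 : r = 0 ∨ (0, r - 1, c + 1) ∈ D
  · left
    refine ⟨?_, fun h => absurd rfl h, ?_⟩
    · rintro (h | h)
      · simp at h
      · exact ha.notMem (hD _ h _ ⟨rfl, Prod.mk_le_mk.2 ⟨le_rfl, Nat.le_succ c⟩⟩)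
    · rintro ⟨t, r', c'⟩ ⟨h1, h2⟩
      simp only [Prod.mk_le_mk] at h1 h2
      subst h1
      rcases h2.2.lt_or_eq with h3 | rfl
      · right
        exact ha.low (0, r', c') ⟨rfl, Prod.mk_le_mk.2 ⟨h2.1, by omega⟩⟩
      · rcases h2.1.lt_or_eq with h3 | rfl
        · right; right
          exact hD _ (h0.resolve_left (by omega)) _ ⟨rfl, Prod.mk_le_mk.2 ⟨by omega, le_rfl⟩⟩
        · left; rfl
  · right
    rw [not_or] at h0
    refine ⟨r - 1, by omega, ?_, ?_⟩
    · refine (ha.low (0, r - 1, c) ⟨rfl, Prod.mk_le_mk.2 ⟨Nat.sub_le _ _, le_rfl⟩⟩).resolve_left ?_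
      simp; omega
    · rintro ⟨t, r', c'⟩ hb ⟨h1, h2⟩
      simp only [Prod.mk_le_mk] at h1 h2
      subst h1
      rcases Nat.lt_or_ge r' r with h3 | h3
      · rcases h2.2.lt_or_eq with h4 | rfl
        · exact absurd (hD _ hb (0, r - 1, c + 1) ⟨rfl, Prod.mk_le_mk.2 ⟨h2.1, h4⟩⟩) h0.2
        · obtain rfl : r' = r - 1 := by omega
          rfl
      · exact absurd (hD _ hb (0, r, c) ⟨rfl, Prod.mk_le_mk.2 ⟨h3, h2.2⟩⟩) ha.notMem

/-- The transpose of `Addable.right`: here (r, c − 1) and (r + 1, c) share a diagonal. -/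
theorem Addable.down (hD : IsLow D) {r c : ℕ} (ha : Addable D (0, r, c)) :
    Addable (Insert.insert (0, r, c) D) (0, r + 1, c) ∨
      ∃ c', c = c' + 1 ∧ Removable D (0, r, c') := by
  by_cases h0 : c = 0 ∨ (0, r + 1, c - 1) ∈ D
  · left
    refine ⟨?_, fun h => absurd rfl h, ?_⟩
    · rintro (h | h)
      · simp at h
      · exact ha.notMem (hD _ h _ ⟨rfl, Prod.mk_le_mk.2 ⟨Nat.le_succ r, le_rfl⟩⟩)
    · rintro ⟨t, r', c'⟩ ⟨h1, h2⟩
      simp only [Prod.mk_le_mk] at h1 h2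
      subst h1
      rcases h2.1.lt_or_eq with h3 | rfl
      · right
        exact ha.low (0, r', c') ⟨rfl, Prod.mk_le_mk.2 ⟨by omega, h2.2⟩⟩
      · rcases h2.2.lt_or_eq with h3 | rfl
        · right; right
          exact hD _ (h0.resolve_left (by omega)) _ ⟨rfl, Prod.mk_le_mk.2 ⟨le_rfl, by omega⟩⟩
        · left; rfl
  · right
    rw [not_or] at h0
    refine ⟨c - 1, by omega, ?_, ?_⟩
    · refine (ha.low (0, r, c - 1) ⟨rfl, Prod.mk_le_mk.2 ⟨le_rfl, Nat.sub_le _ _⟩⟩).resolve_left ?_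
      simp; omega
    · rintro ⟨t, r', c'⟩ hb ⟨h1, h2⟩
      simp only [Prod.mk_le_mk] at h1 h2
      subst h1
      rcases Nat.lt_or_ge c' c with h3 | h3
      · rcases h2.1.lt_or_eq with h4 | rfl
        · exact absurd (hD _ hb (0, r + 1, c - 1) ⟨rfl, Prod.mk_le_mk.2 ⟨h4, h2.2⟩⟩) h0.2
        · obtain rfl : c' = c - 1 := by omega
          rfl
      · exact absurd (hD _ hb (0, r, c) ⟨rfl, Prod.mk_le_mk.2 ⟨h2.1, h3⟩⟩) ha.notMem

/-! ### Removable boxes and the connectedness of the standard fillings of a shape. -/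

theorem Removable.isLow (hD : IsLow D) (hb : Removable D b) : IsLow (D \ {b}) := by
  rintro x ⟨hx, hxb⟩ y hy
  refine ⟨hD x hx y hy, ?_⟩
  rintro rfl
  exact hxb (hb.max x hx hy)

theorem Removable.addable (hD : IsLow D) (hcol : ∀ b ∈ D, b.1 ≠ 0 → b.2.2 = 0)
    (hb : Removable D b) : Addable (D \ {b}) b :=
  ⟨fun h => h.2 rfl, hcol b hb.mem, fun b' h => by
    by_cases h' : b' = b
    · exact Or.inl h'
    · exact Or.inr ⟨hD b hb.mem b' h, h'⟩⟩

theorem Good.low' {n : ℕ} {U : Fin n → Box} (hU : Good U) : IsLow (Set.range U) :=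
  fun _ hb _ h => hU.isLow hb h

theorem Good.col' {n : ℕ} {U : Fin n → Box} (hU : Good U) :
    ∀ b ∈ Set.range U, b.1 ≠ 0 → b.2.2 = 0 := by
  rintro _ ⟨i, rfl⟩; exact hU.col i

theorem Good.removable {n : ℕ} {U : Fin (n + 1) → Box} (hU : Good U) :
    Removable (Set.range U) (U (Fin.last n)) := by
  refine ⟨⟨_, rfl⟩, ?_⟩
  rintro _ ⟨i, rfl⟩ h
  have := hU.mono h
  rw [le_antisymm (Fin.le_last i) this]

theorem Good.range_init {n : ℕ} {U : Fin (n + 1) → Box} (hU : Good U) :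
    Set.range (U ∘ Fin.castSucc) = Set.range U \ {U (Fin.last n)} := by
  have h := range_app (U ∘ Fin.castSucc) (U (Fin.last n))
  rw [app_init] at h
  rw [h, Set.insert_sdiff_of_mem _ (Set.mem_singleton _), Set.sdiff_singleton_eq_self hU.init.2.notMem]

/-- Every finite shape has a standard filling. -/
theorem exists_good (n : ℕ) (D : Finset Box) (hn : D.card = n) (hD : IsLow (D : Set Box))
    (hcol : ∀ b ∈ (D : Set Box), b.1 ≠ 0 → b.2.2 = 0) :
    ∃ U : Fin n → Box, Good U ∧ Set.range U = D := by
  induction n generalizing D with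
  | zero =>
    rw [Finset.card_eq_zero] at hn
    subst hn
    exact ⟨Fin.elim0, ⟨fun i => i.elim0, fun i => i.elim0, fun i => i.elim0⟩, by simp⟩
  | succ n ih =>
    obtain ⟨b, hb⟩ := Finset.exists_maximal (Finset.card_pos.1 (by omega : 0 < D.card))
    have hr : Removable (D : Set Box) b := ⟨hb.prop, fun b' hb' h =>
      le_antisymm (hb.le_of_ge hb' ⟨h.1.le, h.2⟩) ⟨h.1.le, h.2⟩⟩
    have e : ((D.erase b : Finset Box) : Set Box) = (D : Set Box) \ {b} := by simp
    obtain ⟨U, hU, hUD⟩ := ih (D.erase b) (by rw [Finset.card_erase_of_mem hb.prop]; omega)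
      (e ▸ hr.isLow hD) (by rw [e]; exact fun x hx => hcol x hx.1)
    refine ⟨app U b, good_app_iff.2 ⟨hU, ?_⟩, ?_⟩
    · rw [hUD, e]; exact hr.addable hD hcol
    · rw [range_app, hUD, e, Set.insert_sdiff_singleton, Set.insert_eq_of_mem hr.mem]

theorem Good.exists_remove {n : ℕ} {W : Fin (n + 1) → Box} (hW : Good W)
    (hb : Removable (Set.range W) b) :
    ∃ P : Fin n → Box, Good P ∧ Set.range P = Set.range W \ {b} ∧ Good (app P b) ∧
      Set.range (app P b) = Set.range W := by
  classical
  have e : (((Finset.univ.image W).erase b : Finset Box) : Set Box) = Set.range W \ {b} := by simp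
  have hm : b ∈ Finset.univ.image W := by
    obtain ⟨i, hi⟩ := hb.mem
    exact Finset.mem_image.2 ⟨i, Finset.mem_univ _, hi⟩
  obtain ⟨P, hP, hPD⟩ := exists_good n ((Finset.univ.image W).erase b)
    (by rw [Finset.card_erase_of_mem hm, Finset.card_image_of_injective _ hW.inj]; simp)
    (e ▸ hb.isLow hW.low') (by rw [e]; exact fun x hx => hW.col' x hx.1)
  rw [e] at hPD
  refine ⟨P, hP, hPD, good_app_iff.2 ⟨hP, hPD ▸ hb.addable hW.low' hW.col'⟩, ?_⟩
  rw [range_app, hPD, Set.insert_sdiff_singleton, Set.insert_eq_of_mem hb.mem]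

theorem Removable.diff {c : Box} (hb : Removable D b) (hbc : b ≠ c) : Removable (D \ {c}) b :=
  ⟨⟨hb.mem, hbc⟩, fun b' h => hb.max b' h.1⟩

/-- Two removable boxes can be removed one after the other, in both orders. -/
theorem Good.exists_remove_two {n : ℕ} {W : Fin (n + 1) → Box} (hW : Good W)
    {c : Box} (hc : Removable (Set.range W) c) (hbc : W (Fin.last n) ≠ c) :
    ∃ m, ∃ _ : n = m + 1, ∃ P : Fin m → Box, Good P ∧
      Set.range P = (Set.range W \ {W (Fin.last n)}) \ {c} := by
  have h1 := hc.diff hbc.symm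
  rw [← hW.range_init] at h1
  obtain ⟨m, rfl⟩ : ∃ m, n = m + 1 := by
    obtain ⟨i, -⟩ := h1.mem
    exact ⟨n - 1, by have := i.isLt; omega⟩
  obtain ⟨P, hP, h2, -⟩ := hW.init.1.exists_remove h1
  exact ⟨m, rfl, P, hP, by rw [h2, hW.range_init]⟩

theorem good_app_of_range {n : ℕ} {P W : Fin n → Box} (hP : Good P)
    (h : Set.range P = Set.range W) (hW : Good (app W b)) : Good (app P b) := by
  rw [good_app_iff] at hW ⊢
  exact ⟨hP, h ▸ hW.2⟩

/-- Standard fillings of the same shape are connected by exchanges of consecutive entries. -/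
theorem Good.connected {n : ℕ} (Z : (Fin n → Box) → Prop)
    (hZ : ∀ (U : Fin n → Box) (i j : Fin n), i.val + 1 = j.val → Good U →
      Good (U ∘ Equiv.swap i j) → Z U → Z (U ∘ Equiv.swap i j))
    {U U' : Fin n → Box} (hU : Good U) (hU' : Good U') (h : Set.range U = Set.range U')
    (hz : Z U) : Z U' := by
  induction n with
  | zero => rwa [← Subsingleton.elim U U']
  | succ n ih =>
    -- Fillings with the same last box are connected by the induction hypothesis for the first n
    -- entries.
    have same : ∀ (V V' : Fin n → Box) (b : Box), Good (app V b) → Good (app V' b) →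
        Set.range V = Set.range V' → Z (app V b) → Z (app V' b) := by
      intro V V' b hV hV' hVV hz
      refine ih (fun P => Good (app P b) → Z (app P b)) ?_ (good_app_iff.1 hV).1
        (good_app_iff.1 hV').1 hVV (fun _ => hz) hV'
      intro P i j hij hP hPs hzP hPb
      have h1 := good_app_of_range hP (range_swap P i j).symm hPb
      rw [← app_swap] at hPb ⊢
      exact hZ _ _ _ (by simpa using hij) h1 hPb (hzP h1)
    by_cases hb : U (Fin.last n) = U' (Fin.last n)
    · have := same (U ∘ Fin.castSucc) (U' ∘ Fin.castSucc) (U (Fin.last n))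
        (by rwa [app_init]) (by rwa [hb, app_init])
        (by rw [hU.range_init, hU'.range_init, h, hb]) (by rwa [app_init])
      rwa [hb, app_init] at this
    -- For different last boxes b and c, let P fill the remaining boxes. The route is U, (P, c, b),
    -- (P, b, c), U'; its middle step is one exchange, and the outer ones keep the last box.
    · have hr : Removable (Set.range U) (U' (Fin.last n)) := h ▸ hU'.removable
      obtain ⟨m, rfl, P, hP, hPD⟩ := hU.exists_remove_two hr hb
      set b := U (Fin.last (m + 1))
      set c := U' (Fin.last (m + 1))
      have e1 : Set.range (app P c) = Set.range U \ {b} := by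
        rw [range_app, hPD, Set.insert_sdiff_singleton,
          Set.insert_eq_of_mem (show c ∈ Set.range U \ {b} from ⟨hr.mem, Ne.symm hb⟩)]
      have e2 : Set.range (app P b) = Set.range U \ {c} := by
        rw [range_app, hPD, Set.sdiff_sdiff_comm, Set.insert_sdiff_singleton,
          Set.insert_eq_of_mem (show b ∈ Set.range U \ {c} from ⟨hU.removable.mem, hb⟩)]
      have aU := hU.removable.addable hU.low' hU.col'
      have aU' := hr.addable hU.low' hU.col'
      have rb := hU.removable.diff hb
      have rc := hr.diff (Ne.symm hb)
      have g1 : Good (app (app P c) b) := by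
        rw [good_app_iff, good_app_iff, e1, hPD]
        exact ⟨⟨hP, rc.addable (hU.removable.isLow hU.low') (fun x hx => hU.col' x hx.1)⟩, aU⟩
      have g2 : Good (app (app P b) c) := by
        rw [good_app_iff, good_app_iff, e2, hPD, Set.sdiff_sdiff_comm]
        exact ⟨⟨hP, rb.addable (hr.isLow hU.low') (fun x hx => hU.col' x hx.1)⟩, aU'⟩
      have z1 := same (U ∘ Fin.castSucc) (app P c) b (by rwa [app_init]) g1
        (by rw [hU.range_init, e1]) (by rwa [app_init])
      have z2 := hZ _ (Fin.last m).castSucc (Fin.last (m + 1)) (by simp) g1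
        (by rwa [app_app_swap]) z1
      rw [app_app_swap] at z2
      have z3 := same (app P b) (U' ∘ Fin.castSucc) c g2 (by rwa [app_init])
        (by rw [hU'.range_init, ← h, e2]) z2
      rwa [app_init] at z3

/-- A standard filling is determined by the eigenvalues of its entries. -/
theorem Good.eq_of_ev {n : ℕ} {U U' : Fin n → Box} (hU : Good U) (hU' : Good U')
    (h : ∀ i, ev (U i) = ev (U' i)) : U = U' := by
  induction n with
  | zero => exact Subsingleton.elim _ _
  | succ n ih =>
    have h1 := ih hU.init.1 hU'.init.1 (fun i => h _)
    have h2 : U (Fin.last n) = U' (Fin.last n) :=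
      hU.init.2.eq_of_ev (h1 ▸ hU'.init.2) (h _)
    rw [← app_init U, ← app_init U', h1, h2]

/-- A shape with `n` boxes has only finitely many addable boxes. -/
theorem finite_addable {n : ℕ} (U : Fin n → Box) :
    {b | Addable (Set.range U) b}.Finite := by
  have key : ∀ b, Addable (Set.range U) b → b ∈ (Finset.univ ×ˢ (Finset.range (n + 1) ×ˢ
      Finset.range (n + 1)) : Finset Box) := by
    intro b hb
    -- The boxes above b in its column, and those to its left in its row, are distinct entries of U;
    -- so the coordinates of b are at most n.
    have aux : ∀ (m : ℕ) (f : ℕ → Box), Function.Injective f →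
        (∀ i < m, Below (f i) b ∧ f i ≠ b) → m < n + 1 := by
      intro m f hf h
      have hm : ∀ i : Fin m, ∃ j, U j = f i := fun i =>
        (hb.low _ (h i i.isLt).1).resolve_left (h i i.isLt).2
      choose g hg using hm
      have hgi : Function.Injective g := fun i j hij =>
        Fin.ext (hf (by rw [← hg, ← hg, hij]))
      have := Fintype.card_le_of_injective g hgi
      simp at this
      omega
    simp only [Finset.mem_product, Finset.mem_univ, Finset.mem_range, true_and]
    constructor
    · refine aux _ (fun i => (b.1, i, b.2.2)) (fun i j h => by simpa using h) fun i hi =>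
        ⟨⟨rfl, Prod.mk_le_mk.2 ⟨hi.le, le_rfl⟩⟩, fun h => ?_⟩
      rw [← h] at hi; exact lt_irrefl _ hi
    · refine aux _ (fun i => (b.1, b.2.1, i)) (fun i j h => by simpa using h) fun i hi =>
        ⟨⟨rfl, Prod.mk_le_mk.2 ⟨le_rfl, hi.le⟩⟩, fun h => ?_⟩
      rw [← h] at hi; exact lt_irrefl _ hi
  exact (Finset.finite_toSet _).subset key

end addable

/-! ### Weight spaces and seminormal families -/

/-- This equation makes T − cf an intertwiner of weight spaces. Without a denominator it also covers
two boxes of the second tableau, whose eigenvalues are both 0. -/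
theorem cf_mul_ev {b c : Box} (h : Apart b c) : cf b c * (ev c - ev b) = (q - 1) * ev c := by
  have := b.1.isLt
  have := c.1.isLt
  by_cases h1 : b.1 = c.1
  · by_cases h0 : b.1 = 0
    · have d := cf_den h h1
      rw [cf, if_pos h1, ev_zero h0, ev_zero (h1 ▸ h0)]
      have e : q ^ content b = q ^ (content b - content c) * q ^ content c := by
        rw [← zpow_add₀ q_ne_zero]; congr 1; ring
      rw [e]
      field_simp
    · rw [ev_of_ne h0, ev_of_ne (h1 ▸ h0)]; ring
  · by_cases h0 : b.1 = 0
    · have h2 : c.1 ≠ 0 := fun h => h1 (h0.trans h.symm)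
      rw [cf, if_neg h1, if_pos h0, ev_of_ne h2]; ring
    · rw [cf, if_neg h1, if_neg h0, ev_of_ne h0]; ring

/-- In one tableau, 1 + cf = 0 means that the contents differ by exactly 1, which for consecutive
entries forces one box directly below the other. In different tableaux, 1 + cf is 1 or q. -/
theorem Good.one_add_cf_ne_zero {n : ℕ} {U : Fin n → Box} (hU : Good U) {i j : Fin n}
    (hij : i.val + 1 = j.val) (hs : ¬ Below (U i) (U j)) : 1 + cf (U i) (U j) ≠ 0 := by
  by_cases h1 : (U i).1 = (U j).1
  · have d := cf_den (hU.apart hij) h1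
    rw [cf, if_pos h1]
    intro h
    obtain ⟨lam, mu, hst⟩ := hU.exists_isStandard
    have hc := hst.consec hij h1
    have e : q ^ (content (U i) - content (U j)) = q ^ (1 : ℤ) := by
      rw [zpow_one]
      field_simp at h
      linear_combination -h
    have e2 := q_zpow_injective e
    unfold content at e2
    rw [h1] at e2
    apply hs
    refine ⟨h1, ?_, ?_⟩ <;> omega
  · rw [cf, if_neg h1]
    by_cases h0 : (U i).1 = 0
    · rw [if_pos h0]; simp
    · rw [if_neg h0, add_sub_cancel]; exact q_ne_zero

section weights

variable {N : Type*} [AddCommGroup N] [Module K N] {t : ℕ → Module.End K N}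

variable (t) in
/-- The joint eigenspace of the Jucys–Murphy elements for the eigenvalues given by a filling. -/
def Wt {n : ℕ} (U : Fin n → Box) : Submodule K N where
  carrier := {v | ∀ j : Fin n, Lm t j v = ev (U j) • v}
  add_mem' h h' j := by rw [map_add, h j, h' j, smul_add]
  zero_mem' j := by simp
  smul_mem' a v h j := by rw [map_smul, h j, smul_comm]

theorem mem_Wt {n : ℕ} {U : Fin n → Box} {v : N} :
    v ∈ Wt t U ↔ ∀ j : Fin n, Lm t j v = ev (U j) • v := Iff.rfl

theorem mem_Wt_app {n : ℕ} {U : Fin n → Box} {b : Box} {v : N} :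
    v ∈ Wt t (app U b) ↔ v ∈ Wt t U ∧ Lm t n v = ev b • v := by
  simp only [mem_Wt, Fin.forall_fin_succ', app_castSucc, app_last, Fin.val_castSucc, Fin.val_last]

theorem aeval_eigenvector (Y : Module.End K N) {v : N} {c : K} (h : Y v = c • v)
    (p : Polynomial K) : Polynomial.aeval Y p v = p.eval c • v := by
  induction p using Polynomial.induction_on with
  | C a => simp [Algebra.algebraMap_eq_smul_one]
  | add p p' h h' => rw [map_add, LinearMap.add_apply, h, h', Polynomial.eval_add, add_smul]
  | monomial n a h' =>
    rw [pow_succ, ← mul_assoc, map_mul, Polynomial.aeval_X, Module.End.mul_apply, h, map_smul, h',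
      Polynomial.eval_mul_X, smul_smul, mul_comm]

/-- A vector of a stable subspace that is annihilated by a product of distinct linear factors is in
the span of the eigenvectors. -/
theorem mem_of_eigenvectors (Y : Module.End K N) (P W : Submodule K N) (hP : ∀ v ∈ P, Y v ∈ P)
    (S : Finset K) (hW : ∀ c ∈ S, ∀ v ∈ P, Y v = c • v → v ∈ W) {v : N} (hv : v ∈ P)
    (hS : Polynomial.aeval Y (∏ c ∈ S, (Polynomial.X - Polynomial.C c)) v = 0) : v ∈ W := by
  classical
  have stable : ∀ (p : Polynomial K), ∀ v ∈ P, Polynomial.aeval Y p v ∈ P := by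
    intro p
    induction p using Polynomial.induction_on with
    | C a =>
      intro v hv
      simpa [Algebra.algebraMap_eq_smul_one] using P.smul_mem a hv
    | add p p' h h' => intro v hv; rw [map_add]; exact P.add_mem (h v hv) (h' v hv)
    | monomial n a h' =>
      intro v hv
      rw [pow_succ, ← mul_assoc, map_mul, Polynomial.aeval_X, Module.End.mul_apply]
      exact h' _ (hP v hv)
  induction S using Finset.induction_on generalizing v with
  | empty =>
    have h0 : v = 0 := by simpa using hS
    rw [h0]
    exact W.zero_mem
  | insert c S hc ih =>
    have ih' := fun {v} => @ih (fun c hc => hW c (Finset.mem_insert_of_mem hc)) v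
    set w := Polynomial.aeval Y (∏ c ∈ S, (Polynomial.X - Polynomial.C c)) v with hw
    have hwP : w ∈ P := stable _ v hv
    have hYw : Y w = c • w := by
      rw [Finset.prod_insert hc, map_mul, Module.End.mul_apply, ← hw, map_sub, Polynomial.aeval_X,
        Polynomial.aeval_C, LinearMap.sub_apply, Algebra.algebraMap_eq_smul_one] at hS
      simpa using sub_eq_zero.1 hS
    have hwW := hW c (Finset.mem_insert_self c S) w hwP hYw
    set p := ∏ c ∈ S, (Polynomial.X - Polynomial.C c) with hp
    have hpc : p.eval c ≠ 0 := by
      rw [hp, Polynomial.eval_prod, Finset.prod_ne_zero_iff]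
      intro d hd
      rw [Polynomial.eval_sub, Polynomial.eval_X, Polynomial.eval_C, sub_ne_zero]
      rintro rfl; exact hc hd
    -- On the c-eigenvector w = p(Y) v the operator p(Y) is the scalar p(c), which is nonzero as the
    -- roots are distinct; so p kills the corrected vector.
    have h1 := ih' (v := v - (p.eval c)⁻¹ • w) (P.sub_mem hv (P.smul_mem _ hwP)) (by
      rw [map_sub, map_smul, aeval_eigenvector Y hYw, smul_smul, inv_mul_cancel₀ hpc, one_smul,
        sub_self])
    exact (W.sub_mem_iff_left (W.smul_mem _ hwW)).1 h1

/-- If a product of distinct linear factors annihilates a stable subspace, then so does every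
polynomial that vanishes at all eigenvalues. -/
theorem aeval_eq_zero_of_eigenvalues (Y : Module.End K N) (P : Submodule K N)
    (hP : ∀ v ∈ P, Y v ∈ P) (S : Finset K) (g : Polynomial K)
    (hg : ∀ c ∈ S, ∀ v ∈ P, Y v = c • v → v ≠ 0 → g.eval c = 0) {v : N} (hv : v ∈ P)
    (hS : Polynomial.aeval Y (∏ c ∈ S, (Polynomial.X - Polynomial.C c)) v = 0) :
    Polynomial.aeval Y g v = 0 := by
  refine LinearMap.mem_ker.1 (mem_of_eigenvectors Y P (LinearMap.ker (Polynomial.aeval Y g)) hP S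
    (fun c hc w hw hYw => ?_) hv hS)
  rw [LinearMap.mem_ker, aeval_eigenvector Y hYw]
  by_cases h0 : w = 0
  · rw [h0, smul_zero]
  · rw [hg c hc w hw hYw h0, zero_smul]

/-- A family of weight vectors, indexed by the standard fillings of a shape, on which the
generators act by the seminormal formulas. -/
structure Family (t : ℕ → Module.End K N) (n : ℕ) (D : Set Box) (z : (Fin n → Box) → N) :
    Prop where
  zero : ∀ U, ¬ (Good U ∧ Set.range U = D) → z U = 0
  wt : ∀ U, z U ∈ Wt t U
  act : ∀ U, Good U → Set.range U = D → ∀ i j : Fin n, i.val + 1 = j.val →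
    t j (z U) = cf (U i) (U j) • z U + (1 + cf (U i) (U j)) • z (U ∘ Equiv.swap i j)

namespace Family

variable {n : ℕ} {D : Set Box} {z z' : (Fin n → Box) → N}

theorem map (hz : Family t n D z) (A : Module.End K N) (hA : ∀ i < n, Commute (t i) A) :
    Family t n D (fun U => A (z U)) where
  zero U hU := by rw [hz.zero U hU, map_zero]
  wt U j := by
    have h := commute_Lm_of_commute (t := t) (x := A) (j := j) (fun m hm => hA m (by omega))
    have := LinearMap.congr_fun h.eq (z U)
    simp only [Module.End.mul_apply] at this
    rw [this, hz.wt U j, map_smul]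
  act U hU hD i j hij := by
    have := LinearMap.congr_fun (hA j j.isLt).eq (z U)
    simp only [Module.End.mul_apply] at this
    rw [this, hz.act U hU hD i j hij, map_add, map_smul, map_smul]

theorem sub (hz : Family t n D z) (hz' : Family t n D z') :
    Family t n D (fun U => z U - z' U) where
  zero U hU := by rw [hz.zero U hU, hz'.zero U hU, sub_zero]
  wt U := (Wt t U).sub_mem (hz.wt U) (hz'.wt U)
  act U hU hD i j hij := by
    rw [map_sub, hz.act U hU hD i j hij, hz'.act U hU hD i j hij, smul_sub, smul_sub]
    abel

theorem smul (hz : Family t n D z) (a : K) : Family t n D (fun U => a • z U) :=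
  hz.map (a • 1) (fun i _ => (Commute.one_right (t i)).smul_right a)

/-- The coefficient 1 + cf of an admissible exchange is invertible, so vanishing spreads along
exchanges, and `Good.connected` reaches every filling. -/
theorem eq_zero (hz : Family t n D z) {U : Fin n → Box} (hU : Good U) (hD : Set.range U = D)
    (h0 : z U = 0) (U' : Fin n → Box) : z U' = 0 := by
  by_cases hU' : Good U' ∧ Set.range U' = D
  · refine (Good.connected (fun U => Set.range U = D ∧ z U = 0) ?_ hU hU'.1 (hD.trans hU'.2.symm)
      ⟨hD, h0⟩).2
    rintro V i j hij hV hVs ⟨hVD, hz0⟩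
    refine ⟨(range_swap V i j).trans hVD, ?_⟩
    have := hz.act V hV hVD i j hij
    rw [hz0, map_zero, smul_zero, zero_add] at this
    exact (smul_eq_zero.1 this.symm).resolve_left
      (hV.one_add_cf_ne_zero hij fun hb => Good.not_swap hij hb hVs)
  · exact hz.zero U' hU'

/-- A z − a z is again a family. With A = L_{n+1}, an eigenvalue known at one filling holds at all
of them. -/
theorem eq_smul (hz : Family t n D z) (A : Module.End K N) (hA : ∀ i < n, Commute (t i) A) (a : K)
    {U : Fin n → Box} (hU : Good U) (hD : Set.range U = D) (h0 : A (z U) = a • z U)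
    (U' : Fin n → Box) : A (z U') = a • z U' :=
  sub_eq_zero.1 (((hz.map A hA).sub (hz.smul a)).eq_zero hU hD (sub_eq_zero.2 h0) U')

end Family

/-- Exchanges among the first n entries leave the last box b in place. Comparing families with fixed
last boxes is the basic tool of the gluing. -/
theorem Family.restrict {n : ℕ} {D : Set Box} {z : (Fin (n + 1) → Box) → N}
    (hz : Family t (n + 1) D z) {b : Box} (hD : IsLow D) (hcol : ∀ b ∈ D, b.1 ≠ 0 → b.2.2 = 0)
    (hb : Removable D b) : Family t n (D \ {b}) (fun P => z (app P b)) where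
  zero U hU := by
    refine hz.zero _ fun h => hU ⟨(good_app_iff.1 h.1).1, ?_⟩
    rw [← h.2, range_app, Set.insert_sdiff_of_mem _ (Set.mem_singleton _),
      Set.sdiff_singleton_eq_self (good_app_iff.1 h.1).2.notMem]
  wt U := (mem_Wt_app.1 (hz.wt _)).1
  act U hU hUD i j hij := by
    have h1 : Good (app U b) := good_app_iff.2 ⟨hU, hUD ▸ hb.addable hD hcol⟩
    have h2 : Set.range (app U b) = D := by
      rw [range_app, hUD, Set.insert_sdiff_singleton, Set.insert_eq_of_mem hb.mem]
    have := hz.act (app U b) h1 h2 i.castSucc j.castSucc (by simpa using hij)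
    simpa only [app_swap, app_castSucc, Fin.val_castSucc] using this

theorem IsRep.Lm_mem_Wt {n m : ℕ} (h : IsRep n t) {U : Fin m → Box} (hm : m ≤ n) {j : ℕ}
    (hj : j < n) {v : N} (hv : v ∈ Wt t U) : Lm t j v ∈ Wt t U := fun i => by
  have := LinearMap.congr_fun (h.Lm_commute (i := i) (j := j) (by omega) hj).eq v
  simp only [Module.End.mul_apply] at this
  rw [this, hv i, map_smul]

theorem IsRep.T_mem_Wt {n m : ℕ} (h : IsRep n t) {U : Fin m → Box} (hm : m + 1 < n) {v : N}
    (hv : v ∈ Wt t U) : t (m + 1) v ∈ Wt t U := fun i => by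
  rw [h.Lm_comm_apply hm (by omega) (Or.inr (by omega)), hv i, map_smul]

/-- The intertwining operator exchanges the last two eigenvalues. -/
theorem IsRep.intertwine {m n : ℕ} (h : IsRep m t) (hn : n + 2 ≤ m) {P : Fin n → Box} {b c : Box}
    (hbc : Apart b c) {v : N} (hv : v ∈ Wt t (app (app P b) c)) :
    t (n + 1) v - cf b c • v ∈ Wt t (app (app P c) b) := by
  obtain ⟨hv1, hv2⟩ := mem_Wt_app.1 hv
  obtain ⟨hv3, hv4⟩ := mem_Wt_app.1 hv1
  have e := cf_mul_ev hbc
  refine mem_Wt_app.2 ⟨mem_Wt_app.2 ⟨?_, ?_⟩, ?_⟩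
  · exact (Wt t P).sub_mem (h.T_mem_Wt (by omega) hv3) ((Wt t P).smul_mem _ hv3)
  · have := h.T_Lm_apply (j := n) (by omega) v
    rw [hv2, map_smul] at this
    rw [map_sub, map_smul, hv4, eq_sub_of_add_eq' this.symm]
    have e2 : (cf b c * (ev c - ev b)) • v = ((q - 1) * ev c) • v := by rw [e]
    rw [mul_sub, sub_smul] at e2
    rw [smul_sub, smul_smul, smul_smul, smul_smul, mul_comm (ev c) (cf b c), ← e2]
    abel
  · have := h.Lm_T_apply (j := n) (by omega) v
    rw [hv2, hv4, map_smul] at this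
    rw [map_sub, map_smul, this, hv2]
    have e2 : (cf b c * (ev c - ev b)) • v = ((q - 1) * ev c) • v := by rw [e]
    rw [mul_sub, sub_smul] at e2
    rw [smul_sub, smul_smul, smul_smul, smul_smul, mul_comm (ev b) (cf b c), ← e2]
    abel

/-! ### The two statements of the joint induction. -/

/-- The polynomial whose roots are the eigenvalues of the addable boxes. -/
def addPoly {n : ℕ} (U : Fin n → Box) : Polynomial K :=
  ∏ b ∈ (finite_addable U).toFinset, (Polynomial.X - Polynomial.C (ev b))

theorem eval_addPoly {n : ℕ} {U : Fin n → Box} {c : K} :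
    (addPoly U).eval c = 0 ↔ ∃ b, Addable (Set.range U) b ∧ ev b = c := by
  rw [addPoly, Polynomial.eval_prod, Finset.prod_eq_zero_iff]
  simp only [Set.Finite.mem_toFinset, Set.mem_ofPred_eq, Polynomial.eval_sub, Polynomial.eval_X,
    Polynomial.eval_C, sub_eq_zero]
  exact exists_congr fun b => and_congr_right fun _ => eq_comm

variable (t) in
/-- The Jucys–Murphy element `L_{n+1}` has the expected eigenvalues on the weight spaces of
fillings with `n` boxes. -/
def Branching (n : ℕ) : Prop := ∀ U : Fin n → Box, Good U → ∀ v ∈ Wt t U,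
  Polynomial.aeval (Lm t n) (addPoly U) v = 0

variable (t) in
/-- Every weight vector of a standard filling is part of a seminormal family. -/
def Extends (n : ℕ) : Prop := ∀ U : Fin n → Box, Good U → ∀ v ∈ Wt t U,
  ∃ z, Family t n (Set.range U) z ∧ z U = v

theorem Branching.eq_zero {n : ℕ} (hA : Branching t n) {U : Fin n → Box} (hU : Good U) {v : N}
    (hv : v ∈ Wt t U) {c : K} (hc : Lm t n v = c • v)
    (h : ∀ b, Addable (Set.range U) b → ev b ≠ c) : v = 0 := by
  have h1 := hA U hU v hv
  rw [aeval_eigenvector _ hc] at h1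
  refine (smul_eq_zero.1 h1).resolve_left fun h2 => ?_
  obtain ⟨b, hb, hbc⟩ := eval_addPoly.1 h2
  exact h b hb hbc

/-- The action of a generator on weight vectors whose last two entries cannot be exchanged. -/
theorem Branching.T_apply {m n : ℕ} (h : IsRep m t) (hn : n + 2 ≤ m) (hA : Branching t n)
    {P : Fin n → Box} {b c : Box} (hg : Good (app (app P b) c)) (hbc : Below b c) {v : N}
    (hv : v ∈ Wt t (app (app P b) c)) : t (n + 1) v = cf b c • v := by
  have hij : ((Fin.last n).castSucc : Fin (n + 2)).val + 1 = (Fin.last (n + 1)).val := by simp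
  have hap := hg.apart hij
  simp only [app_castSucc, app_last] at hap
  have g1 := (good_app_iff.1 hg)
  have g2 := (good_app_iff.1 g1.1)
  rw [range_app] at g1
  have hne : b ≠ c := fun h => g1.2.notMem (Or.inl h.symm)
  -- In the first tableau the intertwined vector would require a box addable to P with the
  -- eigenvalue of c, and there is none. In the second tableau both eigenvalues are 0, and the
  -- information comes from `IsRep.neg_of_ker`.
  by_cases h0 : b.1 = 0
  · have h1 := mem_Wt_app.1 (h.intertwine hn hap hv)
    have h2 := mem_Wt_app.1 h1.1
    refine sub_eq_zero.1 (hA.eq_zero g2.1 h2.1 h2.2 fun d hd hdc => ?_)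
    have hbd : b ≠ d := by
      rintro rfl
      obtain ⟨e1, e2⟩ := eq_of_ev_eq hdc
      exact hap e1 (e2 h0)
    have := (hd.insert hbd).eq_of_ev g1.2 hdc
    subst this
    exact hne (g2.2.eq_of_below hd hbc)
  · have hc0 : c.1 ≠ 0 := hbc.1 ▸ h0
    obtain ⟨hv1, hv2⟩ := mem_Wt_app.1 hv
    obtain ⟨-, hv4⟩ := mem_Wt_app.1 hv1
    rw [ev_of_ne hc0, zero_smul] at hv2
    rw [ev_of_ne h0, zero_smul] at hv4
    rw [h.neg_of_ker (by omega) hv4 hv2]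
    obtain ⟨lam, mu, hst⟩ := hg.exists_isStandard
    have hcf := hst.cf_below hij (by simpa using hbc)
    simp only [app_castSucc, app_last] at hcf
    rcases hcf with ⟨e1, -⟩ | ⟨-, -, e2⟩
    · exact absurd (Prod.ext hbc.1 (Prod.ext e1 ((g2.2.col h0).trans (g1.2.col hc0).symm))) hne
    · rw [e2, neg_one_smul]

end weights

/-! ### The induction step for the eigenvalues. -/

section weights

variable {N : Type*} [AddCommGroup N] [Module K N] {t : ℕ → Module.End K N}

theorem Extends.zero : Extends t 0 := by
  intro U hU v hv
  refine ⟨fun _ => v, ⟨fun V hV => (hV ⟨?_, ?_⟩).elim, fun V j => j.elim0,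
    fun V _ _ i => i.elim0⟩, rfl⟩
  · rwa [Subsingleton.elim V U]
  · rw [Subsingleton.elim V U]

/-- L_1 = e is idempotent, and its eigenvalues 0 and 1 belong to the two boxes that can be added to
the empty shape. -/
theorem Branching.zero {m : ℕ} (h : IsRep m t) (hm : 1 ≤ m) : Branching t 0 := by
  classical
  intro U hU v hv
  have hr : Set.range U = ∅ := Set.range_eq_empty U
  refine aeval_eq_zero_of_eigenvalues (Lm t 0) ⊤ (fun _ _ => Submodule.mem_top) {0, 1} _ ?_
    Submodule.mem_top ?_
  · have key : ∀ s : Fin 2, Addable (Set.range U) (s, 0, 0) := fun s =>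
      ⟨by rw [hr]; exact id, fun _ => rfl, fun b hb => Or.inl (hb.antisymm
        ⟨hb.1.symm, Prod.mk_le_mk.2 ⟨Nat.zero_le _, Nat.zero_le _⟩⟩)⟩
    intro c hc v _ _ _
    rw [eval_addPoly]
    rcases Finset.mem_insert.1 hc with rfl | hc
    · exact ⟨(1, 0, 0), key 1, ev_of_ne (by simp)⟩
    · rw [Finset.mem_singleton] at hc
      subst hc
      exact ⟨(0, 0, 0), key 0, by rw [ev_zero rfl]; simp [content]⟩
  · have := LinearMap.congr_fun (h.Lm_zero_sq (by omega)) v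
    rw [Finset.prod_insert (by simp), Finset.prod_singleton]
    simp only [map_mul, map_sub, Polynomial.aeval_X, map_zero, sub_zero,
      map_one, Module.End.mul_apply, LinearMap.sub_apply, Module.End.one_apply] at this ⊢
    rw [this, sub_self]

/-- A weight of the form `(…, d, a, d)` with `d` left of or above `a` does not occur. -/
theorem Branching.eq_zero_of_removable {m k : ℕ} (h : IsRep m t) (hm : k + 2 ≤ m)
    (hA : Branching t k) (hB : Extends t (k + 1)) {V : Fin k → Box} {a d : Box} (hV : Good V)
    (ha : Addable (Set.range V) a) (hd : Removable (Set.range V) d) (hda : Below d a)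
    (h0 : a.1 = 0) (hc : content d = content a + 1 ∨ content a = content d + 1) {v : N}
    (hv : v ∈ Wt t (app V a)) (hvd : Lm t (k + 1) v = ev d • v) : v = 0 := by
  obtain ⟨k, rfl⟩ : ∃ l, k = l + 1 := by
    obtain ⟨i, -⟩ := hd.mem
    exact ⟨k - 1, by have := i.isLt; omega⟩
  obtain ⟨P, -, -, hPd, hPr⟩ := hV.exists_remove hd
  have hg : Good (app (app P d) a) := good_app_iff.2 ⟨hPd, hPr ▸ ha⟩
  have hgV : Good (app V a) := good_app_iff.2 ⟨hV, ha⟩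
  have hr : Set.range (app (app P d) a) = Set.range (app V a) := by
    rw [range_app (app P d), hPr, ← range_app]
  obtain ⟨z, hz, rfl⟩ := hB _ hgV v hv
  have hY := hz.eq_smul (Lm t (k + 1 + 1)) (fun i hi => h.commute_Lm (by omega) (by omega)
    (Or.inl hi)) _ hgV rfl hvd
  have hij : ((Fin.last k).castSucc : Fin (k + 2)).val + 1 = (Fin.last (k + 1)).val := by simp
  -- The family moves the question to the filling (P, d, a), where both generators involved act on w
  -- by scalars.
  set w := z (app (app P d) a) with hw
  suffices hw0 : w = 0 from hz.eq_zero hg hr hw0 _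
  have hap := hg.apart hij
  have hS := hz.act _ hg hr _ _ hij
  rw [hz.zero _ fun hh => Good.not_swap hij (by simpa using hda) hh.1, smul_zero, add_zero] at hS
  simp only [app_castSucc, app_last, Fin.val_last] at hS hap
  rw [← hw] at hS
  have hwt : w ∈ Wt t (app (app (app P d) a) d) := mem_Wt_app.2 ⟨hz.wt _, hY _⟩
  have hT := mem_Wt_app.1 (h.intertwine (by omega) hap.symm hwt)
  have hT2 := mem_Wt_app.1 hT.1
  -- Exchanging a with the last d would need an addable box with the eigenvalue of d. Its content
  -- would differ by one from that of the addable box a, contrary to `Addable.content_ne`.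
  have hT3 := sub_eq_zero.1 (hA.eq_zero hPd hT2.1 hT2.2 fun b hb hbd => by
    rw [hPr] at hb
    obtain ⟨e1, e2⟩ := eq_of_ev_eq hbd
    have hb0 : b.1 = 0 := e1.trans (hda.1.trans h0)
    have e3 := e2 hb0
    rcases hc with hc | hc
    · exact ha.content_ne hb (h0.trans hb0.symm) (e3.trans hc)
    · exact hb.content_ne ha (hb0.trans h0.symm) (hc.trans (by rw [e3])))
  rw [cf_symm hap] at hT3
  have hq : cf d a ^ 2 = (q - 1) * cf d a + q := by
    obtain ⟨lam, mu, hst⟩ := hg.exists_isStandard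
    simpa using hst.cf_quad hij (by simpa using hda)
  have hb := LinearMap.congr_fun (h.braid (k + 1) (by omega) (by omega)) w
  simp only [Module.End.mul_apply] at hb
  simp only [hS, hT3, map_smul, smul_smul] at hb
  generalize cf d a = A at *
  -- The braid relation reads A(q − 1 − A)(2A − (q − 1)) w = 0. As A² = (q − 1)A + q, one has A(q −
  -- 1 − A) = −q and (2A − (q − 1))² = (q + 1)².
  have h1 : (q * (q + 1) ^ 2) • w = 0 := by
    have e := sub_eq_zero.2 hb
    rw [← sub_smul] at e
    rw [show q * (q + 1) ^ 2 = -(2 * A - (q - 1)) * (A * (q - 1 - A) * A -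
        (q - 1 - A) * A * (q - 1 - A)) by
      linear_combination -(4 * (A ^ 2 - (q - 1) * A - q) + 8 * q + (q - 1) ^ 2) * hq, mul_smul]
    rw [e, smul_zero]
  refine (smul_eq_zero.1 h1).resolve_left (mul_ne_zero q_ne_zero (pow_ne_zero 2 ?_))
  rw [add_comm]; exact q_add_one_ne_zero

/-- Let a be the last box and x = ev a. By `IsRep.roots` the candidates, for a in the first tableau,
are q x, q⁻¹ x and the eigenvalues of the other boxes addable before a, which stay addable. The
first two belong to the boxes to the right of and below a. If such a box is not addable, a removable
box d has the same eigenvalue, and `Branching.eq_zero_of_removable` shows that the candidate does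
not occur. -/
theorem Branching.succ {m k : ℕ} (h : IsRep m t) (hm : k + 2 ≤ m)
    (hA : Branching t k) (hB : Extends t (k + 1)) : Branching t (k + 1) := by
  classical
  intro U hU v hv
  obtain ⟨V, a, rfl⟩ : ∃ V a, U = app V a := ⟨_, _, (app_init U).symm⟩
  obtain ⟨hV, ha⟩ := good_app_iff.1 hU
  obtain ⟨hv1, hv2⟩ := mem_Wt_app.1 hv
  set F := (finite_addable V).toFinset with hF
  have hmem : ∀ b, b ∈ F ↔ Addable (Set.range V) b := fun b => by simp [hF]
  set g : Polynomial K := ∏ b ∈ F.erase a, (Polynomial.X - Polynomial.C (ev b)) with hg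
  have hroots := h.roots (j := k) (by omega) (Wt t V) (fun v hv => h.T_mem_Wt (by omega) hv)
    (fun v hv => h.Lm_mem_Wt (by omega) (by omega) hv)
    (fun v hv => h.Lm_mem_Wt (by omega) (by omega) hv) (ev a) g (fun v hv => by
      rw [hg, Finset.mul_prod_erase F (fun b => Polynomial.X - Polynomial.C (ev b))
        ((hmem a).2 ha)]
      exact hA V hV v hv) hv1 hv2
  have hinj : Set.InjOn ev (F.erase a : Finset Box) := fun b hb c hc hbc =>
    ((hmem b).1 (Finset.mem_of_mem_erase hb)).eq_of_ev ((hmem c).1 (Finset.mem_of_mem_erase hc)) hbc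
  have himg : ∏ c ∈ (F.erase a).image ev, (Polynomial.X - Polynomial.C c) = g := by
    rw [hg, Finset.prod_image hinj]
  have hadd : ∀ c ∈ (F.erase a).image ev, ∃ b, Addable (Set.range (app V a)) b ∧ ev b = c := by
    intro c hc
    obtain ⟨b, hb, rfl⟩ := Finset.mem_image.1 hc
    rw [Finset.mem_erase, hmem] at hb
    exact ⟨b, by rw [range_app]; exact hb.2.insert hb.1.symm, rfl⟩
  have hst : ∀ v ∈ Wt t (app V a), Lm t (k + 1) v ∈ Wt t (app V a) := fun v hv =>
    h.Lm_mem_Wt (by omega) (by omega) hv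
  have hq := q_ne_zero
  by_cases h0 : a.1 = 0
  · obtain ⟨s, r, c⟩ := a
    simp only at h0
    subst h0
    have hx := ev_ne_zero (b := (0, r, c)) rfl
    have evr : ev (0, r, c + 1) = q * ev (0, r, c) := by
      rw [ev_zero rfl, ev_zero rfl, ← zpow_one_add₀ hq]; congr 1; simp [content]; ring
    have evd : ev (0, r + 1, c) = q⁻¹ * ev (0, r, c) := by
      rw [ev_zero rfl, ev_zero rfl, ← zpow_neg_one, ← zpow_add₀ hq]; congr 1; simp [content]; ring
    -- The candidates must be pairwise distinct for their polynomial to be a product over a set of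
    -- roots.
    have n1 : q⁻¹ * ev (0, r, c) ∉ (F.erase (0, r, c)).image ev := by
      rw [← evd, Finset.mem_image]
      rintro ⟨b, hb, hbd⟩
      rw [Finset.mem_erase, hmem] at hb
      obtain ⟨e1, e2⟩ := eq_of_ev_eq hbd
      refine hb.2.content_ne ha e1 ?_
      rw [e2 e1]; simp [content]; ring
    have n2 : q * ev (0, r, c) ∉ insert (q⁻¹ * ev (0, r, c)) ((F.erase (0, r, c)).image ev) := by
      rw [Finset.mem_insert, not_or]
      constructor
      · rw [← evd, ← evr]
        intro h
        have := (eq_of_ev_eq h).2 rfl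
        simp [content] at this
        omega
      · rw [← evr, Finset.mem_image]
        rintro ⟨b, hb, hbd⟩
        rw [Finset.mem_erase, hmem] at hb
        obtain ⟨e1, e2⟩ := eq_of_ev_eq hbd
        refine ha.content_ne hb.2 e1.symm ?_
        rw [e2 e1]; simp [content]; ring
    refine aeval_eq_zero_of_eigenvalues (Lm t (k + 1)) (Wt t (app V (0, r, c))) hst
      (insert (q * ev (0, r, c)) (insert (q⁻¹ * ev (0, r, c)) ((F.erase (0, r, c)).image ev))) _ ?_
      hv ?_
    · intro x hx v hv hvx hne
      rw [eval_addPoly]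
      rcases Finset.mem_insert.1 hx with rfl | hx
      · rcases ha.right hV.low' with hb | ⟨r', rfl, hd⟩
        · exact ⟨_, by rw [range_app]; exact hb, evr⟩
        · refine absurd (hA.eq_zero_of_removable h hm hB hV ha hd
            ⟨rfl, Prod.mk_le_mk.2 ⟨Nat.le_succ r', le_rfl⟩⟩ rfl (Or.inl ?_) hv ?_) hne
          · simp [content]; ring
          · rw [hvx, ← evr]; congr 1
            rw [ev_zero rfl, ev_zero rfl]; congr 1; simp [content]
      rcases Finset.mem_insert.1 hx with rfl | hx
      · rcases ha.down hV.low' with hb | ⟨c', rfl, hd⟩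
        · exact ⟨_, by rw [range_app]; exact hb, evd⟩
        · refine absurd (hA.eq_zero_of_removable h hm hB hV ha hd
            ⟨rfl, Prod.mk_le_mk.2 ⟨le_rfl, Nat.le_succ c'⟩⟩ rfl (Or.inr ?_) hv ?_) hne
          · simp [content]; ring
          · rw [hvx, ← evd]; congr 1
            rw [ev_zero rfl, ev_zero rfl]; congr 1; simp [content]
      · exact hadd _ hx
    · rw [Finset.prod_insert n2, Finset.prod_insert n1, himg, ← mul_assoc]
      exact hroots.2
  -- In the second tableau x = 0, and both candidates would be 0. The sharper first conclusion of
  -- `IsRep.roots` keeps this root simple.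
  · have n1 : (0 : K) ∉ (F.erase a).image ev := by
      rw [Finset.mem_image]
      rintro ⟨b, hb, hb0⟩
      rw [Finset.mem_erase, hmem] at hb
      exact hb.1 (hb.2.eq_of_ev ha (by rw [hb0, ev_of_ne h0]))
    refine aeval_eq_zero_of_eigenvalues (Lm t (k + 1)) (Wt t (app V a)) hst
      (insert 0 ((F.erase a).image ev)) _ ?_ hv ?_
    · intro x hx v hv hvx hne
      rw [eval_addPoly]
      rcases Finset.mem_insert.1 hx with rfl | hx
      · obtain ⟨s, r, c⟩ := a
        obtain rfl : s = 1 := by simp only at h0; omega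
        obtain rfl : c = 0 := ha.col h0
        refine ⟨(1, r + 1, 0), ?_, ev_of_ne (by simp)⟩
        rw [range_app]
        exact ha.column hV.low'
      · exact hadd _ hx
    · rw [Finset.prod_insert n1, himg, Polynomial.C_0, sub_zero]
      exact hroots.1 (ev_of_ne h0)

end weights

/-! ### Gluing seminormal families along the last box. -/

section aux

variable {F M : Type*} [Field F] [AddCommGroup M] [Module F M]

/-- Since 1 + A is invertible, h expresses w through v and T v, so the quadratic relation determines
T w. -/
theorem aux_inv (T : M →ₗ[F] M) (A t : F) (v w : M) (hA : 1 + A ≠ 0)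
    (h : T v = A • v + (1 + A) • w) (h2 : T (T v) = (t - 1) • T v + t • v) :
    T w = (t - 1 - A) • w + (1 + (t - 1 - A)) • v := by
  refine smul_right_injective M hA ?_
  rw [h, map_add, map_smul, map_smul, h] at h2
  simp only
  linear_combination (norm := module) h2

/-- Converse use of the computation in `aux_braid`: the braid relation on v is given, and the last
unknown action is solved for. T v21 enters with the coefficient (1 + B)(1 + C). -/
theorem aux_braid_last (S T : M →ₗ[F] M) (A B C t : F) (v v1 v2 v12 v21 v3 : M)
    (h : A * B = C * (A + B - (t - 1))) (hB : 1 + B ≠ 0) (hC : 1 + C ≠ 0)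
    (hb : S (T (S v)) = T (S (T v)))
    (f : S v = A • v + (1 + A) • v1) (g : T v = B • v + (1 + B) • v2)
    (f1 : S v1 = (t - 1 - A) • v1 + (1 + (t - 1 - A)) • v) (g1 : T v1 = C • v1 + (1 + C) • v12)
    (f2 : S v2 = C • v2 + (1 + C) • v21) (g2 : T v2 = (t - 1 - B) • v2 + (1 + (t - 1 - B)) • v)
    (f12 : S v12 = B • v12 + (1 + B) • v3) :
    T v21 = A • v21 + (1 + A) • v3 := by
  refine smul_right_injective M (mul_ne_zero hB hC) ?_
  rw [f, g] at hb
  simp only [map_add, map_smul, f, g, f1, f2, g1, g2, f12] at hb ⊢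
  linear_combination (norm := module) -hb + ((1 + A) * h) • v1 + (-(1 + B) * h) • v2 +
    ((A - B) * h) • v

end aux

theorem good_app_app {n : ℕ} {D : Set Box} {b c : Box} (hlow : IsLow D)
    (hcol : ∀ b ∈ D, b.1 ≠ 0 → b.2.2 = 0) (hb : Removable D b) (hc : Removable D c) (hbc : b ≠ c)
    {P : Fin n → Box} (hP : Good P) (hr : Set.range P = (D \ {b}) \ {c}) :
    Good (app (app P c) b) ∧ Set.range (app P c) = D \ {b} ∧
      Set.range (app (app P c) b) = D := by
  have e1 : Set.range (app P c) = D \ {b} := by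
    rw [range_app, hr, Set.insert_sdiff_singleton,
      Set.insert_eq_of_mem (show c ∈ D \ {b} from ⟨hc.mem, hbc.symm⟩)]
  refine ⟨?_, e1, ?_⟩
  · rw [good_app_iff, good_app_iff, e1, hr]
    exact ⟨⟨hP, (hc.diff hbc.symm).addable (hb.isLow hlow) (fun x hx => hcol x hx.1)⟩,
      hb.addable hlow hcol⟩
  · rw [range_app, e1, Set.insert_sdiff_singleton, Set.insert_eq_of_mem hb.mem]

section weights

variable {N : Type*} [AddCommGroup N] [Module K N] {t : ℕ → Module.End K N}

theorem IsRep.quad_apply {m : ℕ} (h : IsRep m t) {i : ℕ} (h1 : 1 ≤ i) (hi : i < m) (v : N) :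
    t i (t i v) = (q - 1) • t i v + q • v := by
  simpa using LinearMap.congr_fun (h.quad i h1 hi) v

theorem IsRep.braid_apply {m : ℕ} (h : IsRep m t) {i : ℕ} (h1 : 1 ≤ i) (hi : i + 1 < m) (v : N) :
    t i (t (i + 1) (t i v)) = t (i + 1) (t i (t (i + 1) v)) :=
  LinearMap.congr_fun (h.braid i h1 hi) v

theorem IsRep.commute_T {m : ℕ} (h : IsRep m t) {i j : ℕ} (hij : i + 2 ≤ j) (hj : j < m) :
    Commute (t i) (t j) := h.comm i j hij hj

/-- Families for the other removable boxes, obtained from a family for one removable box. -/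
theorem Extends.exists_families {m k : ℕ} (h : IsRep m t) (hm : k + 2 ≤ m)
    (hB : Extends t (k + 1)) {W : Fin (k + 2) → Box} (hW : Good W)
    {y : (Fin (k + 1) → Box) → N} {b : Box} (hb : W (Fin.last (k + 1)) = b)
    (hy : Family t (k + 1) (Set.range W \ {b}) y)
    (hY : ∀ U, Lm t (k + 1) (y U) = ev b • y U) {c : Box} (hc : Removable (Set.range W) c)
    (hbc : b ≠ c) :
    ∃ z, Family t (k + 1) (Set.range W \ {c}) z ∧ (∀ U, Lm t (k + 1) (z U) = ev c • z U) ∧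
      ∀ P : Fin k → Box, Good P → Set.range P = (Set.range W \ {b}) \ {c} →
        t (k + 1) (y (app P c)) =
          cf c b • y (app P c) + (1 + cf c b) • z (app P b) := by
  subst hb
  set b := W (Fin.last (k + 1))
  obtain ⟨k', hk', P, hP, hPr⟩ := hW.exists_remove_two hc hbc
  obtain rfl : k' = k := by omega
  have hrb : Removable (Set.range W) b := hW.removable
  obtain ⟨g1, e1, e1'⟩ := good_app_app hW.low' hW.col' hrb hc hbc hP hPr
  obtain ⟨g2, e2, e2'⟩ := good_app_app hW.low' hW.col' hc hrb hbc.symm hP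
    (by rw [hPr, Set.sdiff_sdiff_comm])
  have hij : ((Fin.last k').castSucc : Fin (k' + 2)).val + 1 = (Fin.last (k' + 1)).val := by simp
  have hap := g1.apart hij
  have hA := g1.one_add_cf_ne_zero hij
  simp only [app_castSucc, app_last] at hap hA
  have hA := hA fun hh => hbc (hc.max _ hrb.mem hh)
  have hv0 : y (app P c) ∈ Wt t (app (app P c) b) := mem_Wt_app.2 ⟨hy.wt _, hY _⟩
  have hu := (Wt t _).smul_mem (1 + cf c b)⁻¹ (h.intertwine hm hap hv0)
  -- This is the value that the seminormal formula forces for z at (P, b).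
  set u := (1 + cf c b)⁻¹ • (t (k' + 1) (y (app P c)) - cf c b • y (app P c)) with hu0
  obtain ⟨hu1, hu2⟩ := mem_Wt_app.1 hu
  obtain ⟨z, hz, hzu⟩ := hB _ (good_app_iff.1 g2).1 u hu1
  have hYz := hz.eq_smul (Lm t (k' + 1)) (fun i hi => h.commute_Lm (by omega) (by omega)
    (Or.inl hi)) (ev c) (good_app_iff.1 g2).1 rfl (by rw [hzu, hu2])
  rw [e2] at hz
  refine ⟨z, hz, hYz, fun Q hQ hQr => ?_⟩
  -- The last generator commutes with those acting on the first k' entries. The difference of the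
  -- two sides of the formula is thus a family in Q, and it vanishes at P by the choice of u.
  have f1 := hy.restrict (hrb.isLow hW.low') (fun x hx => hW.col' x hx.1) (hc.diff hbc.symm)
  have f2 := hz.restrict (hc.isLow hW.low') (fun x hx => hW.col' x hx.1) (hrb.diff hbc)
  rw [Set.sdiff_sdiff_comm] at f2
  have f3 := ((f1.map (t (k' + 1)) fun i hi => h.commute_T (by omega) (by omega)).sub
    (f1.smul (cf c b))).sub (f2.smul (1 + cf c b))
  have := f3.eq_zero hP hPr (by
    rw [hzu, hu0, smul_smul, mul_inv_cancel₀ hA, one_smul, sub_self]) Q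
  rw [sub_sub, sub_eq_zero] at this
  exact this

/-- The new family consists of one family F c for each possible last box c. For the last box b of
the given filling it is the known family y, and the others are forced by the last generator. The
formulas between F c and F c' for c, c' ≠ b remain; they follow from the braid relation on the six
orders of b, c, c'. -/
theorem Extends.succ {m k : ℕ} (h : IsRep m t) (hm : k + 2 ≤ m)
    (hA : Branching t k) (hB : Extends t (k + 1)) : Extends t (k + 2) := by
  classical
  intro W hW v hv
  obtain ⟨U, b, rfl⟩ : ∃ V a, W = app V a := ⟨_, _, (app_init W).symm⟩
  obtain ⟨hU, -⟩ := good_app_iff.1 hW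
  obtain ⟨hv1, hv2⟩ := mem_Wt_app.1 hv
  obtain ⟨y, hy, rfl⟩ := hB U hU v hv1
  have hY := hy.eq_smul (Lm t (k + 1)) (fun i hi => h.commute_Lm (by omega) (by omega)
    (Or.inl hi)) (ev b) hU rfl hv2
  have hrU := hW.range_init
  rw [app_comp_castSucc, app_last] at hrU
  rw [hrU] at hy
  have hlow := hW.low'
  have hcol := hW.col'
  have hrb := hW.removable
  rw [app_last] at hrb
  have hfam := fun c => Extends.exists_families (c := c) h hm hB hW (app_last U b) hy hY
  set D := Set.range (app U b) with hD
  have hF : ∀ c, ∃ z, Removable D c → Family t (k + 1) (D \ {c}) z ∧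
      (∀ U, Lm t (k + 1) (z U) = ev c • z U) ∧ (c = b → z = y) ∧ (b ≠ c →
      ∀ P : Fin k → Box, Good P → Set.range P = (D \ {b}) \ {c} →
        t (k + 1) (y (app P c)) = cf c b • y (app P c) + (1 + cf c b) • z (app P b)) := by
    intro c
    by_cases hc : Removable D c
    · by_cases hbc : b = c
      · exact ⟨y, fun _ => ⟨hbc ▸ hy, hbc ▸ hY, fun _ => rfl, fun h => absurd hbc h⟩⟩
      · obtain ⟨z, h1, h2, h3⟩ := hfam c hc hbc
        exact ⟨z, fun _ => ⟨h1, h2, fun h => absurd h.symm hbc, fun _ => h3⟩⟩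
    · exact ⟨0, fun h => absurd h hc⟩
  choose F hF using hF
  have hFb : F b = y := (hF b hrb).2.2.1 rfl
  have hij : ((Fin.last k).castSucc : Fin (k + 2)).val + 1 = (Fin.last (k + 1)).val := by simp
  have cf_ne : ∀ c c', Removable D c → Removable D c' → c ≠ c' → ∀ P : Fin k → Box, Good P →
      Set.range P = (D \ {c}) \ {c'} → 1 + cf c' c ≠ 0 ∧ Apart c' c := by
    intro c c' hc hc' hne P hP hPr
    obtain ⟨g1, -⟩ := good_app_app hlow hcol hc hc' hne hP hPr
    have h1 := g1.one_add_cf_ne_zero hij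
    have h2 := g1.apart hij
    simp only [app_castSucc, app_last] at h1 h2
    exact ⟨h1 fun hh => hne (hc'.max _ hc.mem hh), h2⟩
  have first : ∀ c, Removable D c → b ≠ c → ∀ P : Fin k → Box, Good P →
      Set.range P = (D \ {b}) \ {c} →
      t (k + 1) (y (app P c)) = cf c b • y (app P c) + (1 + cf c b) • F c (app P b) :=
    fun c hc hbc => (hF c hc).2.2.2 hbc
  have second : ∀ c, Removable D c → b ≠ c → ∀ P : Fin k → Box, Good P →
      Set.range P = (D \ {b}) \ {c} →
      t (k + 1) (F c (app P b)) =
        (q - 1 - cf c b) • F c (app P b) + (1 + (q - 1 - cf c b)) • y (app P c) := by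
    intro c hc hbc P hP hPr
    exact aux_inv (t (k + 1)) (cf c b) q _ _ (cf_ne b c hrb hc hbc P hP hPr).1
      (first c hc hbc P hP hPr) (h.quad_apply (by omega) (by omega) _)
  have key : ∀ c c', Removable D c → Removable D c' → c ≠ c' → ∀ P : Fin k → Box, Good P →
      Set.range P = (D \ {c}) \ {c'} →
      t (k + 1) (F c (app P c')) =
        cf c' c • F c (app P c') + (1 + cf c' c) • F c' (app P c) := by
    intro c c' hc hc' hne P hP hPr
    by_cases hcb : b = c
    · subst hcb
      rw [hFb]
      exact first c' hc' hne P hP hPr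
    by_cases hcb' : b = c'
    · subst hcb'
      rw [Set.sdiff_sdiff_comm] at hPr
      rw [second c hc hcb P hP hPr, hFb, cf_symm (cf_ne b c hrb hc hcb P hP hPr).2]
    -- three removable boxes
    have hrP : Removable (Set.range P) b := by
      rw [hPr]; exact (hrb.diff hcb).diff hcb'
    obtain ⟨k, rfl⟩ : ∃ l, k = l + 1 := by
      obtain ⟨i, -⟩ := hrP.mem
      exact ⟨k - 1, by have := i.isLt; omega⟩
    -- By `Family.eq_zero` one filling of the remaining boxes suffices. The chosen one ends in b, so
    -- that exchanges lead back to the known family y.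
    obtain ⟨Q, hQ, hQr, hQb, hQbr⟩ := hP.exists_remove hrP
    rw [hPr] at hQr hQbr
    have fc := (hF c hc).1
    have fc' := (hF c' hc').1
    have f1 := fc.restrict (hc.isLow hlow) (fun x hx => hcol x hx.1) (hc'.diff hne.symm)
    have f2 := fc'.restrict (hc'.isLow hlow) (fun x hx => hcol x hx.1) (hc.diff hne)
    rw [Set.sdiff_sdiff_comm] at f2
    have f3 := ((f1.map (t (k + 1 + 1)) fun i hi => h.commute_T (by omega) (by omega)).sub
      (f1.smul (cf c' c))).sub (f2.smul (1 + cf c' c))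
    refine sub_eq_zero.1 ?_
    rw [← sub_sub]
    refine f3.eq_zero hQb hQbr ?_ P
    rw [sub_sub, sub_eq_zero]
    have hlast : ((Fin.last k).castSucc : Fin (k + 2)).val + 1 = (Fin.last (k + 1)).val := by simp
    -- the shapes after removing two boxes
    have sets : ∀ x x' x'' : Box, ((D \ {x}) \ {x'}) \ {x''} = D \ {x, x', x''} := by
      intro x x' x''; ext; simp; tauto
    have perm1 : ((D \ {b}) \ {c}) \ {c'} = Set.range Q := by
      rw [hQr]; simp only [sets]; congr 1; ext; simp; tauto
    have perm2 : ((D \ {b}) \ {c'}) \ {c} = Set.range Q := by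
      rw [hQr]; simp only [sets]; congr 1; ext; simp; tauto
    have low1 := fun x (hx : Removable D x) => hx.isLow hlow
    have col1 := fun x => fun y (hy : y ∈ D \ {x}) => hcol y hy.1
    obtain ⟨a1, a2, a3⟩ := good_app_app (low1 b hrb) (col1 b) (hc.diff (Ne.symm hcb))
      (hc'.diff (Ne.symm hcb')) hne hQ perm1.symm
    obtain ⟨b1, b2, b3⟩ := good_app_app (low1 b hrb) (col1 b) (hc'.diff (Ne.symm hcb'))
      (hc.diff (Ne.symm hcb)) hne.symm hQ perm2.symm
    obtain ⟨c1, -, c3⟩ := good_app_app (low1 c hc) (col1 c) (hrb.diff hcb) (hc'.diff hne.symm)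
      hcb' hQ (show Set.range Q = _ by rw [← perm1]; simp only [sets]; congr 1; ext; simp; tauto)
    obtain ⟨d1, -, d3⟩ := good_app_app (low1 c' hc') (col1 c') (hrb.diff hcb') (hc.diff hne)
      hcb hQ (show Set.range Q = _ by rw [← perm1]; simp only [sets]; congr 1; ext; simp; tauto)
    have act := fun (x : Box) (hx : Removable D x) (x' x'' : Box)
      (hg : Good (app (app Q x') x'')) (hr : Set.range (app (app Q x') x'') = D \ {x}) => by
        have := (hF x hx).1.act _ hg hr _ _ hlast
        rw [app_app_swap] at this
        simpa only [app_castSucc, app_last, Fin.val_last] using this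
    have hQc := (good_app_iff.1 b1).1
    have hQc' := (good_app_iff.1 a1).1
    -- Known edges of the hexagon, starting from the filling (Q, c', c, b). The missing edge joins
    -- (Q, b, c', c) to (Q, b, c, c').
    have f := act b hrb c' c a1 a3
    have ff1 := act b hrb c c' b1 b3
    have ff2 := act c hc c' b c1 c3
    have ff12 := act c' hc' c b d1 d3
    rw [hFb] at f ff1
    have gg := first c hc hcb (app Q c') hQc' a2
    have gg1 := first c' hc' hcb' (app Q c) hQc b2
    have gg2 := second c hc hcb (app Q c') hQc' a2
    have ap1 : Apart c' c := (cf_ne c c' hc hc' hne P hP hPr).2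
    have ap2 : Apart c b := (cf_ne b c hrb hc hcb _ hQc' a2).2
    have ap3 : Apart c' b := (cf_ne b c' hrb hc' hcb' _ hQc b2).2
    rw [cf_symm ap1] at ff1
    exact aux_braid_last (t (k + 1)) (t (k + 1 + 1)) (cf c' c) (cf c b) (cf c' b) q
      _ _ _ _ _ _ (cf_triple ap1 ap2 ap3) (cf_ne b c hrb hc hcb _ hQc' a2).1
      (cf_ne b c' hrb hc' hcb' _ hQc b2).1 (h.braid_apply (by omega) (by omega) _)
      f gg ff1 gg1 ff2 gg2 ff12
  have hzero : ∀ V : Fin (k + 1) → Box, ∀ c, Removable D c → ¬ (Good (app V c) ∧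
      Set.range (app V c) = D) → F c V = 0 := by
    intro V c hc hV
    refine (hF c hc).1.zero _ fun hh => hV ⟨good_app_iff.2 ⟨hh.1, ?_⟩, ?_⟩
    · rw [hh.2]; exact hc.addable hlow hcol
    · rw [range_app, hh.2, Set.insert_sdiff_singleton, Set.insert_eq_of_mem hc.mem]
  have hrem : ∀ V : Fin (k + 1) → Box, ∀ c, Good (app V c) → Set.range (app V c) = D →
      Removable D c ∧ Good V ∧ Set.range V = D \ {c} := by
    intro V c hg hr
    have h1 := hg.removable
    have h2 := hg.range_init
    rw [app_last, hr] at h1 h2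
    rw [app_comp_castSucc] at h2
    exact ⟨h1, (good_app_iff.1 hg).1, h2⟩
  refine ⟨fun V => if Good V ∧ Set.range V = D then F (V (Fin.last _)) (V ∘ Fin.castSucc) else 0,
    ⟨fun V hV => if_neg hV, fun V => ?_, fun V hV hVD i j hij' => ?_⟩, ?_⟩
  · split_ifs with hV
    · obtain ⟨V, c, rfl⟩ : ∃ V' a, V = app V' a := ⟨_, _, (app_init V).symm⟩
      rw [app_comp_castSucc, app_last]
      obtain ⟨hc, -, -⟩ := hrem V c hV.1 hV.2
      exact mem_Wt_app.2 ⟨(hF c hc).1.wt V, (hF c hc).2.1 V⟩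
    · exact Submodule.zero_mem _
  · obtain ⟨V, c, rfl⟩ : ∃ V' a, V = app V' a := ⟨_, _, (app_init V).symm⟩
    obtain ⟨hc, hgV, hrV⟩ := hrem V c hV hVD
    rw [if_pos ⟨hV, hVD⟩, app_comp_castSucc, app_last]
    obtain ⟨i, rfl⟩ : ∃ l : Fin (k + 1), i = l.castSucc :=
      ⟨i.castPred (by rintro rfl; have := j.isLt; simp at hij'; omega), by simp⟩
    revert hij'
    refine Fin.lastCases ?_ (fun j => ?_) j
    · intro hij'
      obtain rfl : i = Fin.last k := Fin.ext (by simpa using hij')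
      obtain ⟨V, c', rfl⟩ : ∃ V' a, V = app V' a := ⟨_, _, (app_init V).symm⟩
      rw [app_app_swap, app_castSucc, app_last, app_last, app_comp_castSucc, app_last,
        Fin.val_last]
      -- If c' is left of or above c, the exchanged filling is not standard and its vector is 0; the
      -- generator then acts by a scalar.
      by_cases hcc : Below c' c
      · rw [if_neg fun hh => Good.not_swap (U := app (app V c') c) hij (by simpa using hcc)
          (by rw [app_app_swap]; exact hh.1), smul_zero, add_zero]
        exact hA.T_apply h hm hV hcc (mem_Wt_app.2 ⟨(hF c hc).1.wt _, (hF c hc).2.1 _⟩)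
      · have hs : Good (app (app V c) c') := by
          rw [← app_app_swap]; exact hV.swap hij (by simpa using hcc)
        have hsr : Set.range (app (app V c) c') = D := by
          rw [← app_app_swap, range_swap, hVD]
        obtain ⟨hc', -, hrV'⟩ := hrem _ _ hs hsr
        rw [if_pos ⟨hs, hsr⟩]
        have hr2 := hgV.range_init
        rw [app_comp_castSucc, app_last, hrV] at hr2
        refine key c c' hc hc' ?_ V (good_app_iff.1 hgV).1 hr2
        rintro rfl
        exact hcc (Below.refl _)
    · intro hij'
      rw [app_swap, app_castSucc, app_castSucc, app_comp_castSucc, app_last]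
      have := (hF c hc).1.act V hgV hrV i j (by simpa using hij')
      split_ifs with hs
      · exact this
      · rw [hzero _ c hc hs] at this
        exact this
  · simp only
    rw [if_pos ⟨hW, hD.symm⟩, app_last, app_comp_castSucc, hFb]

theorem Extends.one : Extends t 1 := by
  classical
  intro W hW v hv
  refine ⟨fun V => if Good V ∧ Set.range V = Set.range W then v else 0, ⟨fun V hV => if_neg hV,
    fun V => ?_, fun V _ _ i j hij => by omega⟩, if_pos ⟨hW, rfl⟩⟩
  split_ifs with hV
  · suffices V = W by rwa [this]
    funext i
    obtain ⟨j, hj⟩ : V i ∈ Set.range W := hV.2 ▸ ⟨i, rfl⟩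
    rw [← hj, Subsingleton.elim i j]
  · exact Submodule.zero_mem _

/-- The statements are coupled. The exclusion of eigenvalues of L_{n+2} uses families with n + 1
boxes, and the gluing of families with n + 2 boxes uses the eigenvalues of L_{n+1}. -/
theorem branching_extends {m : ℕ} (h : IsRep m t) (n : ℕ) :
    (n + 1 ≤ m → Branching t n) ∧ (n + 1 ≤ m → Extends t (n + 1)) := by
  induction n with
  | zero => exact ⟨fun hm => Branching.zero h hm, fun _ => Extends.one⟩
  | succ n ih =>
    exact ⟨fun hm => Branching.succ h hm (ih.1 (by omega)) (ih.2 (by omega)),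
      fun hm => Extends.succ h hm (ih.1 (by omega)) (ih.2 (by omega))⟩

/-- The Jucys–Murphy element `L_{n+1}` has the expected eigenvalues on weight spaces. -/
theorem IsRep.branching {n : ℕ} (h : IsRep (n + 1) t) : Branching t n :=
  (branching_extends h n).1 le_rfl

/-- Weight vectors are part of seminormal families. -/
theorem IsRep.extends {n : ℕ} (h : IsRep n t) : Extends t n := by
  cases n with
  | zero => exact Extends.zero
  | succ n => exact (branching_extends h n).2 le_rfl

end weights

/-! ### The modules `M^{(lam, 1^k)}` -/

/-- The set of boxes of the bipartition `(lam, 1^k)`. -/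
def shape (lam : YoungDiagram) (k : ℕ) : Set Box :=
  {b | b.2 ∈ (if b.1 = 0 then lam else column k)}

theorem mem_shape {lam : YoungDiagram} {k : ℕ} {b : Box} :
    b ∈ shape lam k ↔ b.2 ∈ (if b.1 = 0 then lam else column k) := Iff.rfl

theorem isStandard_iff {n : ℕ} {lam : YoungDiagram} {k : ℕ} {U : Fin n → Box} :
    IsStandard lam (column k) U ↔ Good U ∧ Set.range U = shape lam k :=
  ⟨fun h => ⟨h.good, Set.ext h.shape⟩, fun h => h.1.isStandard fun b => by rw [h.2, mem_shape]⟩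

theorem Good.exists_shape {n : ℕ} {U : Fin n → Box} (hU : Good U) :
    ∃ lam k, IsStandard lam (column k) U := by
  obtain ⟨lam, mu, h⟩ := hU.exists_isStandard
  refine ⟨lam, mu.colLen 0, ?_⟩
  have : mu = column (mu.colLen 0) := by
    ext ⟨r, c⟩
    rw [YoungDiagram.mem_cells, YoungDiagram.mem_cells, mem_column, ← YoungDiagram.mem_iff_lt_colLen]
    constructor
    · intro hm
      obtain ⟨i, hi⟩ := (h.shape (1, r, c)).2 (by simpa using hm)
      have := hU.col i (by rw [hi]; simp)
      rw [hi] at this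
      simp only at this
      subst this
      exact ⟨hm, rfl⟩
    · rintro ⟨hm, rfl⟩
      exact hm
  rwa [← this]

theorem exists_finset_eq_shape (lam : YoungDiagram) (k : ℕ) :
    ∃ D : Finset Box, (D : Set Box) = shape lam k ∧ D.card = lam.card + k := by
  classical
  refine ⟨lam.cells.image (fun x => (0, x)) ∪ (column k).cells.image (fun x => (1, x)), ?_, ?_⟩
  · ext ⟨s, x⟩
    simp only [Finset.coe_union, Finset.coe_image, Set.mem_union, Set.mem_image, Finset.mem_coe,
      YoungDiagram.mem_cells, mem_shape]
    by_cases h0 : s = 0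
    · subst h0; simp
    · obtain rfl : s = 1 := by omega
      simp
  · rw [Finset.card_union_of_disjoint, Finset.card_image_of_injective, Finset.card_image_of_injective]
    · congr 1
      simp [column]
    · intro x y h; simpa using h
    · intro x y h; simpa using h
    · rw [Finset.disjoint_left]
      simp

theorem IsStandard.card_eq {n : ℕ} {lam : YoungDiagram} {k : ℕ} {U : Fin n → Box}
    (hU : IsStandard lam (column k) U) : lam.card + k = n := by
  obtain ⟨D, hD, hc⟩ := exists_finset_eq_shape lam k
  rw [← hc, ← Set.ncard_coe_finset, hD, ← (isStandard_iff.1 hU).2, ← Set.image_univ,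
    Set.ncard_image_of_injective _ hU.inj]
  simp

theorem exists_isStandard (n : ℕ) (lam : YoungDiagram) (k : ℕ) (h : lam.card + k = n) :
    ∃ U : Fin n → Box, IsStandard lam (column k) U := by
  obtain ⟨D, hD, hc⟩ := exists_finset_eq_shape lam k
  have h1 : IsLow (D : Set Box) := by
    rw [hD]
    intro b hb b' hb'
    rw [mem_shape] at hb ⊢
    rw [hb'.1]
    exact YoungDiagram.isLowerSet _ hb'.2 hb
  have h2 : ∀ b ∈ (D : Set Box), b.1 ≠ 0 → b.2.2 = 0 := by
    rw [hD]
    intro b hb h0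
    rw [mem_shape, if_neg h0, mem_column] at hb
    exact hb.2
  obtain ⟨U, hU, hUD⟩ := exists_good n D (hc.trans h) h1 h2
  exact ⟨U, isStandard_iff.2 ⟨hU, hUD.trans hD⟩⟩

/-- The images of the generators under a homomorphism from `R_n`, with natural numbers as
indices. -/
def seq {n : ℕ} {A : Type*} [Ring A] [Algebra K A] (ρ : R n →ₐ[K] A) (i : ℕ) : A :=
  if h : i < n then ρ (T ⟨i, h⟩) else 0

section seq

variable {n : ℕ} {A : Type*} [Ring A] [Algebra K A] (ρ : R n →ₐ[K] A)

theorem seq_of_lt {i : ℕ} (h : i < n) : seq ρ i = ρ (T ⟨i, h⟩) := dif_pos h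

theorem isRep_seq : IsRep n (seq ρ) where
  zero h := by
    rw [seq_of_lt ρ h, ← map_mul, T_zero _ rfl]; simp
  quad i h1 h := by
    rw [seq_of_lt ρ h, ← map_mul, T_quad _ h1]; simp
  braid i h1 h := by
    rw [seq_of_lt ρ h, seq_of_lt ρ (show i < n by omega), ← map_mul, ← map_mul, ← map_mul,
      ← map_mul, T_braid _ _ h1 rfl]
  four h := by
    rw [seq_of_lt ρ h, seq_of_lt ρ (show 0 < n by omega)]
    simp only [← map_mul, ← map_add, ← map_sub, ← map_smul]
    rw [T_four _ _ rfl rfl]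
  four' h := by
    rw [seq_of_lt ρ h, seq_of_lt ρ (show 0 < n by omega)]
    simp only [← map_mul, ← map_add, ← map_sub, ← map_smul]
    rw [T_four' _ _ rfl rfl]
  comm i j hij hj := by
    rw [seq_of_lt ρ hj, seq_of_lt ρ (show i < n by omega), ← map_mul, ← map_mul,
      T_comm _ _ (Or.inl hij)]

end seq

theorem Lm_seq {n : ℕ} {A : Type*} [Ring A] [Algebra K A] (ρ : R (n + 1) →ₐ[K] A) (j : ℕ)
    (hj : j < n + 1) : Lm (seq ρ) j = ρ (jm n j hj) := by
  induction j with
  | zero => simp [Lm, jm, e, seq_of_lt ρ hj]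
  | succ j ih => simp [Lm, jm, seq_of_lt ρ hj, ih (by omega)]

section irr

variable {n : ℕ} {lam : YoungDiagram} {k : ℕ}

variable (n lam k) in
/-- The operators of the generators on `M^{(lam, 1^k)}`. -/
def seqRep : ℕ → Module.End K (V n lam (column k)) := seq (rep n lam k)

theorem seq_rep {i : ℕ} (h : i < n) : seqRep n lam k i = op lam (column k) ⟨i, h⟩ := by
  rw [seqRep, seq_of_lt _ h, rep, lift_T]

theorem vec_act {U : Fin n → Box} (hU : IsStandard lam (column k) U) {i j : Fin n}
    (hij : i.val + 1 = j.val) : seqRep n lam k j (vec lam (column k) U) =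
      cf (U i) (U j) • vec lam (column k) U +
        (1 + cf (U i) (U j)) • vec lam (column k) (U ∘ Equiv.swap i j) := by
  rw [seq_rep j.isLt]
  change op lam (column k) j _ = _
  rw [op_pos j (by omega), opT_vec_std hij hU]

/-- The entry 1, if it is in the first tableau, occupies the corner of content 0, and q^0 = 1 is the
eigenvalue of e. -/
theorem vec_Lm_zero {U : Fin n → Box} (hU : IsStandard lam (column k) U) (i : Fin n)
    (hi : i.val = 0) :
    Lm (seqRep n lam k) 0 (vec lam (column k) U) = ev (U i) • vec lam (column k) U := by
  have h0 : 0 < n := by have := i.isLt; omega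
  obtain rfl : i = ⟨0, h0⟩ := Fin.ext hi
  have hq := q_ne_zero
  rw [Lm, seq_rep h0, LinearMap.smul_apply, LinearMap.add_apply, op_zero_vec _ rfl,
    Module.End.one_apply]
  by_cases h : (U ⟨0, h0⟩).1 = 0
  · have hc : content (U ⟨0, h0⟩) = 0 := by
      have h1 := hU.good.low ⟨0, h0⟩ ((U ⟨0, h0⟩).1, 0, 0)
        ⟨rfl, Prod.mk_le_mk.2 ⟨Nat.zero_le _, Nat.zero_le _⟩⟩
      obtain ⟨j, hj, hj2⟩ := h1
      have : j = ⟨0, h0⟩ := Fin.ext (by have : j.val ≤ 0 := hj; simpa using this)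
      rw [← this, hj2]
      rw [this] at hj2
      simp [content, h]
    rw [if_pos h, ev_zero h, hc, zpow_zero, sub_smul, one_smul, sub_add_cancel, smul_smul,
      inv_mul_cancel₀ hq, one_smul]
  · rw [if_neg h, ev_of_ne h]; simp

/-- For v = v_U and w its partner under an exchange: t⁻¹ T X T takes on v the eigenvalue that X has
on w. The hypothesis h is `cf_mul_ev`. -/
theorem aux_weight {F M : Type*} [Field F] [AddCommGroup M] [Module F M] (T X : M →ₗ[F] M)
    (A t x y : F) (v w : M) (ht : t ≠ 0) (h : A * (y - x) = (t - 1) * y)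
    (h1 : T v = A • v + (1 + A) • w) (h2 : X v = x • v) (h3 : X w = y • w)
    (h4 : T w = (t - 1 - A) • w + (1 + (t - 1 - A)) • v) : t⁻¹ • T (X (T v)) = y • v := by
  rw [h1, map_add, map_smul, map_smul, h2, h3]
  simp only [map_add, map_smul, h1, h4]
  have e1 : A * x = A * y - (t - 1) * y := by linear_combination -h
  have : A • x • (A • v + (1 + A) • w) + (1 + A) • y • ((t - 1 - A) • w + (1 + (t - 1 - A)) • v) =
      (A * x * A + (1 + A) * y * (t - A)) • v + (A * x + y * (t - 1 - A)) • (1 + A) • w := by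
    module
  rw [this, e1]
  have e2 : (A * y - (t - 1) * y) * A + (1 + A) * y * (t - A) = t * y := by ring
  have e3 : A * y - (t - 1) * y + y * (t - 1 - A) = 0 := by ring
  rw [e2, e3, zero_smul, add_zero, smul_smul, ← mul_assoc, inv_mul_cancel₀ ht, one_mul]

theorem aux_weight' {F M : Type*} [Field F] [AddCommGroup M] [Module F M] (T X : M →ₗ[F] M)
    (A t x y : F) (v : M) (ht : t ≠ 0) (h : A * (y - x) = (t - 1) * y)
    (hA : A ^ 2 = (t - 1) * A + t) (h1 : T v = A • v) (h2 : X v = x • v) :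
    t⁻¹ • T (X (T v)) = y • v := by
  rw [h1, map_smul, h2, map_smul, map_smul, h1, smul_smul, smul_smul, smul_smul]
  congr 1
  have : A * x * A = t * y := by linear_combination -A * h + y * hA
  rw [mul_assoc, mul_assoc, ← mul_assoc A, this, ← mul_assoc, inv_mul_cancel₀ ht, one_mul]

/-- The Jucys–Murphy elements act on the basis of `M^{(lam, 1^k)}` by the eigenvalues of the
boxes. -/
theorem vec_Lm {U : Fin n → Box} (hU : IsStandard lam (column k) U) (j : ℕ) (hj : j < n) :
    Lm (seqRep n lam k) j (vec lam (column k) U) =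
      ev (U ⟨j, hj⟩) • vec lam (column k) U := by
  induction j generalizing U with
  | zero => exact vec_Lm_zero hU _ rfl
  | succ j ih =>
    have hij : (⟨j, by omega⟩ : Fin n).val + 1 = (⟨j + 1, hj⟩ : Fin n).val := rfl
    have hv := vec_act hU hij
    have hap := hU.apart hij
    have hx := ih hU (by omega)
    rw [Lm, LinearMap.smul_apply, Module.End.mul_apply, Module.End.mul_apply]
    by_cases hb : Below (U ⟨j, by omega⟩) (U ⟨j + 1, hj⟩)
    · rw [vec_of_not _ (not_std_swap hij hb), smul_zero, add_zero] at hv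
      exact aux_weight' _ _ _ q _ _ _ q_ne_zero (cf_mul_ev hap) (hU.cf_quad hij hb) hv hx
    · have hs := hU.swap hij hb
      have hy := ih hs (by omega)
      have hw := vec_act hs hij
      have e : ((U ∘ Equiv.swap ⟨j, by omega⟩ ⟨j + 1, hj⟩) ∘
        Equiv.swap ⟨j, by omega⟩ ⟨j + 1, hj⟩) = U := by ext1 x; simp
      rw [e] at hw
      simp only [Function.comp_apply, Equiv.swap_apply_left, Equiv.swap_apply_right] at hw hy
      rw [cf_symm hap] at hw
      exact aux_weight _ _ _ q _ _ _ _ q_ne_zero (cf_mul_ev hap) hv hx hy hw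

theorem vec_family : Family (seqRep n lam k) n (shape lam k) (vec lam (column k)) where
  zero U hU := vec_of_not U (by rwa [isStandard_iff])
  wt U := by
    by_cases hU : IsStandard lam (column k) U
    · exact fun j => vec_Lm hU j j.isLt
    · rw [vec_of_not U hU]; exact Submodule.zero_mem _
  act U hU hD i j hij := vec_act (isStandard_iff.2 ⟨hU, hD⟩) hij

/-- A seminormal family defines a map from `M^{(lam, 1^k)}`. -/
theorem Family.exists_map {N : Type*} [AddCommGroup N] [Module K N] {t : ℕ → Module.End K N}
    (ρ : R n →ₐ[K] Module.End K N) (hρ : ∀ i : Fin n, ρ (T i) = t i) {z : (Fin n → Box) → N}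
    (hz : Family t n (shape lam k) z) :
    ∃ ψ : V n lam (column k) →ₗ[K] N, (∀ U, ψ (vec lam (column k) U) = z U) ∧
      ∀ x m, ψ (rep n lam k x m) = ρ x (ψ m) := by
  let ψ : V n lam (column k) →ₗ[K] N :=
    Finsupp.linearCombination K (fun U : StdTab n lam (column k) => z U.1)
  have hψ : ∀ U, ψ (vec lam (column k) U) = z U := by
    intro U
    by_cases hU : IsStandard lam (column k) U
    · rw [vec_of U hU]; simp [ψ]
    · rw [vec_of_not U hU, map_zero, hz.zero U (by rwa [isStandard_iff] at hU)]
  have hT : ∀ i, ψ ∘ₗ rep n lam k (T i) = ρ (T i) ∘ₗ ψ := by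
    intro i
    apply hom_ext'
    intro U hU
    have hU' := isStandard_iff.1 hU
    simp only [LinearMap.comp_apply, hψ, hρ]
    rw [show rep n lam k (T i) = seqRep n lam k i by rw [seqRep, seq_of_lt _ i.isLt]]
    rcases Nat.eq_zero_or_pos i.val with h0 | h0
    -- T_0 = q L_1 − 1, so its action is determined by the first eigenvalue.
    · have hq := q_ne_zero
      have a1 := vec_Lm_zero hU i h0
      have a2 := hz.wt U i
      rw [h0] at a2 ⊢
      simp only [Lm, LinearMap.smul_apply, LinearMap.add_apply, Module.End.one_apply] at a1 a2
      rw [inv_smul_eq_iff₀ hq] at a1 a2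
      rw [eq_sub_of_add_eq a1, eq_sub_of_add_eq a2, map_sub, map_smul, map_smul, hψ]
    · have hij : (prev i).val + 1 = i.val := by simp [prev]; omega
      rw [vec_act hU hij, hz.act U hU'.1 hU'.2 _ _ hij, map_add, map_smul, map_smul, hψ, hψ]
  refine ⟨ψ, hψ, fun x => ?_⟩
  let W : Submodule K (R n) :=
    { carrier := {x | ∀ m, ψ (rep n lam k x m) = ρ x (ψ m)}
      add_mem' := fun {a b} ha hb m => by
        rw [map_add, map_add, LinearMap.add_apply, LinearMap.add_apply, map_add, ha, hb]
      zero_mem' := fun m => by simp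
      smul_mem' := fun c a ha m => by
        rw [map_smul, map_smul, LinearMap.smul_apply, LinearMap.smul_apply, map_smul, ha] }
  have hW : W = ⊤ := eq_top_of_mul_T W (fun m => by simp) (by
    intro w hw i m
    rw [map_mul, map_mul, Module.End.mul_apply, Module.End.mul_apply, hw]
    exact congrArg _ (LinearMap.congr_fun (hT i) m))
  have : x ∈ W := hW ▸ Submodule.mem_top
  exact this

end irr

/-! ### Weight vectors in modules -/

theorem addPoly_eq {n : ℕ} (U : Fin n → Box) [DecidableEq K] : addPoly U =
    ∏ c ∈ (finite_addable U).toFinset.image ev, (Polynomial.X - Polynomial.C c) := by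
  rw [Finset.prod_image]
  · rfl
  · intro a ha b hb h
    exact Addable.eq_of_ev (by simpa using ha) (by simpa using hb) h

/-- The weight vectors of standard fillings span. -/
theorem IsRep.eq_top_of_Wt_le {N : Type*} [AddCommGroup N] [Module K N] {n : ℕ}
    {t : ℕ → Module.End K N} (ht : IsRep n t) (W : Submodule K N)
    (hW : ∀ U : Fin n → Box, Good U → Wt t U ≤ W) : W = ⊤ := by
  classical
  -- Downward induction on the number m of entries: `Branching` makes `Wt t U` the span of the
  -- spaces `Wt t (app U b)`. The weight space of the empty filling is everything.
  have key : ∀ d m : ℕ, m + d = n → ∀ U : Fin m → Box, Good U → Wt t U ≤ W := by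
    intro d
    induction d with
    | zero => rintro m rfl; exact hW
    | succ d ih =>
      intro m hm U hU v hv
      have hA := (ht.mono (show m + 1 ≤ n by omega)).branching U hU v hv
      rw [addPoly_eq] at hA
      refine mem_of_eigenvectors (Lm t m) (Wt t U) W
        (fun w hw => ht.Lm_mem_Wt (by omega) (by omega) hw) _ (fun c hc w hw hcw => ?_) hv hA
      obtain ⟨b, hb, rfl⟩ := Finset.mem_image.1 hc
      exact ih (m + 1) (by omega) (app U b) (good_app_iff.2 ⟨hU, by simpa using hb⟩)
        (mem_Wt_app.2 ⟨hw, hcw⟩)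
  rw [eq_top_iff]
  intro v _
  exact key n 0 (Nat.zero_add n) Fin.elim0 ⟨fun i => i.elim0, fun i => i.elim0, fun i => i.elim0⟩
    (fun j => j.elim0)

theorem Lm_intertwine {M N : Type*} [AddCommGroup M] [Module K M] [AddCommGroup N] [Module K N]
    {t : ℕ → Module.End K M} {t' : ℕ → Module.End K N} (ψ : M →ₗ[K] N) {j : ℕ}
    (h : ∀ i ≤ j, ∀ v, ψ (t i v) = t' i (ψ v)) (v : M) : ψ (Lm t j v) = Lm t' j (ψ v) := by
  induction j generalizing v with
  | zero => simp [Lm, h 0 le_rfl]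
  | succ j ih =>
    simp only [Lm, LinearMap.smul_apply, Module.End.mul_apply, map_smul, h (j + 1) le_rfl,
      ih (fun i hi => h i (by omega))]

theorem Family.intertwine {M N : Type*} [AddCommGroup M] [Module K M] [AddCommGroup N] [Module K N]
    {t : ℕ → Module.End K M} {t' : ℕ → Module.End K N} {n : ℕ} {D : Set Box}
    {z : (Fin n → Box) → M} (hz : Family t n D z) (ψ : M →ₗ[K] N)
    (h : ∀ i < n, ∀ v, ψ (t i v) = t' i (ψ v)) : Family t' n D (fun U => ψ (z U)) where
  zero U hU := by rw [hz.zero U hU, map_zero]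
  wt U j := by
    rw [← Lm_intertwine ψ (fun i hi => h i (by omega)), hz.wt U j, map_smul]
  act U hU hD i j hij := by
    rw [← h j j.isLt, hz.act U hU hD i j hij, map_add, map_smul, map_smul]

/-! ### Universal property, irreducibility and semisimplicity. -/

section ops

variable {n : ℕ} (N : Type*) [AddCommGroup N] [Module K N]

variable (n) in
/-- The operators of the generators on an `R_n`-module. -/
def ops [Module (R n) N] [IsScalarTower K (R n) N] : ℕ → Module.End K N :=
  seq (Algebra.lsmul K K N : R n →ₐ[K] Module.End K N)

variable {N}

theorem ops_apply [Module (R n) N] [IsScalarTower K (R n) N] (i : Fin n) (v : N) :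
    ops n N i v = (T i : R n) • v := by
  rw [ops, seq_of_lt _ i.isLt]; rfl

theorem isRep_ops [Module (R n) N] [IsScalarTower K (R n) N] : IsRep n (ops n N) := isRep_seq _

end ops

/-- The basis vector of a standard bitableau in `M^{(lam, 1^k)}`. -/
def bvec {n : ℕ} (lam : YoungDiagram) (k : ℕ) (U : Fin n → Box) : Irr n lam k :=
  vec lam (column k) U

section irr

variable {n : ℕ} {lam : YoungDiagram} {k : ℕ}

theorem seqRep_apply (i : Fin n) (v : Irr n lam k) : seqRep n lam k i v = (T i : R n) • v := by
  rw [seqRep, seq_of_lt _ i.isLt]; rfl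

/-- A linear map from `M^{(lam, 1^k)}` that commutes with the generators defines a seminormal
family. -/
theorem family_of_map {N : Type*} [AddCommGroup N] [Module K N] {t : ℕ → Module.End K N}
    (f : Irr n lam k →ₗ[K] N) (hf : ∀ (i : Fin n) v, f ((T i : R n) • v) = t i (f v)) :
    Family t n (shape lam k) (fun U => f (bvec lam k U)) :=
  Family.intertwine (t := seqRep n lam k) vec_family f fun i hi v =>
    (congrArg f (seqRep_apply ⟨i, hi⟩ v)).trans (hf ⟨i, hi⟩ v)

theorem irr_induction {N : Type*} [AddCommGroup N] [Module K N] {f g : Irr n lam k →ₗ[K] N}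
    (h : ∀ U, IsStandard lam (column k) U → f (bvec lam k U) = g (bvec lam k U)) : f = g :=
  hom_ext' (lam := lam) (mu := column k) (n := n) h

/-- Maps from `M^{(lam, 1^k)}` that agree on one basis vector are equal. -/
theorem map_ext {N : Type*} [AddCommGroup N] [Module K N] {t : ℕ → Module.End K N}
    {f g : Irr n lam k →ₗ[K] N} (hf : ∀ (i : Fin n) v, f ((T i : R n) • v) = t i (f v))
    (hg : ∀ (i : Fin n) v, g ((T i : R n) • v) = t i (g v)) {U : Fin n → Box}
    (hU : IsStandard lam (column k) U) (h : f (bvec lam k U) = g (bvec lam k U)) : f = g := by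
  have hU' := isStandard_iff.1 hU
  exact irr_induction fun U' _ => sub_eq_zero.1 (((family_of_map f hf).sub
    (family_of_map g hg)).eq_zero hU'.1 hU'.2 (sub_eq_zero.2 h) U')

/-- The universal property of `M^{(lam, 1^k)}` among `R_n`-modules. -/
theorem exists_hom {N : Type*} [AddCommGroup N] [Module K N] [Module (R n) N]
    [IsScalarTower K (R n) N] {U : Fin n → Box} (hU : IsStandard lam (column k) U) {v : N}
    (hv : v ∈ Wt (ops n N) U) : ∃ g : Irr n lam k →ₗ[R n] N, g (bvec lam k U) = v := by
  obtain ⟨hg, hs⟩ := isStandard_iff.1 hU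
  obtain ⟨z, hz, hzU⟩ := isRep_ops.extends U hg v hv
  rw [hs] at hz
  obtain ⟨ψ, hψ, hψ'⟩ := hz.exists_map (Algebra.lsmul K K N)
    (fun i => LinearMap.ext fun v => (ops_apply i v).symm)
  exact ⟨{ ψ with map_smul' := hψ' }, (hψ U).trans hzU⟩

/-- With `exists_hom` this identifies the homomorphisms from M^{(λ,1^k)} to N with the weight space
of N for any one standard U. -/
theorem hom_ext_bvec {N : Type*} [AddCommGroup N] [Module K N] [Module (R n) N]
    [IsScalarTower K (R n) N] {f g : Irr n lam k →ₗ[R n] N} {U : Fin n → Box}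
    (hU : IsStandard lam (column k) U) (h : f (bvec lam k U) = g (bvec lam k U)) : f = g := by
  have := map_ext (t := ops n N) (f := f.restrictScalars K) (g := g.restrictScalars K)
    (fun i v => by rw [ops_apply]; exact f.map_smul _ _)
    (fun i v => by rw [ops_apply]; exact g.map_smul _ _) hU h
  exact LinearMap.ext fun x => LinearMap.congr_fun this x

theorem Lm_coeff (x : V n lam (column k)) (j : Fin n) (U : StdTab n lam (column k)) :
    (Lm (seqRep n lam k) j x) U = ev (U.1 j) * x U := by
  induction x using Finsupp.induction_linear with
  | zero => simp
  | add x y hx hy => rw [map_add, Finsupp.add_apply, hx, hy, Finsupp.add_apply, mul_add]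
  | single W a =>
    have h := vec_Lm W.2 j j.isLt
    rw [vec_of W.1 W.2] at h
    have h2 : (Finsupp.single W a : V n lam (column k)) = a • Finsupp.single W 1 := by simp
    rw [h2, map_smul, h, Finsupp.smul_apply, Finsupp.smul_apply, Finsupp.smul_apply]
    by_cases hWU : W = U
    · subst hWU; simp [mul_comm]
    · simp [Finsupp.single_eq_of_ne' hWU]

/-- Each v_W is a joint eigenvector, and different fillings have different eigenvalue sequences
(`Good.eq_of_ev`); so only one coordinate of x can be nonzero. -/
theorem eq_smul_vec {U : Fin n → Box} (hU : Good U) {x : V n lam (column k)}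
    (hx : ∀ j : Fin n, Lm (seqRep n lam k) j x = ev (U j) • x) (h0 : x ≠ 0) :
    IsStandard lam (column k) U ∧ ∃ a : K, a ≠ 0 ∧ x = a • vec lam (column k) U := by
  have key : ∀ W : StdTab n lam (column k), x W ≠ 0 → W.1 = U := by
    intro W hW
    refine Good.eq_of_ev W.2.good hU fun j => ?_
    have h1 := Lm_coeff x j W
    rw [hx j, Finsupp.smul_apply, smul_eq_mul] at h1
    exact (mul_right_cancel₀ hW h1).symm
  obtain ⟨W, hW⟩ := Finsupp.ne_iff.1 h0
  have hWU := key W hW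
  subst hWU
  refine ⟨W.2, x W, hW, ?_⟩
  rw [vec_of W.1 W.2, Finsupp.smul_single, smul_eq_mul, mul_one]
  ext W'
  by_cases h : W' = W
  · subst h; simp
  · rw [Finsupp.single_eq_of_ne h]
    by_contra h'
    exact h (Subtype.ext (key W' h'))

/-- The weight spaces of `M^{(lam, 1^k)}` are the lines of the basis vectors. -/
theorem Wt_irr {U : Fin n → Box} (hU : Good U) {x : Irr n lam k}
    (hx : x ∈ Wt (ops n (Irr n lam k)) U) (h0 : x ≠ 0) :
    IsStandard lam (column k) U ∧ ∃ a : K, a ≠ 0 ∧ x = a • bvec lam k U := by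
  refine eq_smul_vec hU (fun j => ?_) h0
  have := Lm_intertwine (t := ops n (Irr n lam k)) (t' := seqRep n lam k) LinearMap.id (j := j)
    (fun i hi v => by
      have := ops_apply (n := n) ⟨i, by omega⟩ v
      rw [← seqRep_apply] at this
      exact this) x
  exact this.symm.trans (hx j)

theorem bvec_ne_zero {U : Fin n → Box} (hU : IsStandard lam (column k) U) : bvec lam k U ≠ 0 := by
  change vec lam (column k) U ≠ 0
  rw [vec_of U hU]
  simp

end irr

/-- A nonzero module contains a nonzero weight vector. -/
theorem exists_weight_vector {n : ℕ} (N : Type*) [AddCommGroup N] [Module K N] [Module (R n) N]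
    [IsScalarTower K (R n) N] [Nontrivial N] :
    ∃ U : Fin n → Box, Good U ∧ ∃ v ∈ Wt (ops n N) U, v ≠ 0 := by
  by_contra! h
  exact bot_ne_top (α := Submodule K N) ((isRep_ops (n := n)).eq_top_of_Wt_le ⊥ fun U hU v hv => h U hU v hv)

/-- A nonzero submodule contains a nonzero weight vector, which is a multiple of some v_U. The
quotient map kills this v_U and is therefore 0 by `hom_ext_bvec`. -/
theorem isSimpleModule_irr {n : ℕ} {lam : YoungDiagram} {k : ℕ} (h : lam.card + k = n) :
    IsSimpleModule (R n) (Irr n lam k) := by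
  obtain ⟨U₀, hU₀⟩ := exists_isStandard n lam k h
  have : Nontrivial (Irr n lam k) := ⟨_, _, bvec_ne_zero hU₀⟩
  rw [isSimpleModule_iff]
  refine { eq_bot_or_eq_top := fun p => or_iff_not_imp_left.2 fun hp => ?_ }
  have : Nontrivial p := Submodule.nontrivial_iff_ne_bot.2 hp
  obtain ⟨U, hU, v, hv, hv0⟩ := exists_weight_vector (n := n) p
  have hv' : (v : Irr n lam k) ∈ Wt (ops n (Irr n lam k)) U := fun j => by
    have := Lm_intertwine (t := ops n p) (t' := ops n (Irr n lam k)) (p.subtype.restrictScalars K)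
      (j := j) (fun i hi v => by
        have h1 := ops_apply (n := n) ⟨i, by omega⟩ v
        have h2 := ops_apply (n := n) ⟨i, by omega⟩ (v : Irr n lam k)
        simp only at h1 h2
        rw [h1]
        exact h2.symm) v
    rw [hv j] at this
    exact this.symm
  obtain ⟨hs, a, ha, hva⟩ := Wt_irr hU hv' (by simpa using hv0)
  have hp : bvec lam k U ∈ p := by
    have : bvec lam k U = a⁻¹ • (v : Irr n lam k) := by
      rw [hva, smul_smul, inv_mul_cancel₀ ha, one_smul]
    rw [this]
    exact Submodule.smul_of_tower_mem p _ v.2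
  have h1 : p.mkQ = 0 := by
    let : Module K (Irr n lam k ⧸ p) := Submodule.Quotient.module' p
    exact hom_ext_bvec hs (by simpa using hp)
  rw [← Submodule.ker_mkQ p, h1, LinearMap.ker_zero]

/-- The algebra `R_n` is semisimple. -/
instance isSemisimpleRing_R (n : ℕ) : IsSemisimpleRing (R n) := by
  -- Every weight vector of the left regular module lies in the image of such a homomorphism, so
  -- these images span R_n.
  let I := Σ x : {x : YoungDiagram × ℕ // x.1.card + x.2 = n}, (Irr n x.1.1 x.1.2 →ₗ[R n] R n)
  refine isSemisimpleModule_of_isSemisimpleModule_submodule'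
    (p := fun x : I => LinearMap.range x.2) (fun x => ?_) ?_
  · have := isSimpleModule_irr x.1.2
    exact IsSemisimpleModule.range x.2
  · have := (isRep_ops (n := n) (N := R n)).eq_top_of_Wt_le
      ((⨆ x : I, LinearMap.range x.2).restrictScalars K) (fun U hU v hv => by
        obtain ⟨lam, k, hs⟩ := hU.exists_shape
        obtain ⟨g, hg⟩ := exists_hom hs hv
        refine Submodule.mem_iSup_of_mem (⟨⟨(lam, k), hs.card_eq⟩, g⟩ : I) ⟨_, hg⟩)
    exact (Submodule.restrictScalars_eq_top_iff K (R n) _).1 this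

/-- Every simple `R_n`-module is isomorphic to some `M^{(lam, 1^k)}`. -/
theorem exists_equiv_irr {n : ℕ} (N : Type*) [AddCommGroup N] [Module K N] [Module (R n) N]
    [IsScalarTower K (R n) N] [IsSimpleModule (R n) N] :
    ∃ lam k, lam.card + k = n ∧ Nonempty (Irr n lam k ≃ₗ[R n] N) := by
  have := IsSimpleModule.nontrivial (R n) N
  obtain ⟨U, hU, v, hv, hv0⟩ := exists_weight_vector (n := n) N
  obtain ⟨lam, k, hs⟩ := hU.exists_shape
  obtain ⟨g, hg⟩ := exists_hom hs hv
  have := isSimpleModule_irr hs.card_eq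
  refine ⟨lam, k, hs.card_eq, ⟨LinearEquiv.ofBijective g (LinearMap.bijective_of_ne_zero ?_)⟩⟩
  rintro rfl
  exact hv0 hg.symm

/-! ### Adding boxes -/

section boxes

variable {lam mu : YoungDiagram} {k : ℕ}

theorem IsAddBox.exists_addable {j : ℤ} (h : IsAddBox lam j mu) (k : ℕ) :
    ∃ b : Box, Addable (shape lam k) b ∧ ev b = q ^ j ∧ shape mu k = insert b (shape lam k) ∧
      b.1 = 0 ∧ mu.cells = insert b.2 lam.cells := by
  obtain ⟨x, hx, hmu, rfl⟩ := h
  refine ⟨(0, x), ⟨?_, fun h => absurd rfl h, ?_⟩, ?_, ?_, rfl, hmu⟩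
  · rw [mem_shape]; simpa using hx
  · rintro ⟨s, y⟩ ⟨h1, h2⟩
    obtain rfl : s = 0 := h1
    have hy : y ∈ mu := YoungDiagram.isLowerSet _ (a := x) h2
      (by change x ∈ mu.cells; rw [hmu]; simp)
    rw [← YoungDiagram.mem_cells, hmu, Finset.mem_insert] at hy
    rcases hy with rfl | hy
    · exact Or.inl rfl
    · right; rw [mem_shape]; simpa using hy
  · rw [ev_zero rfl]; simp [content]
  · ext ⟨s, y⟩
    rw [Set.mem_insert_iff, mem_shape, mem_shape]
    by_cases hs : s = 0
    · subst hs
      simp only [if_true, Prod.mk.injEq, true_and]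
      rw [← YoungDiagram.mem_cells, hmu, Finset.mem_insert, YoungDiagram.mem_cells]
    · simp [hs]

theorem IsAddBox.unique {mu' : YoungDiagram} {j : ℤ} (h : IsAddBox lam j mu)
    (h' : IsAddBox lam j mu') : mu = mu' := by
  obtain ⟨b, hb, he, -, -, hc⟩ := h.exists_addable 0
  obtain ⟨b', hb', he', -, -, hc'⟩ := h'.exists_addable 0
  obtain rfl := hb.eq_of_ev hb' (he.trans he'.symm)
  exact YoungDiagram.ext (hc.trans hc'.symm)

theorem Addable.exists_isAddBox {b : Box} (hb : Addable (shape lam k) b) {j : ℤ}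
    (he : ev b = q ^ j) : ∃ mu, IsAddBox lam j mu := by
  obtain ⟨s, x⟩ := b
  have hs : s = 0 := by
    by_contra hs
    rw [ev_of_ne hs] at he
    exact zpow_ne_zero j q_ne_zero he.symm
  subst hs
  have hx : x ∉ lam := by simpa [mem_shape] using hb.notMem
  refine ⟨⟨Insert.insert x lam.cells, ?_⟩, x, hx, rfl, ?_⟩
  · intro y z hzy hy
    simp only [Finset.coe_insert, Set.mem_insert_iff, Finset.mem_coe, YoungDiagram.mem_cells] at hy ⊢
    rcases hy with rfl | hy
    · simpa [mem_shape] using hb.low (0, z) ⟨rfl, hzy⟩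
    · exact Or.inr (YoungDiagram.isLowerSet _ hzy hy)
  · rw [ev_zero rfl] at he
    have := q_zpow_injective he
    simpa [content] using this

theorem addable_column (lam : YoungDiagram) (k : ℕ) : Addable (shape lam k) (1, k, 0) := by
  refine ⟨by simp [mem_shape, mem_column], fun _ => rfl, ?_⟩
  rintro ⟨s, r, c⟩ ⟨h1, h2⟩
  obtain rfl : s = 1 := h1
  simp only [Prod.mk_le_mk] at h2
  simp [mem_shape, mem_column]
  omega

theorem shape_succ (lam : YoungDiagram) (k : ℕ) :
    shape lam (k + 1) = insert (1, k, 0) (shape lam k) := by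
  ext ⟨s, r, c⟩
  rw [Set.mem_insert_iff, mem_shape, mem_shape]
  by_cases hs : s = 0
  · subst hs; simp
  · obtain rfl : s = 1 := by omega
    simp [mem_column]
    omega

end boxes

/-! ### Branching -/

section branching

variable {n : ℕ} {lam mu : YoungDiagram} {k l : ℕ} {b : Box}

theorem isStandard_app (hb : Addable (shape lam k) b) (hs : shape mu l = insert b (shape lam k))
    {U : Fin n → Box} (hU : IsStandard lam (column k) U) : IsStandard mu (column l) (app U b) := by
  obtain ⟨h1, h2⟩ := isStandard_iff.1 hU
  exact isStandard_iff.2 ⟨good_app_iff.2 ⟨h1, h2 ▸ hb⟩, by rw [range_app, h2, hs]⟩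

/-- The embedding of `M^{(lam, 1^k)}` into the restriction of the module of a bipartition with one
more box. -/
theorem exists_branch_map (h : lam.card + k = n) (hb : Addable (shape lam k) b)
    (hs : shape mu l = insert b (shape lam k)) :
    ∃ φ : Irr n lam k →ₗ[K] Irr (n + 1) mu l, (∀ U, φ (bvec lam k U) = bvec mu l (app U b)) ∧
      (∀ x m, φ (x • m) = incl n x • φ m) ∧
      ∀ m, jm n n (Nat.lt_succ_self n) • φ m = ev b • φ m := by
  obtain ⟨U₀, hU₀⟩ := exists_isStandard n lam k h
  have hV₀ := isStandard_iff.1 (isStandard_app hb hs hU₀)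
  have hlow : IsLow (shape mu l) := hV₀.2 ▸ hV₀.1.low'
  have hcol : ∀ b ∈ shape mu l, b.1 ≠ 0 → b.2.2 = 0 := hV₀.2 ▸ hV₀.1.col'
  have hrem : Removable (shape mu l) b := by
    have := hV₀.1.removable
    rwa [hV₀.2, app_last] at this
  have hfam := (vec_family (n := n + 1) (lam := mu) (k := l)).restrict hlow hcol hrem
  have hD : shape mu l \ {b} = shape lam k := by
    rw [hs, Set.insert_sdiff_of_mem _ (Set.mem_singleton _),
      Set.sdiff_singleton_eq_self hb.notMem]
  rw [hD] at hfam
  obtain ⟨φ, hφ, hφ'⟩ : ∃ φ : Irr n lam k →ₗ[K] Irr (n + 1) mu l,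
      (∀ U, φ (bvec lam k U) = bvec mu l (app U b)) ∧ ∀ x m, φ (x • m) = incl n x • φ m :=
    hfam.exists_map ((rep (n + 1) mu l).comp (incl n)) (fun i => by
    rw [AlgHom.comp_apply, incl_T, seqRep, seq_of_lt _ (by omega)]; rfl)
  refine ⟨φ, hφ, hφ', fun m => ?_⟩
  let f : Irr n lam k →ₗ[K] Irr (n + 1) mu l :=
    (Algebra.lsmul K K (Irr (n + 1) mu l) (jm n n (Nat.lt_succ_self n))) ∘ₗ φ
  let g : Irr n lam k →ₗ[K] Irr (n + 1) mu l := ev b • φ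
  have : f = g := irr_induction fun U hU => by
    have h1 := vec_Lm (isStandard_app hb hs hU) n (Nat.lt_succ_self n)
    rw [seqRep, Lm_seq _ n (Nat.lt_succ_self n)] at h1
    have h2 : app U b ⟨n, Nat.lt_succ_self n⟩ = b := app_last U b
    rw [h2] at h1
    change jm n n (Nat.lt_succ_self n) • φ (bvec lam k U) = ev b • φ (bvec lam k U)
    rw [hφ]
    exact h1
  exact LinearMap.congr_fun this m

variable {N : Type*} [AddCommGroup N] [Module K N] [Module (R (n + 1)) N]
  [IsScalarTower K (R (n + 1)) N] {f : Irr n lam k →ₗ[K] N}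

theorem map_ops (hf : ∀ x m, f (x • m) = incl n x • f m) (i : Fin n) (v : Irr n lam k) :
    f ((T i : R n) • v) = ops (n + 1) N i (f v) := by
  rw [hf, incl_T, ← ops_apply]; rfl

/-- A generalized eigenvector of the last Jucys–Murphy element that comes from a basis vector of
`M^{(lam, 1^k)}` is an eigenvector. -/
theorem Lm_apply_of_mem_genEigenspace (hf : ∀ x m, f (x • m) = incl n x • f m) {a : K}
    (ha : ∀ m, ∃ j : ℕ, (jm n n (Nat.lt_succ_self n) - algebraMap K (R (n + 1)) a) ^ j • f m = 0)
    {U : Fin n → Box} (hU : IsStandard lam (column k) U) :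
    f (bvec lam k U) ∈ Wt (ops (n + 1) N) U ∧
      Lm (ops (n + 1) N) n (f (bvec lam k U)) = a • f (bvec lam k U) := by
  classical
  have ht : IsRep (n + 1) (ops (n + 1) N) := isRep_ops
  have hfam := family_of_map f (map_ops hf)
  set t := ops (n + 1) N with hto
  set v := f (bvec lam k U) with hv
  have hw : v ∈ Wt t U := hfam.wt U
  refine ⟨hw, ?_⟩
  have hA := ht.branching U hU.good v hw
  rw [addPoly_eq] at hA
  have hgen : ∀ m : N, m ∈ (Lm t n).maxGenEigenspace a ↔
      ∃ j : ℕ, (jm n n (Nat.lt_succ_self n) - algebraMap K (R (n + 1)) a) ^ j • m = 0 := by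
    intro m
    rw [Module.End.mem_maxGenEigenspace]
    have : Lm t n - a • 1 = Algebra.lsmul K K N
        (jm n n (Nat.lt_succ_self n) - algebraMap K (R (n + 1)) a) := by
      rw [map_sub, AlgHom.commutes, hto, ops, Lm_seq _ n (Nat.lt_succ_self n),
        Algebra.algebraMap_eq_smul_one]
    rw [this]
    simp only [← map_pow]
    rfl
  -- The polynomial `addPoly U` has simple roots, and a is the only possible eigenvalue on this
  -- intersection, so X − a already annihilates it.
  have key := aeval_eq_zero_of_eigenvalues (Lm t n) (Wt t U ⊓ (Lm t n).maxGenEigenspace a)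
    (fun w hw => ⟨ht.Lm_mem_Wt (by omega) (by omega) hw.1,
      Module.End.mapsTo_maxGenEigenspace_of_comm (Commute.refl _) a hw.2⟩) _
    (Polynomial.X - Polynomial.C a) ?_ ⟨hw, (hgen v).2 (ha _)⟩ hA
  · rw [map_sub, Polynomial.aeval_X, Polynomial.aeval_C, LinearMap.sub_apply,
      Algebra.algebraMap_eq_smul_one] at key
    simpa using sub_eq_zero.1 key
  · rintro c - w ⟨-, hw2⟩ hcw hw0
    obtain ⟨j, hj⟩ := (Module.End.mem_maxGenEigenspace _ _ _).1 hw2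
    have h1 := aeval_eigenvector (Lm t n) hcw ((Polynomial.X - Polynomial.C a) ^ j)
    rw [map_pow, map_sub, Polynomial.aeval_X, Polynomial.aeval_C,
      Algebra.algebraMap_eq_smul_one, hj, Polynomial.eval_pow] at h1
    exact eq_zero_of_pow_eq_zero ((smul_eq_zero.1 h1.symm).resolve_right hw0)

theorem eq_zero_of_forall_not_addable (hf : ∀ x m, f (x • m) = incl n x • f m) {a : K}
    (ha : ∀ m, ∃ j : ℕ, (jm n n (Nat.lt_succ_self n) - algebraMap K (R (n + 1)) a) ^ j • f m = 0)
    (hb : ∀ b, Addable (shape lam k) b → ev b ≠ a) : f = 0 :=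
  irr_induction fun U hU => by
    obtain ⟨h1, h2⟩ := Lm_apply_of_mem_genEigenspace hf ha hU
    exact isRep_ops.branching.eq_zero hU.good h1 h2
      (by rw [(isStandard_iff.1 hU).2]; exact hb)

/-- The universal property of the modules of the bipartitions with one more box. -/
theorem existsUnique_extension (h : lam.card + k = n) (hb : Addable (shape lam k) b)
    (hs : shape mu l = insert b (shape lam k)) {φ : Irr n lam k →ₗ[K] Irr (n + 1) mu l}
    (hφ : ∀ U, φ (bvec lam k U) = bvec mu l (app U b))
    (hφ' : ∀ x m, φ (x • m) = incl n x • φ m) (hf : ∀ x m, f (x • m) = incl n x • f m)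
    (ha : ∀ m, ∃ j : ℕ,
      (jm n n (Nat.lt_succ_self n) - algebraMap K (R (n + 1)) (ev b)) ^ j • f m = 0) :
    ∃! g : Irr (n + 1) mu l →ₗ[R (n + 1)] N, ∀ m, g (φ m) = f m := by
  obtain ⟨U, hU⟩ := exists_isStandard n lam k h
  have hU' := isStandard_app hb hs hU
  obtain ⟨h1, h2⟩ := Lm_apply_of_mem_genEigenspace hf ha hU
  -- The image of v_U under f has the weight of U followed by b, which is all that is needed to
  -- define g. One basis vector also decides the equality g ∘ φ = f and the uniqueness.
  obtain ⟨g, hg⟩ := exists_hom hU' (mem_Wt_app.2 ⟨h1, h2⟩)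
  refine ⟨g, fun m => ?_, fun g' hg' => hom_ext_bvec hU' ?_⟩
  · have hgφ : ∀ x m, (g.restrictScalars K ∘ₗ φ) (x • m) =
        incl n x • (g.restrictScalars K ∘ₗ φ) m := fun x m => by
      rw [LinearMap.comp_apply, hφ']; exact g.map_smul _ _
    have := map_ext (map_ops hgφ) (map_ops hf) hU (by
      rw [LinearMap.comp_apply, hφ]; exact hg)
    exact LinearMap.congr_fun this m
  · rw [hg, ← hg', hφ]

end branching

/-! ### Trace forms and ambidextrous adjunctions -/

/-- A symmetric trace form on a linear category whose pairings of morphism spaces are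
nondegenerate. -/
structure TraceForm (F : Type*) [Field F] (C : Type*) [Category C] [Preadditive C]
    [Linear F C] where
  /-- The trace of an endomorphism. -/
  tr (X : C) : (X ⟶ X) →ₗ[F] F
  comm {X Y : C} (f : X ⟶ Y) (g : Y ⟶ X) : tr X (f ≫ g) = tr Y (g ≫ f)
  nondeg {X Y : C} (f : X ⟶ Y) : f ≠ 0 → ∃ g : Y ⟶ X, tr X (f ≫ g) ≠ 0

namespace TraceForm

section

variable {F : Type*} [Field F] {C : Type*} [Category C] [Preadditive C] [Linear F C]
  (τ : TraceForm F C)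

/-- The trace pairing is injective in both arguments; as one side is finite dimensional, it is
perfect. -/
theorem existsUnique {X Y : C} [Module.Finite F (X ⟶ Y)] (φ : (X ⟶ Y) →ₗ[F] F) :
    ∃! k : Y ⟶ X, ∀ u : X ⟶ Y, τ.tr X (u ≫ k) = φ u := by
  let p : (Y ⟶ X) →ₗ[F] (X ⟶ Y) →ₗ[F] F :=
    LinearMap.mk₂ F (fun k u => τ.tr X (u ≫ k)) (by simp) (by simp) (by simp) (by simp)
  have hp : p.IsPerfPair := by
    apply LinearMap.IsPerfPair.of_injective'
    · rw [← LinearMap.ker_eq_bot, LinearMap.ker_eq_bot']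
      intro k hk
      by_contra h
      obtain ⟨u, hu⟩ := τ.nondeg k h
      rw [τ.comm] at hu
      exact hu (LinearMap.congr_fun hk u)
    · rw [← LinearMap.ker_eq_bot, LinearMap.ker_eq_bot']
      intro u hu
      by_contra h
      obtain ⟨k, hk⟩ := τ.nondeg u h
      exact hk (LinearMap.congr_fun hu k)
  obtain ⟨k, hk, huniq⟩ := hp.bijective_left.existsUnique φ
  exact ⟨k, fun u => LinearMap.congr_fun hk u, fun k' hk' => huniq k' (LinearMap.ext hk')⟩

end

variable {F : Type*} [Field F] {C D : Type*} [Category C] [Preadditive C] [Linear F C]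
  [Category D] [Preadditive D] [Linear F D] (τ : TraceForm F C) (σ : TraceForm F D)
  {G : C ⥤ D} {H : D ⥤ C} (adj : G ⊣ H)

/-- The bijection of an adjunction with linear right adjoint, as a linear map. -/
def homLinearEquiv [H.Additive] [H.Linear F] (adj : G ⊣ H) (X : C) (Y : D) : (G.obj X ⟶ Y) ≃ₗ[F] (X ⟶ H.obj Y) :=
  { adj.homEquiv X Y with
    map_add' := fun f g => by simp [Adjunction.homEquiv_unit]
    map_smul' := fun a f => by simp [Adjunction.homEquiv_unit, Functor.map_smul] }

/-- The morphisms `h` and `k` correspond to each other under trace duality. -/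
def Dual {X : C} {Y : D} (h : H.obj Y ⟶ X) (k : Y ⟶ G.obj X) : Prop :=
  ∀ u : G.obj X ⟶ Y, σ.tr _ (u ≫ k) = τ.tr _ (adj.homEquiv X Y u ≫ h)

/-- The underlying chain is Hom(HY, X) ≅ Hom(X, HY)* ≅ Hom(GX, Y)* ≅ Hom(Y, GX), where the outer
steps are trace duality and the middle one is the adjunction. -/
theorem existsUnique_dual [∀ X Y : D, Module.Finite F (X ⟶ Y)] [H.Additive] [H.Linear F] {X : C} {Y : D} (h : H.obj Y ⟶ X) :
    ∃! k : Y ⟶ G.obj X, Dual τ σ adj h k :=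
  σ.existsUnique (τ.tr X ∘ₗ Linear.rightComp F X h ∘ₗ (homLinearEquiv (F := F) adj X Y).toLinearMap)

theorem existsUnique_dual' [∀ X Y : C, Module.Finite F (X ⟶ Y)] [H.Additive] [H.Linear F] {X : C} {Y : D} (k : Y ⟶ G.obj X) :
    ∃! h : H.obj Y ⟶ X, Dual τ σ adj h k := by
  obtain ⟨h, hh, huniq⟩ := τ.existsUnique (σ.tr (G.obj X) ∘ₗ Linear.rightComp F (G.obj X) k ∘ₗ
    (homLinearEquiv (F := F) adj X Y).symm.toLinearMap)
  refine ⟨h, fun u => ?_, fun h' hh' => huniq h' fun w => ?_⟩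
  · rw [hh]
    exact congrArg (fun z => σ.tr _ (z ≫ k)) ((adj.homEquiv X Y).symm_apply_apply u).symm
  · refine Eq.trans ?_ (hh' ((adj.homEquiv X Y).symm w)).symm
    rw [Equiv.apply_symm_apply]

/-- This and `Dual.comp_right` are the naturality of the reversed adjunction. Naturality in X needs
the symmetry of the traces, because the morphism has to be moved around the cycle. -/
theorem Dual.comp_left {X : C} {Y Y' : D} {h : H.obj Y ⟶ X} {k : Y ⟶ G.obj X}
    (hk : Dual τ σ adj h k) (f : Y' ⟶ Y) : Dual τ σ adj (H.map f ≫ h) (f ≫ k) := fun u => by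
  rw [← Category.assoc, hk, Adjunction.homEquiv_naturality_right, Category.assoc]

theorem Dual.comp_right {X X' : C} {Y : D} {h : H.obj Y ⟶ X} {k : Y ⟶ G.obj X}
    (hk : Dual τ σ adj h k) (g : X ⟶ X') : Dual τ σ adj (h ≫ g) (k ≫ G.map g) := fun u => by
  rw [← Category.assoc, σ.comm, ← Category.assoc, hk, Adjunction.homEquiv_naturality_left,
    Category.assoc, τ.comm, Category.assoc]

/-- The trace forms turn an adjunction `G ⊣ H` into an adjunction `H ⊣ G`. -/
def adjunction [∀ X Y : C, Module.Finite F (X ⟶ Y)] [∀ X Y : D, Module.Finite F (X ⟶ Y)]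
    [H.Additive] [H.Linear F] : H ⊣ G :=
  Adjunction.mkOfHomEquiv
    { homEquiv := fun _ _ =>
        { toFun := fun h => (existsUnique_dual τ σ adj h).choose
          invFun := fun k => (existsUnique_dual' τ σ adj k).choose
          left_inv := fun h => ((existsUnique_dual' τ σ adj _).choose_spec.2 h
            (existsUnique_dual τ σ adj h).choose_spec.1).symm
          right_inv := fun k => ((existsUnique_dual τ σ adj _).choose_spec.2 k
            (existsUnique_dual' τ σ adj k).choose_spec.1).symm }
      homEquiv_naturality_left_symm := fun f k =>
        ((existsUnique_dual' τ σ adj (f ≫ k)).choose_spec.2 _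
          (Dual.comp_left τ σ adj (existsUnique_dual' τ σ adj k).choose_spec.1 f)).symm
      homEquiv_naturality_right := fun h g =>
        ((existsUnique_dual τ σ adj (h ≫ g)).choose_spec.2 _
          (Dual.comp_right τ σ adj (existsUnique_dual τ σ adj h).choose_spec.1 g)).symm }

end TraceForm

/-! ### Traces of maps between `R_n`-modules -/

section trace

variable {n : ℕ}

attribute [local instance] ModuleCat.moduleOfAlgebraModule

theorem isScalarTower_obj (X : FGModuleCat.{0} (R n)) : IsScalarTower K (R n) X.obj :=
  ⟨fun x y z => by rw [Algebra.smul_def, mul_smul]; rfl⟩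

attribute [local instance] isScalarTower_obj

instance finite_obj (X : FGModuleCat.{0} (R n)) : Module.Finite K X.obj :=
  have : Module.Finite (R n) X.obj := X.property
  Module.Finite.trans (R n) X.obj

/-- The linear map over `ℂ(q)` of a morphism of `R_n`-modules. -/
def toLin (X Y : FGModuleCat.{0} (R n)) : (X ⟶ Y) →ₗ[K] (X.obj →ₗ[K] Y.obj) where
  toFun f :=
    { toFun := f.hom.hom
      map_add' := f.hom.hom.map_add
      map_smul' := fun a x => f.hom.hom.map_smul (algebraMap K (R n) a) x }
  map_add' _ _ := rfl
  map_smul' _ _ := rfl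

theorem toLin_injective (X Y : FGModuleCat.{0} (R n)) : Function.Injective (toLin X Y) := by
  intro f g h
  apply FGModuleCat.hom_ext
  exact LinearMap.ext fun x => LinearMap.congr_fun h x

instance finite_hom (X Y : FGModuleCat.{0} (R n)) : Module.Finite K (X ⟶ Y) :=
  Module.Finite.of_injective (toLin X Y) (toLin_injective X Y)

/-- A linear map between semisimple modules has a pseudo-inverse. -/
theorem exists_pseudoinverse {S M N : Type*} [Ring S] [AddCommGroup M] [Module S M]
    [AddCommGroup N] [Module S N] [IsSemisimpleModule S M] [IsSemisimpleModule S N]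
    (f : M →ₗ[S] N) : ∃ g : N →ₗ[S] M, f ∘ₗ g ∘ₗ f = f := by
  obtain ⟨s, hs⟩ := IsSemisimpleModule.lifting_property f.rangeRestrict
    f.surjective_rangeRestrict LinearMap.id
  obtain ⟨g, hg⟩ := IsSemisimpleModule.extension_property (LinearMap.range f).subtype
    Subtype.val_injective s
  refine ⟨g, LinearMap.ext fun x => ?_⟩
  have h1 : g (f x) = s (f.rangeRestrict x) := LinearMap.congr_fun hg (f.rangeRestrict x)
  have h2 : f (s (f.rangeRestrict x)) = f x :=
    congrArg Subtype.val (LinearMap.congr_fun hs (f.rangeRestrict x))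
  rw [LinearMap.comp_apply, LinearMap.comp_apply, h1, h2]

variable (n) in
/-- The trace over `ℂ(q)` of endomorphisms of `R_n`-modules. -/
def traceForm : TraceForm K (FGModuleCat.{0} (R n)) where
  tr X := LinearMap.trace K X.obj ∘ₗ toLin X X
  comm f g := LinearMap.trace_comp_comm' (toLin _ _ f) (toLin _ _ g)
  nondeg {X Y} f hf := by
    obtain ⟨g, hg⟩ := exists_pseudoinverse f.hom.hom
    refine ⟨FGModuleCat.ofHom g, fun h => hf ?_⟩
    -- As f g f = f, the map x ↦ g (f x) is idempotent. In characteristic zero an idempotent of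
    -- trace 0 vanishes, and then so does f.
    have hi : IsIdempotentElem (toLin X X (f ≫ FGModuleCat.ofHom g)) :=
      LinearMap.ext fun x => congrArg g (LinearMap.congr_fun hg x)
    have h0 := LinearMap.IsIdempotentElem.eq_zero_of_trace_eq_zero hi h
    apply FGModuleCat.hom_ext
    rw [← hg]
    exact LinearMap.ext fun x => congrArg f.hom.hom (LinearMap.congr_fun h0 x)|>.trans (map_zero _)

instance iRes_additive (i : WithTop ℤ) : (iRes n i).Additive where
  map_add := rfl

instance iRes_linear (i : WithTop ℤ) : (iRes n i).Linear K where
  map_smul f a := by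
    apply FGModuleCat.hom_ext
    refine LinearMap.ext fun x => Subtype.ext ?_
    change algebraMap K (R (n + 1)) a • f.hom.hom x.1 = incl n (algebraMap K (R n) a) • f.hom.hom x.1
    rw [AlgHom.commutes]

/-- A left adjoint of the restriction functor is also a right adjoint. -/
def iResAdjunction {i : WithTop ℤ} {G : FGModuleCat.{0} (R n) ⥤ FGModuleCat.{0} (R (n + 1))}
    (adj : G ⊣ iRes n i) : iRes n i ⊣ G :=
  (traceForm n).adjunction (traceForm (n + 1)) adj

end trace

/-! ### The adjoints of the restriction functors -/

section adjoints

variable {n : ℕ} {lam mu : YoungDiagram} {k l : ℕ} {b : Box} {i : WithTop ℤ}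

attribute [local instance] ModuleCat.moduleOfAlgebraModule isScalarTower_obj

/-- A morphism to the restriction of a module, as a linear map to the module. -/
def resHom {Y : FGModuleCat.{0} (R (n + 1))} (f : irr n lam k ⟶ (iRes n i).obj Y) :
    Irr n lam k →ₗ[K] Y.obj where
  toFun m := (f.hom.hom m).1
  map_add' x y := congrArg Subtype.val (map_add f.hom.hom x y)
  map_smul' a x := by
    have h1 : a • x = (algebraMap K (R n) a) • x := (algebraMap_smul (R n) a x).symm
    rw [h1]
    refine (congrArg Subtype.val (f.hom.hom.map_smul (algebraMap K (R n) a) x)).trans ?_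
    change incl n (algebraMap K (R n) a) • (f.hom.hom x).1 =
      algebraMap K (R (n + 1)) a • (f.hom.hom x).1
    rw [AlgHom.commutes]

theorem resHom_smul {Y : FGModuleCat.{0} (R (n + 1))} (f : irr n lam k ⟶ (iRes n i).obj Y)
    (x : R n) (m : Irr n lam k) : resHom f (x • m) = incl n x • resHom f m :=
  congrArg Subtype.val (f.hom.hom.map_smul x m)

theorem resHom_mem {Y : FGModuleCat.{0} (R (n + 1))} (f : irr n lam k ⟶ (iRes n i).obj Y)
    (m : Irr n lam k) : ∃ j : ℕ, (jm n n (Nat.lt_succ_self n) -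
      algebraMap K (R (n + 1)) (eigenvalue i)) ^ j • resHom f m = 0 :=
  (f.hom.hom m).2

theorem resHom_injective {Y : FGModuleCat.{0} (R (n + 1))}
    {f g : irr n lam k ⟶ (iRes n i).obj Y} (h : ∀ m, resHom f m = resHom g m) : f = g :=
  FGModuleCat.hom_ext (LinearMap.ext fun m => Subtype.ext (h m))

/-- If a box with the right eigenvalue can be added to `(lam, 1^k)`, then the module of the new
bipartition corepresents the morphisms from `M^{(lam, 1^k)}` to restrictions. -/
theorem nonempty_corepresentableBy (h : lam.card + k = n) (hb : Addable (shape lam k) b)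
    (hs : shape mu l = insert b (shape lam k)) (hi : eigenvalue i = ev b) :
    Nonempty ((iRes n i ⋙ coyoneda.obj (Opposite.op (irr n lam k))).CorepresentableBy
      (irr (n + 1) mu l)) := by
  obtain ⟨φ, hφ, hφ', hφL⟩ := exists_branch_map h hb hs
  let ψ : Irr n lam k →ₗ[R n] genEigenspace n (eigenvalue i) (irr (n + 1) mu l).obj :=
    { toFun := fun m => ⟨φ m, 1, by
        rw [pow_one, hi]
        refine (sub_smul _ _ (φ m)).trans (sub_eq_zero.2 ?_)
        exact (hφL m).trans (algebraMap_smul (R (n + 1)) (ev b) (φ m)).symm⟩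
      map_add' := fun x y => Subtype.ext (map_add φ x y)
      map_smul' := fun x m => Subtype.ext (hφ' x m) }
  let ψ' : irr n lam k ⟶ (iRes n i).obj (irr (n + 1) mu l) := ⟨ModuleCat.ofHom ψ⟩
  have hψ : ∀ {Y : FGModuleCat.{0} (R (n + 1))} (g : irr (n + 1) mu l ⟶ Y) (m : Irr n lam k),
      resHom (ψ' ≫ (iRes n i).map g) m = g.hom.hom (φ m) := fun g m => rfl
  refine ⟨{ homEquiv := fun {Y} => Equiv.ofBijective (fun g => ψ' ≫ (iRes n i).map g) ⟨?_, ?_⟩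
            homEquiv_comp := fun g f => ?_ }⟩
  · intro g g' hg
    have hu := existsUnique_extension h hb hs hφ hφ' (f := resHom (ψ' ≫ (iRes n i).map g))
      (resHom_smul _) (hi ▸ resHom_mem _)
    refine FGModuleCat.hom_ext (hu.unique (fun m => (hψ g m).symm) fun m => ?_)
    exact (hψ g' m).symm.trans (congrArg (fun f => resHom f m) hg).symm
  · intro f
    obtain ⟨g, hg, -⟩ := existsUnique_extension h hb hs hφ hφ' (f := resHom f)
      (resHom_smul _) (hi ▸ resHom_mem _)
    exact ⟨⟨ModuleCat.ofHom g⟩, resHom_injective fun m => hg m⟩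
  · change ψ' ≫ (iRes n i).map (f ≫ g) = (ψ' ≫ (iRes n i).map f) ≫ (iRes n i).map g
    rw [Functor.map_comp, Category.assoc]

theorem nonempty_corepresentableBy_zero {X : FGModuleCat.{0} (R n)}
    (hX : ∀ (Y : FGModuleCat.{0} (R (n + 1))) (f : X ⟶ (iRes n i).obj Y), f = 0)
    {Z : FGModuleCat.{0} (R (n + 1))} (hZ : Limits.IsZero Z) :
    Nonempty ((iRes n i ⋙ coyoneda.obj (Opposite.op X)).CorepresentableBy Z) :=
  ⟨{ homEquiv := fun {Y} =>
      { toFun := fun _ => (0 : X ⟶ (iRes n i).obj Y)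
        invFun := fun _ => 0
        left_inv := fun _ => hZ.eq_of_src _ _
        right_inv := fun f => (hX Y f).symm }
     homEquiv_comp := fun {_ Y'} _ _ => (hX Y' _).symm }⟩

theorem hom_eq_zero (hb : ∀ b, Addable (shape lam k) b → ev b ≠ eigenvalue i)
    (Y : FGModuleCat.{0} (R (n + 1))) (f : irr n lam k ⟶ (iRes n i).obj Y) : f = 0 :=
  resHom_injective fun m => LinearMap.congr_fun
    (eq_zero_of_forall_not_addable (resHom_smul f) (resHom_mem f) hb) m

/-- The corepresenting object is the module of the enlarged shape if a box with the right eigenvalue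
can be added, and the zero module otherwise. -/
theorem leftAdjointObjIsDefined_irr (h : lam.card + k = n) :
    (iRes n i).leftAdjointObjIsDefined (irr n lam k) := by
  by_cases hb : ∃ b, Addable (shape lam k) b ∧ ev b = eigenvalue i
  · obtain ⟨b, hb, he⟩ := hb
    obtain ⟨U, hU⟩ := exists_isStandard n lam k h
    obtain ⟨h1, h2⟩ := isStandard_iff.1 hU
    obtain ⟨mu, l, hV⟩ := (good_app_iff.2 ⟨h1, h2.symm ▸ hb⟩ : Good (app U b)).exists_shape
    obtain ⟨e⟩ := nonempty_corepresentableBy (mu := mu) (l := l) h hb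
      (by rw [← (isStandard_iff.1 hV).2, range_app, h2]) he.symm
    exact e.isCorepresentable
  · obtain ⟨e⟩ := nonempty_corepresentableBy_zero (n := n) (i := i)
      (hom_eq_zero (lam := lam) (k := k) fun b hb' he => hb ⟨b, hb', he⟩) (Limits.isZero_zero (FGModuleCat.{0} (R (n + 1))))
    exact e.isCorepresentable

theorem leftAdjointObjIsDefined_of_iso {X X' : FGModuleCat.{0} (R n)} (e : X ≅ X')
    (h : (iRes n i).leftAdjointObjIsDefined X) : (iRes n i).leftAdjointObjIsDefined X' := by
  obtain ⟨Z, ⟨r⟩⟩ := h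
  exact (r.ofIso (Functor.isoWhiskerLeft (iRes n i) (coyoneda.mapIso e.op).symm)).isCorepresentable

/-- A complement decomposition of a module is a coproduct. -/
def isColimitOfIsCompl {S : Type} [Ring S] [IsNoetherianRing S] (X : FGModuleCat.{0} S)
    {p p' : Submodule S X.obj} (h : IsCompl p p') :
    haveI : Module.Finite S X.obj := X.property
    Limits.IsColimit (Limits.BinaryCofan.mk (P := X)
      (⟨ModuleCat.ofHom p.subtype⟩ : FGModuleCat.of S p ⟶ X)
      (⟨ModuleCat.ofHom p'.subtype⟩ : FGModuleCat.of S p' ⟶ X)) :=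
  haveI : Module.Finite S X.obj := X.property
  Limits.BinaryCofan.isColimitMk
    (fun s => ⟨ModuleCat.ofHom (LinearMap.ofIsCompl h s.inl.hom.hom s.inr.hom.hom)⟩)
    (fun s => FGModuleCat.hom_ext (LinearMap.ext fun x => LinearMap.ofIsCompl_apply_left h x))
    (fun s => FGModuleCat.hom_ext (LinearMap.ext fun x => LinearMap.ofIsCompl_apply_right h x))
    (fun s m h1 h2 => FGModuleCat.hom_ext (LinearMap.ofIsCompl_eq h
      (fun x => by rw [← h1]; rfl) (fun x => by rw [← h2]; rfl)).symm)

/-- Induction on the dimension over ℂ(q): by semisimplicity a simple submodule, isomorphic to some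
M^{(λ,1^k)}, splits off, and the objects on which a left adjoint is defined are closed under
coproducts. -/
theorem leftAdjointObjIsDefined (X : FGModuleCat.{0} (R n)) :
    (iRes n i).leftAdjointObjIsDefined X := by
  obtain ⟨d, hd⟩ : ∃ d, Module.finrank K X.obj = d := ⟨_, rfl⟩
  induction d using Nat.strong_induction_on generalizing X with
  | _ d ih =>
  have : Module.Finite (R n) X.obj := X.property
  rcases subsingleton_or_nontrivial X.obj with h0 | h0
  · obtain ⟨e⟩ := nonempty_corepresentableBy_zero (n := n) (i := i) (X := X)
      (fun Y f => FGModuleCat.hom_ext (LinearMap.ext fun x => by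
        rw [Subsingleton.elim x 0, map_zero, map_zero]))
      (Limits.isZero_zero (FGModuleCat.{0} (R (n + 1))))
    exact e.isCorepresentable
  · obtain ⟨p, hp⟩ := IsSemisimpleModule.exists_simple_submodule (R n) X.obj
    obtain ⟨p', hc⟩ := exists_isCompl p
    have h1 : (iRes n i).leftAdjointObjIsDefined (FGModuleCat.of (R n) p) := by
      obtain ⟨lam, k, h, ⟨e⟩⟩ := exists_equiv_irr (n := n) p
      exact leftAdjointObjIsDefined_of_iso (LinearEquiv.toFGModuleCatIso e)
        (leftAdjointObjIsDefined_irr h)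
    have h2 : (iRes n i).leftAdjointObjIsDefined (FGModuleCat.of (R n) p') := by
      refine ih (Module.finrank K p') ?_ (FGModuleCat.of (R n) p') rfl
      rw [← hd]
      refine Submodule.finrank_lt (s := p'.restrictScalars K) ?_
      intro h
      have hp' : p' = ⊤ := (Submodule.restrictScalars_eq_top_iff K (R n) _).1 h
      have h3 : p = ⊥ := by simpa [hp'] using hc.inf_eq_bot
      exact (isSimpleModule_iff_isAtom.1 hp).1 h3
    refine Functor.leftAdjointObjIsDefined_of_isColimit (isColimitOfIsCompl X hc) ?_
    rintro ⟨_ | _⟩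
    · exact h1
    · exact h2

theorem isRightAdjoint_iRes : (iRes n i).IsRightAdjoint :=
  Functor.isRightAdjoint_of_leftAdjointObjIsDefined_eq_top
    (eq_top_iff.2 fun X _ => leftAdjointObjIsDefined X)

variable {G : FGModuleCat.{0} (R n) ⥤ FGModuleCat.{0} (R (n + 1))}

theorem nonempty_iso_of_addable (adj : G ⊣ iRes n i) (h : lam.card + k = n)
    (hb : Addable (shape lam k) b) (hs : shape mu l = insert b (shape lam k))
    (hi : eigenvalue i = ev b) : Nonempty (G.obj (irr n lam k) ≅ irr (n + 1) mu l) := by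
  obtain ⟨e⟩ := nonempty_corepresentableBy h hb hs hi
  exact ⟨(adj.corepresentableBy _).uniqueUpToIso e⟩

theorem isZero_of_forall_not_addable (adj : G ⊣ iRes n i)
    (hb : ∀ b, Addable (shape lam k) b → ev b ≠ eigenvalue i) :
    Limits.IsZero (G.obj (irr n lam k)) := by
  obtain ⟨e⟩ := nonempty_corepresentableBy_zero (hom_eq_zero hb)
    (Limits.isZero_zero (FGModuleCat.{0} (R (n + 1))))
  exact (Limits.isZero_zero _).of_iso ((adj.corepresentableBy _).uniqueUpToIso e)

/-- A functor that is both a left and a right adjoint is exact. -/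
theorem exactFunctor_of_adjunctions {C D : Type*} [Category C] [Category D] {F : C ⥤ D} {H : D ⥤ C}
    (adj : F ⊣ H) (adj' : H ⊣ F) : exactFunctor C D F := by
  have := adj.leftAdjoint_preservesColimits
  have := adj'.rightAdjoint_preservesLimits
  exact (exactFunctor_iff F).2 ⟨inferInstance, inferInstance⟩

end adjoints

theorem eigenvalue_coe (j : ℤ) : eigenvalue (j : WithTop ℤ) = q ^ j := rfl

theorem eigenvalue_top : eigenvalue ⊤ = 0 := rfl

/-- The values of a left adjoint on the irreducible modules. -/
theorem leftAdjoint_irr {n : ℕ} {i : WithTop ℤ}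
    {G : FGModuleCat.{0} (R n) ⥤ FGModuleCat.{0} (R (n + 1))} (adj : G ⊣ iRes n i)
    {lam : YoungDiagram} {k : ℕ} (h : lam.card + k = n) :
    (∀ j : ℤ, i = (j : WithTop ℤ) →
      (∀ mu, IsAddBox lam j mu → Nonempty (G.obj (irr n lam k) ≅ irr (n + 1) mu k)) ∧
      ((¬ ∃ mu, IsAddBox lam j mu) → Limits.IsZero (G.obj (irr n lam k)))) ∧
    (i = ⊤ → Nonempty (G.obj (irr n lam k) ≅ irr (n + 1) lam (k + 1))) := by
  refine ⟨?_, ?_⟩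
  · rintro j rfl
    refine ⟨fun mu hmu => ?_, fun hmu => ?_⟩
    · obtain ⟨b, hb, he, hs, -, -⟩ := hmu.exists_addable k
      exact nonempty_iso_of_addable adj h hb hs ((eigenvalue_coe j).trans he.symm)
    · exact isZero_of_forall_not_addable adj fun b hb he =>
        hmu (hb.exists_isAddBox (he.trans (eigenvalue_coe j)))
  · rintro rfl
    exact nonempty_iso_of_addable adj h (addable_column lam k) (shape_succ lam k)
      (eigenvalue_top.trans (ev_of_ne (by simp)).symm)

end
end Mirabolic

/-- The index n plays the role of n − 1 in the informal statement, so n ≥ 1 there becomes any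
natural number here, and ∞ is `⊤`. -/
theorem mainTheorem6 (n : ℕ) (i : WithTop ℤ) :
    (Mirabolic.iRes n i).IsRightAdjoint ∧ (Mirabolic.iRes n i).IsLeftAdjoint ∧
    ∀ (Ind IndHat : FGModuleCat.{0} (Mirabolic.R n) ⥤ FGModuleCat.{0} (Mirabolic.R (n + 1)))
      (_ : Ind ⊣ Mirabolic.iRes n i) (_ : Mirabolic.iRes n i ⊣ IndHat),
      (∀ (lam : YoungDiagram) (k : ℕ), lam.card + k = n →
        IsSimpleModule (Mirabolic.R n) (Mirabolic.Irr n lam k) ∧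
        (∀ j : ℤ, i = (j : WithTop ℤ) →
          (∀ mu mu' : YoungDiagram,
            Mirabolic.IsAddBox lam j mu → Mirabolic.IsAddBox lam j mu' → mu = mu') ∧
          (∀ mu : YoungDiagram, Mirabolic.IsAddBox lam j mu →
            Nonempty (Ind.obj (Mirabolic.irr n lam k) ≅ Mirabolic.irr (n + 1) mu k) ∧
            Nonempty (IndHat.obj (Mirabolic.irr n lam k) ≅ Mirabolic.irr (n + 1) mu k)) ∧
          ((¬ ∃ mu : YoungDiagram, Mirabolic.IsAddBox lam j mu) →
            Limits.IsZero (Ind.obj (Mirabolic.irr n lam k)) ∧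
            Limits.IsZero (IndHat.obj (Mirabolic.irr n lam k)))) ∧
        (i = ⊤ →
          Nonempty (Ind.obj (Mirabolic.irr n lam k) ≅ Mirabolic.irr (n + 1) lam (k + 1)) ∧
          Nonempty (IndHat.obj (Mirabolic.irr n lam k) ≅ Mirabolic.irr (n + 1) lam (k + 1)))) ∧
      Nonempty (Ind ≅ IndHat) ∧
      exactFunctor _ _ Ind ∧ exactFunctor _ _ IndHat := by
  refine ⟨Mirabolic.isRightAdjoint_iRes, ?_, fun Ind IndHat adj adj' => ?_⟩
  · have := Mirabolic.isRightAdjoint_iRes (n := n) (i := i)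
    exact (Mirabolic.iResAdjunction (Adjunction.ofIsRightAdjoint (Mirabolic.iRes n i))).isLeftAdjoint
  -- Trace duality makes Ind a right adjoint of the restriction functor, as IndHat is by assumption.
  -- The values of IndHat then follow from those of a left adjoint.
  · have e : Ind ≅ IndHat := (Mirabolic.iResAdjunction adj).rightAdjointUniq adj'
    have adj'' : IndHat ⊣ Mirabolic.iRes n i := adj.ofNatIsoLeft e
    refine ⟨fun lam k h => ⟨Mirabolic.isSimpleModule_irr h, fun j hj => ?_, fun hi => ?_⟩, ⟨e⟩,
      Mirabolic.exactFunctor_of_adjunctions adj (Mirabolic.iResAdjunction adj),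
      Mirabolic.exactFunctor_of_adjunctions adj'' adj'⟩
    · obtain ⟨h1, h2⟩ := (Mirabolic.leftAdjoint_irr adj h).1 j hj
      obtain ⟨h1', h2'⟩ := (Mirabolic.leftAdjoint_irr adj'' h).1 j hj
      exact ⟨fun mu mu' hmu hmu' => hmu.unique hmu', fun mu hmu => ⟨h1 mu hmu, h1' mu hmu⟩,
        fun hmu => ⟨h2 hmu, h2' hmu⟩⟩
    · exact ⟨(Mirabolic.leftAdjoint_irr adj h).2 hi, (Mirabolic.leftAdjoint_irr adj'' h).2 hi⟩
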